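/- A Markov decision process (MDP) consists of a finite directed graph with $n\ge 1$ vertices and $m$ edges in which every vertex has an outgoing edge, together with a partition of the vertices into player-1 vertices and random vertices. At a random vertex the successor is chosen uniformly at random among the out-neighbours; at a player-1 vertex it is chosen by a strategy, which may depend on the whole history. For a set $\psi$ of infinite vertex sequences, the almost-sure winning set of $\psi$ is the set of vertices from which some strategy of player 1 makes the play belong to $\psi$ with probability $1$. For a vertex set $T$, the objective $\text{Büchi}(T)$ (resp. $\text{coBüchi}(T)$) is the set of sequences that visit some vertex of $T$ infinitely often (resp. no vertex of $T$ infinitely often). For pairs $(L_1,U_1),\dots,(L_k,U_k)$ of vertex sets, the Rabin objective is the set of sequences for which there is an $i$ such that some vertex of $L_i$ is visited infinitely often and no vertex of $U_i$ is visited infinitely often. Given $k\ge 1$ objectives $\psi_1,\dots,\psi_k$, the disjunctive objective is $\psi_1\cup\dots\cup\psi_k$, and the winning set of the disjunctive query is the union of the almost-sure winning sets of $\psi_1,\dots,\psi_k$. The computational model is the deterministic word RAM, with word length logarithmic in the length of the input (for $k$-CNF-SAT with $n$ variables, $O(n+\log(\text{input length}))$ bits). An MDP is given by the owners of its vertices and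 the list of its edges, and sets of vertices are given by listing their elements. The Strong Exponential Time Hypothesis (SETH) states that for each $\varepsilon>0$ there is a $k$ such that $k$-CNF-SAT on $n$ variables and $m$ clauses cannot be solved in time $O(2^{(1-\varepsilon)n}\,\mathrm{poly}(m))$. The Orthogonal Vectors Conjecture (OVC) states that for each $\varepsilon>0$ there is a constant $c$ such that no algorithm decides in time $O(N^{2-\varepsilon})$, for sets $S_1,S_2\subseteq\{0,1\}^d$ with $N\ge 1$, $|S_1|,|S_2|\le N$ and $d\le c\log_2 N$, whether there are $u\in S_1$ and $v\in S_2$ with $\sum_{i=1}^d u_iv_i=0$. **Theorem.** Assume SETH or OVC. Then for every $\varepsilon>0$ and for each of the following problems there is no algorithm with running time $O(\ell+m^{2-\varepsilon})$ and no algorithm with running time $O(\ell+(k\cdot m)^{1-\varepsilon})$, where $\ell$ is the length of the input, $m$ is the number of edges of the MDP and $k$ is the number of target sets (resp. Rabin pairs); in particular there is no $O(m^{2-\varepsilon})$ and no $O((k\cdot m)^{1-\varepsilon})$ algorithm: 1. computing the almost-sure winning set in an MDP with a disjunctive Büchi query; 2. computing the almost-sure winning set in an MDP with a disjunctive coBüchi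 objective, or with a disjunctive coBüchi query; 3. computing the almost-sure winning set in an MDP with a disjunctive coBüchi objective, or with a disjunctive coBüchi query, where all target sets are singletons; 4. computing the almost-sure winning set in an MDP with a Rabin objective. -/

import Mathlib

open MeasureTheory ProbabilityTheory

/-! ### Word RAM

Programs act on a finite set of registers and one memory, both holding natural numbers.
Every instruction takes one time unit. With word length `w`, an instruction can only be executed
if the number it writes is smaller than `2 ^ w`; otherwise the machine is stuck and the run does
not exist. -/

/-- The operations of the arithmetic unit. -/
inductive BinOp
  | add | sub | mul | div | mod | band | bor | bxor | shl | shr | lt | eq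

/-- Subtraction is truncated, division by zero yields zero, comparisons yield `1` or `0`. -/
def BinOp.eval : BinOp → ℕ → ℕ → ℕ
  | .add, a, b => a + b
  | .sub, a, b => a - b
  | .mul, a, b => a * b
  | .div, a, b => a / b
  | .mod, a, b => a % b
  | .band, a, b => a &&& b
  | .bor, a, b => a ||| b
  | .bxor, a, b => a ^^^ b
  | .shl, a, b => a <<< b
  | .shr, a, b => a >>> b
  | .lt, a, b => if a < b then 1 else 0
  | .eq, a, b => if a = b then 1 else 0

/-- Structured RAM programs; `r`, `a`, `b` are register numbers. -/
inductive RamProgram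
  /-- do nothing -/
  | nop
  /-- `r := c` -/
  | const (r c : ℕ)
  /-- `r := a o b` -/
  | op (o : BinOp) (r a b : ℕ)
  /-- `r := memory[a]` -/
  | load (r a : ℕ)
  /-- `memory[a] := r` -/
  | store (a r : ℕ)
  /-- first `p`, then `q` -/
  | seq (p q : RamProgram)
  /-- if `r ≠ 0` then `p` else `q` -/
  | cond (r : ℕ) (p q : RamProgram)
  /-- while `r ≠ 0` do `p` -/
  | loop (r : ℕ) (p : RamProgram)

/-- Contents of the registers and of the memory. -/
structure RamState where
  reg : ℕ → ℕ
  mem : ℕ → ℕ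

/-- `RamRun w p s s' t`: on a machine with `w`-bit words, program `p` started in state `s` halts
in state `s'` after exactly `t` time units. -/
inductive RamRun (w : ℕ) : RamProgram → RamState → RamState → ℕ → Prop
  | nop (s : RamState) : RamRun w .nop s s 1
  | const (s : RamState) (r c : ℕ) (h : c < 2 ^ w) :
      RamRun w (.const r c) s { s with reg := Function.update s.reg r c } 1
  | op (s : RamState) (o : BinOp) (r a b : ℕ) (h : o.eval (s.reg a) (s.reg b) < 2 ^ w) :
      RamRun w (.op o r a b) s
        { s with reg := Function.update s.reg r (o.eval (s.reg a) (s.reg b)) } 1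
  | load (s : RamState) (r a : ℕ) (h : s.mem (s.reg a) < 2 ^ w) :
      RamRun w (.load r a) s { s with reg := Function.update s.reg r (s.mem (s.reg a)) } 1
  | store (s : RamState) (a r : ℕ) (h : s.reg r < 2 ^ w) :
      RamRun w (.store a r) s { s with mem := Function.update s.mem (s.reg a) (s.reg r) } 1
  | seq (s s' s'' : RamState) (p q : RamProgram) (t t' : ℕ)
      (hp : RamRun w p s s' t) (hq : RamRun w q s' s'' t') :
      RamRun w (.seq p q) s s'' (t + t')
  | cond_true (s s' : RamState) (r : ℕ) (p q : RamProgram) (t : ℕ)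
      (h : s.reg r ≠ 0) (hp : RamRun w p s s' t) :
      RamRun w (.cond r p q) s s' (t + 1)
  | cond_false (s s' : RamState) (r : ℕ) (p q : RamProgram) (t : ℕ)
      (h : s.reg r = 0) (hq : RamRun w q s s' t) :
      RamRun w (.cond r p q) s s' (t + 1)
  | loop_stop (s : RamState) (r : ℕ) (p : RamProgram) (h : s.reg r = 0) :
      RamRun w (.loop r p) s s 1
  | loop_step (s s' s'' : RamState) (r : ℕ) (p : RamProgram) (t t' : ℕ)
      (h : s.reg r ≠ 0) (hp : RamRun w p s s' t) (hl : RamRun w (.loop r p) s' s'' t') :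
      RamRun w (.loop r p) s s'' (t + t' + 1)

/-- The input is written to memory cells `0, 1, …`; everything else is zero. -/
def RamState.init (input : List ℕ) : RamState where
  reg := fun _ => 0
  mem := fun i => input.getD i 0

/-- An algorithmic problem: the instances, their encoding as a sequence of words, and the
expected output. The word length of the machine on instance `x` is a constant multiple of
`logSize x`. -/
structure AlgProblem where
  Input : Type
  encode : Input → List ℕ
  logSize : Input → ℕ
  answer : Input → List ℕ

/-- There is an algorithm for `Q` that takes time `O(T)` on a word RAM with words of
`O(logSize)` bits; the output is found in memory cells `0, 1, …`. -/
def AlgProblem.SolvableIn (Q : AlgProblem) (T : Q.Input → ℝ) : Prop :=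
  ∃ (p : RamProgram) (c : ℕ) (C : ℝ), ∀ x : Q.Input, ∃ (s : RamState) (t : ℕ),
    RamRun (c * Q.logSize x) p (RamState.init (Q.encode x)) s t ∧
    (∀ (i : ℕ) (hi : i < (Q.answer x).length), s.mem i = (Q.answer x)[i]) ∧
    (t : ℝ) ≤ C * T x

/-- `[1]` for yes and `[0]` for no. -/
noncomputable def yesNo (p : Prop) : List ℕ := by
  classical exact if p then [1] else [0]

/-- The characteristic vector of a set of `{0, …, n - 1}`. -/
noncomputable def charVector {n : ℕ} (W : Set (Fin n)) : List ℕ := by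
  classical exact List.ofFn fun v => if v ∈ W then 1 else 0

/-! ### Orthogonal Vectors Conjecture -/

/-- Two sets of at most `N` Boolean vectors of dimension `d`. -/
structure OVInput where
  d : ℕ
  N : ℕ
  N_pos : 0 < N
  S₁ : List (Fin d → Bool)
  S₂ : List (Fin d → Bool)
  nodup₁ : S₁.Nodup
  nodup₂ : S₂.Nodup
  card₁ : S₁.length ≤ N
  card₂ : S₂.length ≤ N

def OVInput.HasOrthogonalPair (x : OVInput) : Prop :=
  ∃ u ∈ x.S₁, ∃ v ∈ x.S₂, ∑ i, (u i).toNat * (v i).toNat = 0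

/-- The input words: dimension, sizes of both sets, then all vectors coordinate by coordinate. -/
def OVInput.encode (x : OVInput) : List ℕ :=
  [x.d, x.S₁.length, x.S₂.length] ++
    (x.S₁ ++ x.S₂).flatMap fun u => List.ofFn fun i => (u i).toNat

/-- The orthogonal vectors problem in dimension `d ≤ c * log₂ N`. -/
noncomputable def ovProblem (c : ℝ) : AlgProblem where
  Input := { x : OVInput // (x.d : ℝ) ≤ c * Real.logb 2 x.N }
  encode x := x.1.encode
  logSize x := x.1.encode.length.size
  answer x := yesNo x.1.HasOrthogonalPair

/-- Orthogonal Vectors Conjecture: for no `ε > 0` can the orthogonal vectors problem in dimension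
`O(log N)` be solved in time `O(N ^ (2 - ε))`. -/
def OVC : Prop :=
  ∀ ε : ℝ, 0 < ε → ∃ c : ℝ,
    ¬ (ovProblem c).SolvableIn fun x => (x.1.N : ℝ) ^ (2 - ε)

/-! ### Strong Exponential Time Hypothesis -/

/-- A CNF formula with `n` variables; the literal `(i, b)` is true if variable `i` has
value `b`. -/
structure CNFInput where
  n : ℕ
  clauses : List (List (Fin n × Bool))

def CNFInput.Satisfiable (x : CNFInput) : Prop :=
  ∃ a : Fin x.n → Bool, ∀ C ∈ x.clauses, ∃ l ∈ C, a l.1 = l.2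

/-- The input words: number of variables, number of clauses, then for each clause its length
and its literals, where `(i, b)` is the word `2 * i + b`. -/
def CNFInput.encode (x : CNFInput) : List ℕ :=
  [x.n, x.clauses.length] ++
    x.clauses.flatMap fun C => C.length :: C.map fun l => 2 * (l.1 : ℕ) + l.2.toNat

/-- `k`-CNF-SAT. The machine has words of `O(n + log (input length))` bits, so that it can address
a memory of size `2 ^ O(n)`. -/
noncomputable def satProblem (k : ℕ) : AlgProblem where
  Input := { x : CNFInput // ∀ C ∈ x.clauses, C.length ≤ k }
  encode x := x.1.encode
  logSize x := x.1.n + x.1.encode.length.size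
  answer x := yesNo x.1.Satisfiable

/-- Strong Exponential Time Hypothesis: for each `ε > 0` there is a `k` such that `k`-CNF-SAT with
`n` variables and `m` clauses cannot be solved in time `O(2 ^ ((1 - ε) n) poly(m))`. -/
def SETH : Prop :=
  ∀ ε : ℝ, 0 < ε → ∃ k : ℕ, ∀ e : ℕ,
    ¬ (satProblem k).SolvableIn fun x =>
      (2 : ℝ) ^ ((1 - ε) * (x.1.n : ℝ)) * ((x.1.clauses.length : ℝ) + 1) ^ e

/-! ### Markov decision processes -/

/-- An MDP on the vertex set `V`: a directed graph in which every vertex has a successor, and the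
set of random vertices; all other vertices belong to player 1. At a random vertex the successor
is chosen uniformly at random. -/
structure MDP (V : Type) where
  edge : V → V → Prop
  random : Set V
  exists_edge : ∀ v, ∃ w, edge v w

namespace MDP

/-- The last vertex of the history `v₀, …, vₙ`. -/
def last {V : Type} {n : ℕ} (h : Finset.Iic n → V) : V := h ⟨n, Finset.mem_Iic.2 le_rfl⟩

/-- A player 1 strategy: it maps each history `v₀, …, vₙ` that ends in a player 1 vertex to a
successor of `vₙ` (its values on other histories are never used). -/
structure Strategy {V : Type} (P : MDP V) where
  choose : (n : ℕ) → (Finset.Iic n → V) → V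
  edge_choose : ∀ (n : ℕ) (h : Finset.Iic n → V),
    last h ∉ P.random → P.edge (last h) (choose n h)

variable {V : Type} [Finite V]

/-- The uniform distribution on the successors of `v`. -/
noncomputable def uniformSucc (P : MDP V) (v : V) : PMF V :=
  PMF.uniformOfFinset (Set.toFinite {w | P.edge v w}).toFinset (by
    obtain ⟨w, hw⟩ := P.exists_edge v
    exact ⟨w, by simpa using hw⟩)

/-- The distribution of the vertex that follows the history `h` under the strategy `σ`. -/
noncomputable def next (P : MDP V) (σ : P.Strategy) (n : ℕ) (h : Finset.Iic n → V) : PMF V := by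
  classical exact if last h ∈ P.random then P.uniformSucc (last h) else PMF.pure (σ.choose n h)

variable [MeasurableSpace V] [MeasurableSingletonClass V]

/-- `MDP.next` as a Markov kernel. -/
noncomputable def nextKernel (P : MDP V) (σ : P.Strategy) (n : ℕ) :
    Kernel (Finset.Iic n → V) V :=
  Kernel.ofFunOfCountable fun h => (P.next σ n h).toMeasure

instance (P : MDP V) (σ : P.Strategy) (n : ℕ) : IsMarkovKernel (P.nextKernel σ n) :=
  ⟨fun h => by
    change IsProbabilityMeasure (P.next σ n h).toMeasure
    infer_instance⟩

/-- The probability measure on infinite vertex sequences when the play starts in `v` and player 1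
plays `σ`. -/
noncomputable def playMeasure (P : MDP V) (σ : P.Strategy) (v : V) : Measure (ℕ → V) :=
  Kernel.traj (X := fun _ => V) (fun n => P.nextKernel σ n) 0 (fun _ => v)

/-- The almost-sure winning set of the objective `ψ`. -/
def almostSure (P : MDP V) (ψ : Set (ℕ → V)) : Set V :=
  {v | ∃ σ : P.Strategy, P.playMeasure σ v ψ = 1}

end MDP

/-- The vertices that occur infinitely often in `ω`. -/
def infSet {V : Type} (ω : ℕ → V) : Set V := {v | ∃ᶠ i in Filter.atTop, ω i = v}

def buchi {V : Type} (T : Set V) : Set (ℕ → V) := {ω | (infSet ω ∩ T).Nonempty}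

def coBuchi {V : Type} (T : Set V) : Set (ℕ → V) := {ω | infSet ω ∩ T = ∅}

/-- The Rabin objective of a list of pairs `(L, U)`. -/
def rabin {V : Type} (RP : List (Set V × Set V)) : Set (ℕ → V) :=
  {ω | ∃ LU ∈ RP, (LU.1 ∩ infSet ω).Nonempty ∧ LU.2 ∩ infSet ω = ∅}

/-! ### The algorithmic problems -/

/-- A concrete MDP with vertices `0, …, n - 1`, given by the owners of the vertices and a list of
its edges. -/
structure MDPInput where
  n : ℕ
  n_pos : 0 < n
  random : Fin n → Bool
  edges : List (Fin n × Fin n)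
  edges_nodup : edges.Nodup
  exists_edge : ∀ v, ∃ w, (v, w) ∈ edges

namespace MDPInput

def toMDP (x : MDPInput) : MDP (Fin x.n) where
  edge v w := (v, w) ∈ x.edges
  random := {v | x.random v = true}
  exists_edge := x.exists_edge

/-- The number of edges. -/
def m (x : MDPInput) : ℕ := x.edges.length

/-- The words for the MDP: `n`, `m`, for each vertex whether it is random, all edges. -/
def encode (x : MDPInput) : List ℕ :=
  [x.n, x.m] ++ (List.ofFn fun v => (x.random v).toNat) ++
    x.edges.flatMap fun e => [(e.1 : ℕ), (e.2 : ℕ)]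

end MDPInput

/-- The words for a set of vertices: its cardinality, then its elements. -/
def encodeVertexSet {n : ℕ} (T : Finset (Fin n)) : List ℕ :=
  T.card :: (T.sort (· ≤ ·)).map fun v => (v : ℕ)

/-- An MDP with target sets `T₁, …, Tₖ`, `k ≥ 1`. -/
structure TargetsInput extends MDPInput where
  targets : List (Finset (Fin n))
  targets_ne : targets ≠ []

/-- An MDP with Rabin pairs `(L₁, U₁), …, (Lₖ, Uₖ)`, `k ≥ 1`. -/
structure RabinInput extends MDPInput where
  pairs : List (Finset (Fin n) × Finset (Fin n))
  pairs_ne : pairs ≠ []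

/-- The words for the MDP, then `k` and the target sets. -/
def TargetsInput.encode (x : TargetsInput) : List ℕ :=
  x.toMDPInput.encode ++ x.targets.length :: x.targets.flatMap encodeVertexSet

/-- The words for the MDP, then `k` and the Rabin pairs. -/
def RabinInput.encode (x : RabinInput) : List ℕ :=
  x.toMDPInput.encode ++ x.pairs.length ::
    x.pairs.flatMap fun LU => encodeVertexSet LU.1 ++ encodeVertexSet LU.2

/-- The winning set of the disjunctive query of the Büchi objectives of the target sets. -/
def TargetsInput.buchiQueryWin (x : TargetsInput) : Set (Fin x.n) :=
  ⋃ T ∈ x.targets, x.toMDP.almostSure (buchi (T : Set (Fin x.n)))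

/-- The winning set of the disjunctive query of the coBüchi objectives of the target sets. -/
def TargetsInput.coBuchiQueryWin (x : TargetsInput) : Set (Fin x.n) :=
  ⋃ T ∈ x.targets, x.toMDP.almostSure (coBuchi (T : Set (Fin x.n)))

/-- The winning set of the disjunctive coBüchi objective of the target sets. -/
def TargetsInput.coBuchiObjectiveWin (x : TargetsInput) : Set (Fin x.n) :=
  x.toMDP.almostSure (⋃ T ∈ x.targets, coBuchi (T : Set (Fin x.n)))

/-- The winning set of the Rabin objective. -/
def RabinInput.rabinWin (x : RabinInput) : Set (Fin x.n) :=
  x.toMDP.almostSure (rabin (x.pairs.map fun LU => ((LU.1 : Set (Fin x.n)), (LU.2 : Set (Fin x.n)))))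

/-- A problem on MDPs, with the number `m` of edges and the number `k` of target sets
or pairs. -/
structure MDPProblem extends AlgProblem where
  m : Input → ℕ
  k : Input → ℕ

/-- Computing the a.s. winning set for a disjunctive Büchi query. -/
noncomputable def buchiQuery : MDPProblem where
  Input := TargetsInput
  encode x := x.encode
  logSize x := x.encode.length.size
  answer x := charVector x.buchiQueryWin
  m x := x.m
  k x := x.targets.length

/-- Computing the a.s. winning set for a disjunctive coBüchi objective. -/
noncomputable def coBuchiObjective : MDPProblem where
  Input := TargetsInput
  encode x := x.encode
  logSize x := x.encode.length.size
  answer x := charVector x.coBuchiObjectiveWin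
  m x := x.m
  k x := x.targets.length

/-- Computing the a.s. winning set for a disjunctive coBüchi query. -/
noncomputable def coBuchiQuery : MDPProblem where
  Input := TargetsInput
  encode x := x.encode
  logSize x := x.encode.length.size
  answer x := charVector x.coBuchiQueryWin
  m x := x.m
  k x := x.targets.length

/-- Computing the a.s. winning set for a disjunctive coBüchi objective with singleton
target sets. -/
noncomputable def singletonCoBuchiObjective : MDPProblem where
  Input := { x : TargetsInput // ∀ T ∈ x.targets, T.card = 1 }
  encode x := x.1.encode
  logSize x := x.1.encode.length.size
  answer x := charVector x.1.coBuchiObjectiveWin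
  m x := x.1.m
  k x := x.1.targets.length

/-- Computing the a.s. winning set for a disjunctive coBüchi query with singleton target sets. -/
noncomputable def singletonCoBuchiQuery : MDPProblem where
  Input := { x : TargetsInput // ∀ T ∈ x.targets, T.card = 1 }
  encode x := x.1.encode
  logSize x := x.1.encode.length.size
  answer x := charVector x.1.coBuchiQueryWin
  m x := x.1.m
  k x := x.1.targets.length

/-- Computing the a.s. winning set for a Rabin objective. -/
noncomputable def rabinObjective : MDPProblem where
  Input := RabinInput
  encode x := x.encode
  logSize x := x.encode.length.size
  answer x := charVector x.rabinWin
  m x := x.m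
  k x := x.pairs.length

/-- There is no `O(m ^ (2 - ε))` algorithm and no `O((k m) ^ (1 - ε))` algorithm for `Q`, for any
`ε > 0`. The algorithms that are excluded may in addition use time linear in the length of the
input, since the claim would otherwise hold trivially: `m ^ (2 - ε)` and `(k m) ^ (1 - ε)` time
units do not suffice to read the input if `k` is very large or very small, respectively. -/
def MDPProblem.NoFastAlgorithm (Q : MDPProblem) : Prop :=
  ∀ ε : ℝ, 0 < ε →
    (¬ Q.SolvableIn fun x => ((Q.encode x).length : ℝ) + (Q.m x : ℝ) ^ (2 - ε)) ∧
    (¬ Q.SolvableIn fun x => ((Q.encode x).length : ℝ) + ((Q.k x : ℝ) * (Q.m x : ℝ)) ^ (1 - ε))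

/-! All six problems receive one reduction from orthogonal vectors, and orthogonal vectors with an
arbitrary dimension is hard under either hypothesis.

The graph. In a round of the play, player 1 chooses a vector `u_j` at the start vertex `0`, and
chance draws a coordinate `i` (or returns to `0`). If `u_j` has a zero there, the play returns to
`0`; otherwise it moves on to a vertex `(k, b)`, where `b` is the bit of the second vector `v_k` at
`i`. The flag `c` selects one of two variants. With `c` set, every vertex except `0` is random and
each `(k, b)` leads back to `0`; the `k`-th target is `(k, 1)`. If `u_j` and `v_k` are orthogonal,
choosing `j` forever never reaches `(k, 1)`. If there is no orthogonal pair, every choice of `j`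
gives every `(k, 1)` a positive chance, so almost surely all targets recur. As `0` always recurs,
the same graph serves coBüchi objectives, coBüchi queries and Rabin objectives. Without `c`, the
coordinate vertices belong to player 1 and each `(k, b)` is absorbing; the `k`-th target set is `{0,
(k, 0)}`. For an orthogonal pair, choosing `j` and then `k` leads to `(k, 0)` or back to `0`
forever. Otherwise, for each `k`, with positive probability the first draw is a common one of `u_j`
and `v_k`, and the play is absorbed outside the target set. The probabilistic core is
`MDP.ae_recurrent`: almost surely, the vertices visited infinitely often form a nonempty set that is
closed under the moves of chance and in which every vertex has a successor. It rests on Lévy's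
conditional Borel–Cantelli lemma (`MDP.ae_frequently_step`).

The counting. The graph has `O(N(d+1))` edges and at most `N` targets, so both excluded running
times are at most a constant times `N^(2-ε) (d+1)^2`; this intermediate bound is
`OVTable.DecidedBy`. Under OVC the factor `(d+1)^2` is polylogarithmic and costs half of the saving
`ε`. Under SETH the variables are split into halves: the assignments to each half are vectors
indexed by the clauses, with a one where the clause is not yet satisfied, so `N = 2^⌈n/2⌉` and
`(d+1)^2` is polynomial in the number of clauses.

The machine. The reductions must themselves run on the word RAM. Expressions (`RamExpr`) and list
generators (`RamGen`) are compiled to programs with explicit costs and bounds on all intermediate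
values, and `RamGen.runs_transform` turns a generator into a program that ends exactly in the
initial state for its output, so that another algorithm can follow.
`OVTable.ReducesTo.exists_program` composes the graph generator with a hypothetical fast algorithm.
-/

/-! ### Running times up to an upper bound -/

/-- `p` leads from `s` to `s'` within `T` time units. -/
def RamRuns (w : ℕ) (p : RamProgram) (s s' : RamState) (T : ℕ) : Prop :=
  ∃ t, RamRun w p s s' t ∧ t ≤ T

/-- The word length enters a run only through upper bounds on written values. This allows an
algorithm to be run as a subroutine on a machine with longer words. -/
theorem RamRun.mono_word {w w' : ℕ} (hw : w ≤ w') {p : RamProgram} {s s' : RamState} {t : ℕ}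
    (h : RamRun w p s s' t) : RamRun w' p s s' t := by
  have hp : 2 ^ w ≤ 2 ^ w' := Nat.pow_le_pow_right (by norm_num) hw
  induction h with
  | nop s => exact .nop s
  | const s r c h => exact .const s r c (h.trans_le hp)
  | op s o r a b h => exact .op s o r a b (h.trans_le hp)
  | load s r a h => exact .load s r a (h.trans_le hp)
  | store s a r h => exact .store s a r (h.trans_le hp)
  | seq s s' s'' p q t t' _ _ ih ih' => exact .seq s s' s'' p q t t' ih ih'
  | cond_true s s' r p q t h _ ih => exact .cond_true s s' r p q t h ih
  | cond_false s s' r p q t h _ ih => exact .cond_false s s' r p q t h ih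
  | loop_stop s r p h => exact RamRun.loop_stop s r p h
  | loop_step s s' s'' r p t t' h _ _ ih ih' => exact .loop_step s s' s'' r p t t' h ih ih'

namespace RamRuns

variable {w : ℕ} {p q : RamProgram} {s s' s'' : RamState} {T T' : ℕ}

theorem mono (h : RamRuns w p s s' T) (hT : T ≤ T') : RamRuns w p s s' T' := by
  obtain ⟨t, h, ht⟩ := h
  exact ⟨t, h, ht.trans hT⟩

theorem seq (hp : RamRuns w p s s' T) (hq : RamRuns w q s' s'' T') :
    RamRuns w (.seq p q) s s'' (T + T') := by
  obtain ⟨t, h, ht⟩ := hp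
  obtain ⟨t', h', ht'⟩ := hq
  exact ⟨_, .seq _ _ _ _ _ _ _ h h', by omega⟩

theorem const (s : RamState) (r : ℕ) {c : ℕ} (h : c < 2 ^ w) :
    RamRuns w (.const r c) s { s with reg := Function.update s.reg r c } 1 :=
  ⟨1, .const s r c h, le_rfl⟩

theorem op (s : RamState) {o : BinOp} (r : ℕ) {a b : ℕ}
    (h : o.eval (s.reg a) (s.reg b) < 2 ^ w) :
    RamRuns w (.op o r a b) s
      { s with reg := Function.update s.reg r (o.eval (s.reg a) (s.reg b)) } 1 :=
  ⟨1, .op s o r a b h, le_rfl⟩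

theorem load (s : RamState) (r : ℕ) {a : ℕ} (h : s.mem (s.reg a) < 2 ^ w) :
    RamRuns w (.load r a) s { s with reg := Function.update s.reg r (s.mem (s.reg a)) } 1 :=
  ⟨1, .load s r a h, le_rfl⟩

theorem store (s : RamState) {a r : ℕ} (h : s.reg r < 2 ^ w) :
    RamRuns w (.store a r) s { s with mem := Function.update s.mem (s.reg a) (s.reg r) } 1 :=
  ⟨1, .store s a r h, le_rfl⟩

theorem cond_true {r : ℕ} (h : s.reg r ≠ 0) (hp : RamRuns w p s s' T) :
    RamRuns w (.cond r p q) s s' (T + 1) := by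
  obtain ⟨t, h', ht⟩ := hp
  exact ⟨_, .cond_true _ _ _ _ _ _ h h', by omega⟩

theorem cond_false {r : ℕ} (h : s.reg r = 0) (hq : RamRuns w q s s' T) :
    RamRuns w (.cond r p q) s s' (T + 1) := by
  obtain ⟨t, h', ht⟩ := hq
  exact ⟨_, .cond_false _ _ _ _ _ _ h h', by omega⟩

/-- A loop with an invariant that counts the iterations. -/
theorem loop {r n : ℕ} (Inv : ℕ → RamState → Prop) (T : ℕ → ℕ)
    (hstep : ∀ i < n, ∀ s, Inv i s → s.reg r ≠ 0 ∧ ∃ s', RamRuns w p s s' (T i) ∧ Inv (i + 1) s')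
    (hend : ∀ s, Inv n s → s.reg r = 0) (h0 : Inv 0 s) :
    ∃ s', RamRuns w (.loop r p) s s' (∑ i ∈ Finset.range n, (T i + 1) + 1) ∧ Inv n s' := by
  -- The induction is on the number `k` of remaining iterations, with a variable starting index,
  -- because a run of a loop is decomposed from its first iteration.
  suffices H : ∀ k i s, i + k = n → Inv i s →
      ∃ s', RamRuns w (.loop r p) s s' (∑ j ∈ Finset.range k, (T (i + j) + 1) + 1) ∧ Inv n s' by
    simpa using H n 0 s (by omega) h0
  intro k
  induction k with
  | zero =>
    intro i s hi hs
    obtain rfl : i = n := by omega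
    exact ⟨s, ⟨1, RamRun.loop_stop _ _ _ (hend s hs), by simp⟩, hs⟩
  | succ k ih =>
    intro i s hi hs
    obtain ⟨hr, s₁, ⟨t, h, ht⟩, hs₁⟩ := hstep i (by omega) s hs
    obtain ⟨s₂, ⟨t', h', ht'⟩, hs₂⟩ := ih (i + 1) s₁ (by omega) hs₁
    refine ⟨s₂, ⟨_, .loop_step _ _ _ _ _ _ _ hr h h', ?_⟩, hs₂⟩
    rw [Finset.sum_range_succ']
    simp only [add_zero]
    have : ∑ j ∈ Finset.range k, (T (i + 1 + j) + 1)
        = ∑ j ∈ Finset.range k, (T (i + (j + 1)) + 1) :=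
      Finset.sum_congr rfl fun j _ => by rw [show i + 1 + j = i + (j + 1) by omega]
    omega

end RamRuns

/-- An upper bound for the registers that `p` writes. -/
def RamProgram.regBound : RamProgram → ℕ
  | .nop => 0
  | .const r _ => r + 1
  | .op _ r _ _ => r + 1
  | .load r _ => r + 1
  | .store _ _ => 0
  | .seq p q => max p.regBound q.regBound
  | .cond _ p q => max p.regBound q.regBound
  | .loop _ p => p.regBound

/-- Only destination registers change. Hence finitely many registers have to be reset before a
second program can start from an initial state. -/
theorem RamRun.reg_eq {w : ℕ} {p : RamProgram} {s s' : RamState} {t : ℕ} (h : RamRun w p s s' t)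
    {r : ℕ} (hr : p.regBound ≤ r) : s'.reg r = s.reg r := by
  induction h with
  | nop | store | loop_stop => rfl
  | const s r' c h =>
    simp only [RamProgram.regBound] at hr
    simp [Function.update_of_ne (show r ≠ r' by omega)]
  | op s o r' a b h =>
    simp only [RamProgram.regBound] at hr
    simp [Function.update_of_ne (show r ≠ r' by omega)]
  | load s r' a h =>
    simp only [RamProgram.regBound] at hr
    simp [Function.update_of_ne (show r ≠ r' by omega)]
  | seq s s' s'' p q t t' _ _ ih ih' =>
    simp only [RamProgram.regBound, max_le_iff] at hr
    rw [ih' hr.2, ih hr.1]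
  | cond_true s s' r p q t h _ ih =>
    simp only [RamProgram.regBound, max_le_iff] at hr
    exact ih hr.1
  | cond_false s s' r p q t h _ ih =>
    simp only [RamProgram.regBound, max_le_iff] at hr
    exact ih hr.2
  | loop_step s s' s'' r p t t' h _ _ ih ih' =>
    rw [ih' hr, ih (by simpa only [RamProgram.regBound] using hr)]

/-- Set the registers below `R` to zero. -/
def RamProgram.clear : ℕ → RamProgram
  | 0 => .nop
  | R + 1 => .seq (.const R 0) (clear R)

theorem RamProgram.runs_clear (w R : ℕ) (s : RamState) (h : ∀ r, R ≤ r → s.reg r = 0) :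
    RamRuns w (.clear R) s ⟨fun _ => 0, s.mem⟩ (R + 1) := by
  induction R generalizing s with
  | zero =>
    refine ⟨1, ?_, le_rfl⟩
    have : s = ⟨fun _ => 0, s.mem⟩ := by
      obtain ⟨r, m⟩ := s
      simp only [RamState.mk.injEq, and_true]
      exact funext fun i => h i (Nat.zero_le _)
    nth_rw 1 [this]
    exact .nop _
  | succ R ih =>
    refine ((RamRuns.const s R (Nat.two_pow_pos w)).seq (ih _ fun r hr => ?_)).mono (by omega)
    rcases hr.eq_or_lt with rfl | hr
    · simp
    · simpa [Function.update_of_ne hr.ne'] using h r hr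

/-! ### A language of arithmetic expressions -/

/-- Expressions over the memory; `var i` is the `i`-th entry of the environment, and
`fold n init step` is the last member of the sequence that starts with `init` and whose
member `i + 1` is the value of `step`, `i` and member `i` having been put in front of the
environment. -/
inductive RamExpr
  | const (c : ℕ)
  | var (i : ℕ)
  | op (o : BinOp) (a b : RamExpr)
  | load (a : RamExpr)
  | fold (n init step : RamExpr)

/-- The members of the sequence computed by `RamExpr.fold`. -/
def foldSeq (init : ℕ) (step : ℕ → ℕ → ℕ) : ℕ → ℕ
  | 0 => init
  | i + 1 => step i (foldSeq init step i)

/-- The operations whose value is polynomial in their arguments. -/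
def BinOp.Tame : BinOp → Prop
  | .bor | .bxor | .shl => False
  | _ => True

/-- Exponents add: for products by the law of exponents, for sums because two numbers that are at
least `2` have a product no smaller than their sum. The other tame operations do not exceed an
argument or `1`. -/
theorem BinOp.Tame.eval_le {o : BinOp} (ho : o.Tame) {B p q a b : ℕ} (hB : 2 ≤ B) (hp : 0 < p)
    (hq : 0 < q) (ha : a ≤ B ^ p) (hb : b ≤ B ^ q) : o.eval a b ≤ B ^ (p + q) := by
  have hBp : 2 ≤ B ^ p := hB.trans (Nat.le_self_pow hp.ne' B)
  have hBq : 2 ≤ B ^ q := hB.trans (Nat.le_self_pow hq.ne' B)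
  have h1 : B ^ p + B ^ q ≤ B ^ (p + q) := by
    rw [pow_add]
    nlinarith
  have h2 : a * b ≤ B ^ (p + q) := by
    rw [pow_add]
    exact Nat.mul_le_mul ha hb
  cases o <;> simp only [BinOp.Tame] at ho <;> simp only [BinOp.eval]
  · omega
  · omega
  · exact h2
  · exact (Nat.div_le_self _ _).trans (by omega)
  · exact (Nat.mod_le _ _).trans (by omega)
  · exact Nat.and_le_left.trans (by omega)
  · rw [Nat.shiftRight_eq_div_pow]
    exact (Nat.div_le_self _ _).trans (by omega)
  · split_ifs <;> omega
  · split_ifs <;> omega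

namespace RamExpr

def eval (M : ℕ → ℕ) : RamExpr → List ℕ → ℕ
  | const c, _ => c
  | var i, env => env.getD i 0
  | op o a b, env => o.eval (a.eval M env) (b.eval M env)
  | load a, env => M (a.eval M env)
  | fold n init step, env =>
    foldSeq (init.eval M env) (fun i x => step.eval M (i :: x :: env)) (n.eval M env)

/-- If the environment and the memory are bounded by `B ≥ 2`, then the values of all
subexpressions are bounded by `B ^ e.size`. -/
def size : RamExpr → ℕ
  | const c => c + 1
  | var _ => 1
  | op _ a b => a.size + b.size
  | load a => a.size + 1
  | fold n init step => n.size + init.size + step.size + 1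

/-- All operations are tame, and all iterations have at most `B` steps and all of their values
are at most `B`. -/
def Ok (M : ℕ → ℕ) (B : ℕ) : RamExpr → List ℕ → Prop
  | const _, _ => True
  | var _, _ => True
  | op o a b, env => o.Tame ∧ a.Ok M B env ∧ b.Ok M B env
  | load a, env => a.Ok M B env
  | fold n init step, env =>
    n.Ok M B env ∧ init.Ok M B env ∧ n.eval M env ≤ B ∧
    (∀ i ≤ n.eval M env,
      foldSeq (init.eval M env) (fun i x => step.eval M (i :: x :: env)) i ≤ B) ∧
    ∀ i < n.eval M env, step.Ok M B
      (i :: foldSeq (init.eval M env) (fun i x => step.eval M (i :: x :: env)) i :: env)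

/-- The number of time units for the evaluation. -/
def cost (M : ℕ → ℕ) : RamExpr → List ℕ → ℕ
  | const _, _ => 1
  | var _, _ => 1
  | op _ a b, env => a.cost M env + b.cost M env + 1
  | load a, env => a.cost M env + 3
  | fold n init step, env =>
    init.cost M env + n.cost M env + 2 + ∑ i ∈ Finset.range (n.eval M env), (step.cost M
      (i :: foldSeq (init.eval M env) (fun i x => step.eval M (i :: x :: env)) i :: env) + 5)

/-- Evaluate an expression into register `t`, all registers from `t` on being available. The
variables are stored in the registers `ctx`. If `guarded` is set, then the memory is treated as
zero from the address in register `0` on. -/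
def compile (guarded : Bool) : RamExpr → List ℕ → ℕ → RamProgram
  | const c, _, t => .const t c
  -- There is no move instruction; the bitwise conjunction of a register with itself copies it.
  | var i, ctx, t => if h : i < ctx.length then .op .band t ctx[i] ctx[i] else .const t 0
  | op o a b, ctx, t =>
    .seq (a.compile guarded ctx t) (.seq (b.compile guarded ctx (t + 1)) (.op o t t (t + 1)))
  | load a, ctx, t =>
    .seq (a.compile guarded ctx t) (if guarded then
      .seq (.op .lt (t + 1) t 0) (.cond (t + 1) (.load t t) (.const t 0)) else .load t t)
  | fold n init step, ctx, t =>
    .seq (init.compile guarded ctx t) <| .seq (n.compile guarded ctx (t + 1)) <|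
    .seq (.const (t + 2) 0) <| .loop (t + 1) <|
    .seq (step.compile guarded ((t + 2) :: t :: ctx) (t + 3)) <|
    .seq (.op .band t (t + 3) (t + 3)) <| .seq (.const (t + 3) 1) <|
    .seq (.op .add (t + 2) (t + 2) (t + 3)) (.op .sub (t + 1) (t + 1) (t + 3))

theorem size_pos (e : RamExpr) : 0 < e.size := by
  induction e <;> simp only [size] <;> omega

/-- The value of a `fold` is one of its members, which `Ok` bounds by `B` outright. So the exponent
depends on the expression only and not on the number of iterations. -/
theorem eval_le {M : ℕ → ℕ} {B : ℕ} (hB : 2 ≤ B) (hM : ∀ a, M a ≤ B) (e : RamExpr)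
    {env : List ℕ} (henv : ∀ x ∈ env, x ≤ B) (hok : e.Ok M B env) : e.eval M env ≤ B ^ e.size := by
  have hself : ∀ (e : RamExpr) {x}, x ≤ B → x ≤ B ^ e.size := fun e x hx =>
    hx.trans (Nat.le_self_pow e.size_pos.ne' B)
  induction e generalizing env with
  | const c =>
    simp only [eval, size]
    calc c ≤ 2 ^ c := c.lt_two_pow_self.le
      _ ≤ B ^ c := Nat.pow_le_pow_left hB c
      _ ≤ B ^ (c + 1) := Nat.pow_le_pow_right (by omega) (by omega)
  | var i =>
    refine hself _ ?_
    simp only [eval]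
    rcases lt_or_ge i env.length with h | h
    · rw [List.getD_eq_getElem _ _ h]
      exact henv _ (List.getElem_mem h)
    · rw [List.getD_eq_default _ _ h]
      omega
  | op o a b iha ihb =>
    exact hok.1.eval_le hB a.size_pos b.size_pos (iha henv hok.2.1) (ihb henv hok.2.2)
  | load a => exact hself _ (hM _)
  | fold n init step => exact hself _ (hok.2.2.2.1 _ le_rfl)

/-- Registers below `t` are preserved, which keeps variables and pending intermediate results
intact. In the guarded mode register `0` marks the end of `M`, so that anything written behind that
address remains invisible to the expression. -/
theorem runs_compile {M : ℕ → ℕ} {B w : ℕ} {guarded : Bool} (hB : 2 ≤ B) (hM : ∀ a, M a ≤ B)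
    (e : RamExpr) (hw : B ^ e.size < 2 ^ w) (ctx : List ℕ) (t : ℕ) (s : RamState) (ht : 0 < t)
    (hctx : ∀ r ∈ ctx, r < t) (henv : ∀ r ∈ ctx, s.reg r ≤ B)
    (hok : e.Ok M B (ctx.map s.reg))
    (hraw : guarded = false → s.mem = M)
    (hguard : guarded = true → (∀ a < s.reg 0, s.mem a = M a) ∧ ∀ a, s.reg 0 ≤ a → M a = 0) :
    ∃ s', RamRuns w (e.compile guarded ctx t) s s' (e.cost M (ctx.map s.reg)) ∧
      s'.mem = s.mem ∧ (∀ r < t, s'.reg r = s.reg r) ∧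
      s'.reg t = e.eval M (ctx.map s.reg) := by
  have hBw : ∀ {e' : RamExpr}, B ^ e'.size < 2 ^ w → B < 2 ^ w := fun {e'} h =>
    (Nat.le_self_pow e'.size_pos.ne' B).trans_lt h
  have hmono : ∀ {k l : ℕ}, B ^ l < 2 ^ w → k ≤ l → B ^ k < 2 ^ w := fun h hkl =>
    (Nat.pow_le_pow_right (by omega) hkl).trans_lt h
  have hmap : ∀ {s s' : RamState} {ctx : List ℕ} {t : ℕ}, (∀ r ∈ ctx, r < t) →
      (∀ r < t, s'.reg r = s.reg r) → ctx.map s'.reg = ctx.map s.reg := fun h h' =>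
    List.map_congr_left fun r hr => h' r (h r hr)
  have henvmem : ∀ {s : RamState} {ctx : List ℕ}, (∀ r ∈ ctx, s.reg r ≤ B) →
      ∀ x ∈ ctx.map s.reg, x ≤ B := by
    intro s ctx h x hx
    obtain ⟨r, hr, rfl⟩ := List.mem_map.1 hx
    exact h r hr
  have hval := eval_le hB hM e (henvmem henv) hok
  induction e generalizing ctx t s with
  | const c =>
    refine ⟨_, RamRuns.const s t (hval.trans_lt hw), rfl, fun r hr => ?_, ?_⟩
    · simp [Function.update_of_ne hr.ne]
    · simp [eval]
  | var i =>
    by_cases h : i < ctx.length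
    · simp only [compile, h, dif_pos, cost]
      have hr := henv _ (List.getElem_mem h)
      refine ⟨_, RamRuns.op s t ?_, rfl, fun r hr => ?_, ?_⟩
      · simp only [BinOp.eval, Nat.and_self]
        exact hr.trans_lt (hBw hw)
      · simp [Function.update_of_ne hr.ne]
      · simp [eval, BinOp.eval, h]
    · simp only [compile, h, dif_neg, not_false_eq_true, cost]
      refine ⟨_, RamRuns.const s t (Nat.two_pow_pos w), rfl, fun r hr => ?_, ?_⟩
      · simp [Function.update_of_ne hr.ne]
      · simp [eval, h]
  | op o a b iha ihb =>
    have hok' := hok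
    obtain ⟨-, hoka, hokb⟩ := hok
    obtain ⟨s₁, h₁, hm₁, hr₁, hv₁⟩ := iha (hmono hw (by simp [size])) ctx t s ht hctx henv hoka
      hraw hguard (eval_le hB hM a (henvmem henv) hoka)
    have hc₁ := hmap hctx hr₁
    obtain ⟨s₂, h₂, hm₂, hr₂, hv₂⟩ := ihb (hmono hw (by simp [size])) ctx (t + 1) s₁ (by omega)
      (fun r hr => (hctx r hr).trans (by omega)) (fun r hr => by
        rw [hr₁ r (hctx r hr)]; exact henv r hr) (by rwa [hc₁]) (fun h => hm₁.trans (hraw h))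
      (fun h => by rw [hm₁, hr₁ 0 ht]; exact hguard h)
      (by rw [hc₁]; exact eval_le hB hM b (henvmem henv) hokb)
    rw [hc₁] at h₂ hv₂
    have hv₁' : s₂.reg t = a.eval M (ctx.map s.reg) := by rw [hr₂ t (by omega), hv₁]
    have hres : o.eval (s₂.reg t) (s₂.reg (t + 1)) = (op o a b).eval M (ctx.map s.reg) := by
      rw [hv₁', hv₂]; rfl
    refine ⟨_, (h₁.seq (h₂.seq (RamRuns.op s₂ t (o := o) ?_))).mono ?_, ?_, fun r hr => ?_, ?_⟩
    · rw [hres]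
      exact hval.trans_lt hw
    · simp only [cost]
      omega
    · exact hm₂.trans hm₁
    · simp [Function.update_of_ne hr.ne, hr₂ r (by omega), hr₁ r hr]
    · simp [hres]
  | load a iha =>
    obtain ⟨s₁, h₁, hm₁, hr₁, hv₁⟩ := iha (hmono hw (by simp [size])) ctx t s ht hctx henv hok
      hraw hguard (eval_le hB hM a (henvmem henv) hok)
    cases guarded with
    | false =>
      have hmem : s₁.mem (s₁.reg t) = M (a.eval M (ctx.map s.reg)) := by
        rw [hm₁, hraw rfl, hv₁]
      refine ⟨_, (h₁.seq (RamRuns.load s₁ t (a := t) ?_)).mono ?_, hm₁, fun r hr => ?_, ?_⟩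
      · rw [hmem]
        exact (hM _).trans_lt (hBw hw)
      · simp only [cost]
        omega
      · simp [Function.update_of_ne hr.ne, hr₁ r hr]
      · simp [hmem, eval]
    | true =>
      obtain ⟨hg, hz⟩ := hguard rfl
      have h1w : 1 < 2 ^ w := lt_of_lt_of_le (by omega) (hBw hw).le
      have hlt : RamRuns w (.op .lt (t + 1) t 0) s₁ _ 1 := RamRuns.op s₁ (t + 1) (by
        simp only [BinOp.eval]
        split_ifs <;> omega)
      by_cases hlt' : s₁.reg t < s₁.reg 0
      · have hmem : s₁.mem (s₁.reg t) = M (a.eval M (ctx.map s.reg)) := by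
          rw [hm₁, hv₁]
          rw [hv₁, hr₁ 0 ht] at hlt'
          exact hg _ hlt'
        refine ⟨_, (h₁.seq (hlt.seq (RamRuns.cond_true ?_ (RamRuns.load _ t (a := t) ?_)))).mono ?_,
          ?_, fun r hr => ?_, ?_⟩
        · simp [BinOp.eval, hlt']
        · simp only [ne_eq, Nat.left_eq_add, one_ne_zero, not_false_eq_true,
            Function.update_of_ne, hmem]
          exact (hM _).trans_lt (hBw hw)
        · simp only [cost]
          omega
        · exact hm₁
        · simp [Function.update_of_ne hr.ne, Function.update_of_ne (show r ≠ t + 1 by omega),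
            hr₁ r hr]
        · simp [hmem, eval]
      · refine ⟨_, (h₁.seq (hlt.seq (RamRuns.cond_false ?_ (RamRuns.const _ t ?_)))).mono ?_,
          ?_, fun r hr => ?_, ?_⟩
        · simp [BinOp.eval, hlt']
        · omega
        · simp only [cost]
          omega
        · exact hm₁
        · simp [Function.update_of_ne hr.ne, Function.update_of_ne (show r ≠ t + 1 by omega),
            hr₁ r hr]
        · simp only [Function.update_self, eval]
          rw [hv₁, hr₁ 0 ht] at hlt'
          exact (hz _ (by omega)).symm
  | fold n init step ihn ihinit ihstep =>
    obtain ⟨hokn, hokinit, hnB, hacc, hokstep⟩ := hok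
    set env := ctx.map s.reg with henvdef
    set N := n.eval M env with hN
    set f := foldSeq (init.eval M env) (fun i x => step.eval M (i :: x :: env)) with hf
    obtain ⟨s₁, h₁, hm₁, hr₁, hv₁⟩ := ihinit (hmono hw (by simp only [size]; omega)) ctx t s ht hctx
      henv hokinit hraw hguard (eval_le hB hM init (henvmem henv) hokinit)
    have hc₁ := hmap hctx hr₁
    obtain ⟨s₂, h₂, hm₂, hr₂, hv₂⟩ := ihn (hmono hw (by simp only [size]; omega)) ctx (t + 1) s₁
      (by omega) (fun r hr => (hctx r hr).trans (by omega)) (fun r hr => by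
        rw [hr₁ r (hctx r hr)]; exact henv r hr) (by rwa [hc₁]) (fun h => hm₁.trans (hraw h))
      (fun h => by rw [hm₁, hr₁ 0 ht]; exact hguard h)
      (by rw [hc₁]; exact eval_le hB hM n (henvmem henv) hokn)
    rw [hc₁] at h₂ hv₂
    have h₃ := RamRuns.const s₂ (t + 2) (Nat.two_pow_pos w)
    have hBw' := hBw hw
    -- Register `t` is the accumulator. Two counters are kept: `t + 1` counts down for the loop
    -- test, `t + 2` counts up and is the index read by `step`.
    let Inv : ℕ → RamState → Prop := fun i s' => s'.mem = s.mem ∧ (∀ r < t, s'.reg r = s.reg r) ∧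
      s'.reg t = f i ∧ s'.reg (t + 1) = N - i ∧ s'.reg (t + 2) = i
    obtain ⟨s₄, h₄, hi₄⟩ := RamRuns.loop (w := w) (r := t + 1) (n := N)
      (p := .seq (step.compile guarded ((t + 2) :: t :: ctx) (t + 3)) <|
        .seq (.op .band t (t + 3) (t + 3)) <| .seq (.const (t + 3) 1) <|
        .seq (.op .add (t + 2) (t + 2) (t + 3)) (.op .sub (t + 1) (t + 1) (t + 3)))
      (s := { s₂ with reg := Function.update s₂.reg (t + 2) 0 }) Inv
      (fun i => step.cost M (i :: f i :: env) + 4)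
      (by
        rintro i hi s' ⟨hm, hr, hx, hrem, hidx⟩
        refine ⟨by omega, ?_⟩
        have hmap' : ((t + 2) :: t :: ctx).map s'.reg = i :: f i :: env := by
          simp only [List.map_cons, hx, hidx, hmap hctx hr, henvdef]
        have hb' : ∀ r ∈ (t + 2) :: t :: ctx, s'.reg r ≤ B := by
          intro r hr'
          simp only [List.mem_cons] at hr'
          rcases hr' with rfl | rfl | hr'
          · omega
          · rw [hx]; exact hacc i hi.le
          · rw [hr r (hctx r hr')]; exact henv r hr'
        obtain ⟨s₅, h₅, hm₅, hr₅, hv₅⟩ := ihstep (hmono hw (by simp only [size]; omega))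
          ((t + 2) :: t :: ctx) (t + 3) s' (by omega)
          (by
            intro r hr'
            simp only [List.mem_cons] at hr'
            rcases hr' with rfl | rfl | hr'
            · omega
            · omega
            · exact (hctx r hr').trans (by omega))
          hb' (by rw [hmap']; exact hokstep i hi) (fun h => hm.trans (hraw h))
          (fun h => by rw [hm, hr 0 ht]; exact hguard h)
          (eval_le hB hM step (henvmem hb') (by rw [hmap']; exact hokstep i hi))
        rw [hmap'] at h₅ hv₅
        have hv₅' : s₅.reg (t + 3) = f (i + 1) := hv₅
        have hfw : f (i + 1) < 2 ^ w := (hacc _ hi).trans_lt hBw'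
        refine ⟨_, (h₅.seq ((RamRuns.op _ t ?_).seq ((RamRuns.const _ (t + 3) ?_).seq
          ((RamRuns.op _ (t + 2) ?_).seq (RamRuns.op _ (t + 1) ?_))))).mono ?_, ?_, ?_, ?_, ?_, ?_⟩
        · simpa [BinOp.eval, hv₅'] using hfw
        · omega
        · simp [BinOp.eval, hr₅, hidx]
          omega
        · simp [BinOp.eval, hr₅, hrem]
          omega
        · omega
        · exact hm₅.trans hm
        · intro r hrt
          simp [Function.update_of_ne (show r ≠ t by omega),
            Function.update_of_ne (show r ≠ t + 1 by omega),
            Function.update_of_ne (show r ≠ t + 2 by omega),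
            Function.update_of_ne (show r ≠ t + 3 by omega), hr₅ r (by omega), hr r hrt]
        · simp [BinOp.eval, hv₅']
        · simp [BinOp.eval, hr₅, hrem]
          omega
        · simp [BinOp.eval, hr₅, hidx])
      (fun s' hs' => by have := hs'.2.2.2.1; omega)
      (by
        refine ⟨hm₂.trans hm₁, fun r hr => ?_, ?_, ?_, ?_⟩
        · simp [Function.update_of_ne (show r ≠ t + 2 by omega), hr₂ r (by omega), hr₁ r hr]
        · simp [hr₂, hv₁, hf, foldSeq, henvdef]
        · simp [hv₂, hN, henvdef]
        · simp)
    refine ⟨s₄, (h₁.seq (h₂.seq (h₃.seq h₄))).mono ?_, hi₄.1, hi₄.2.1, hi₄.2.2.1⟩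
    rw [← henvdef]
    simp only [cost, ← hN, ← hf, Nat.add_assoc, Nat.reduceAdd]
    omega

end RamExpr

/-! ### A language of list generators -/

/-- Generators of lists of numbers; `rep n g` is the concatenation of the lists generated by `g`
when `0, 1, …, n - 1` is put in front of the environment. -/
inductive RamGen
  | emit (e : RamExpr)
  | seq (g h : RamGen)
  | rep (n : RamExpr) (g : RamGen)

namespace RamGen

def out (M : ℕ → ℕ) : RamGen → List ℕ → List ℕ
  | emit e, env => [e.eval M env]
  | seq g h, env => g.out M env ++ h.out M env
  | rep n g, env => (List.range (n.eval M env)).flatMap fun i => g.out M (i :: env)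

def size : RamGen → ℕ
  | emit e => e.size
  | seq g h => max g.size h.size
  | rep n g => max n.size g.size

def Ok (M : ℕ → ℕ) (B : ℕ) : RamGen → List ℕ → Prop
  | emit e, env => e.Ok M B env
  | seq g h, env => g.Ok M B env ∧ h.Ok M B env
  | rep n g, env => n.Ok M B env ∧ n.eval M env ≤ B ∧ ∀ i < n.eval M env, g.Ok M B (i :: env)

def cost (M : ℕ → ℕ) : RamGen → List ℕ → ℕ
  | emit e, env => e.cost M env + 3
  | seq g h, env => g.cost M env + h.cost M env
  | rep n g, env => n.cost M env + 2 +
      ∑ i ∈ Finset.range (n.eval M env), (g.cost M (i :: env) + 4)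

/-- Append the generated list to the memory; register `1` holds the address of the first free
cell. -/
def compile : RamGen → List ℕ → ℕ → RamProgram
  | emit e, ctx, t => .seq (e.compile true ctx t) <| .seq (.store 1 t) <| .seq (.const t 1) <|
      .op .add 1 1 t
  | seq g h, ctx, t => .seq (g.compile ctx t) (h.compile ctx t)
  | rep n g, ctx, t => .seq (n.compile true ctx t) <| .seq (.const (t + 1) 0) <| .loop t <|
      .seq (g.compile ((t + 1) :: ctx) (t + 2)) <| .seq (.const (t + 2) 1) <|
      .seq (.op .add (t + 1) (t + 1) (t + 2)) (.op .sub t t (t + 2))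

/-- Each emitted number takes time. Bounds on the running time thereby also bound the length of the
generated instance. -/
theorem length_out_le_cost (M : ℕ → ℕ) (g : RamGen) (env : List ℕ) :
    (g.out M env).length ≤ g.cost M env := by
  induction g generalizing env with
  | emit e => simp [out, cost]
  | seq g h ihg ihh =>
    simp only [out, cost, List.length_append]
    exact Nat.add_le_add (ihg env) (ihh env)
  | rep n g ih =>
    simp only [out, cost, List.length_flatMap]
    refine le_trans ?_ (Nat.le_add_left _ _)
    induction n.eval M env with
    | zero => simp
    | succ k ihk =>
      rw [List.range_succ, List.map_append, List.sum_append, Finset.sum_range_succ]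
      have := ih (k :: env)
      simp only [List.map_cons, List.map_nil, List.sum_cons, List.sum_nil]
      omega

theorem out_le {M : ℕ → ℕ} {B : ℕ} (hB : 2 ≤ B) (hM : ∀ a, M a ≤ B) (g : RamGen) {env : List ℕ}
    (henv : ∀ x ∈ env, x ≤ B) (hok : g.Ok M B env) : ∀ x ∈ g.out M env, x ≤ B ^ g.size := by
  have hmono : ∀ {k l : ℕ}, k ≤ l → B ^ k ≤ B ^ l := fun h => Nat.pow_le_pow_right (by omega) h
  induction g generalizing env with
  | emit e =>
    intro x hx
    rw [List.mem_singleton.1 hx]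
    exact e.eval_le hB hM henv hok
  | seq g h ihg ihh =>
    intro x hx
    rcases List.mem_append.1 hx with hx | hx
    · exact (ihg henv hok.1 x hx).trans (hmono (le_max_left _ _))
    · exact (ihh henv hok.2 x hx).trans (hmono (le_max_right _ _))
  | rep n g ih =>
    intro x hx
    obtain ⟨i, hi, hx⟩ := List.mem_flatMap.1 hx
    rw [List.mem_range] at hi
    refine (ih (env := i :: env) ?_ (hok.2.2 i hi) x hx).trans (hmono (le_max_right _ _))
    intro y hy
    rcases List.mem_cons.1 hy with rfl | hy
    · exact hi.le.trans hok.2.1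
    · exact henv y hy

/-- The memory with contents `M` below `off` and the list `l` from `off` on. -/
def appendMem (M : ℕ → ℕ) (off : ℕ) (l : List ℕ) (a : ℕ) : ℕ :=
  if a < off then M a else l.getD (a - off) 0

theorem update_appendMem (M : ℕ → ℕ) (off : ℕ) (l : List ℕ) (v : ℕ) :
    Function.update (appendMem M off l) (off + l.length) v = appendMem M off (l ++ [v]) := by
  funext a
  simp only [Function.update_apply, appendMem]
  split_ifs with h h' h'
  · omega
  · subst h
    simp
  · rfl
  · rcases lt_or_ge (a - off) l.length with h1 | h1
    · rw [List.getD_append _ _ _ _ h1]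
    · rw [List.getD_eq_default _ _ h1, List.getD_eq_default]
      simp only [List.length_append, List.length_singleton]
      omega

/-- The list `l` is what has been written so far. Expressions are evaluated in guarded mode with
bound `off`, so they see `M` whatever `l` is, and the induction can extend `l` step by step. -/
theorem runs_compile {M : ℕ → ℕ} {B w off : ℕ} (hB : 2 ≤ B) (hM : ∀ a, M a ≤ B)
    (hoff : ∀ a, off ≤ a → M a = 0) (g : RamGen) (hw : B ^ g.size < 2 ^ w) (ctx : List ℕ) (t : ℕ)
    (s : RamState) (l : List ℕ) (ht : 2 ≤ t) (hctx : ∀ r ∈ ctx, 2 ≤ r ∧ r < t)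
    (henv : ∀ r ∈ ctx, s.reg r ≤ B) (hok : g.Ok M B (ctx.map s.reg))
    (hmem : s.mem = appendMem M off l) (h0 : s.reg 0 = off) (h1 : s.reg 1 = off + l.length)
    (hlen : off + (l ++ g.out M (ctx.map s.reg)).length < 2 ^ w) :
    ∃ s', RamRuns w (g.compile ctx t) s s' (g.cost M (ctx.map s.reg)) ∧
      s'.mem = appendMem M off (l ++ g.out M (ctx.map s.reg)) ∧ s'.reg 0 = off ∧
      s'.reg 1 = off + (l ++ g.out M (ctx.map s.reg)).length ∧
      ∀ r, 2 ≤ r → r < t → s'.reg r = s.reg r := by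
  have hmono : ∀ {k l : ℕ}, B ^ l < 2 ^ w → k ≤ l → B ^ k < 2 ^ w := fun h hkl =>
    (Nat.pow_le_pow_right (by omega) hkl).trans_lt h
  have hmap : ∀ {s s' : RamState} {ctx : List ℕ} {t : ℕ}, (∀ r ∈ ctx, 2 ≤ r ∧ r < t) →
      (∀ r, 2 ≤ r → r < t → s'.reg r = s.reg r) → ctx.map s'.reg = ctx.map s.reg := fun h h' =>
    List.map_congr_left fun r hr => h' r (h r hr).1 (h r hr).2
  have henvmem : ∀ {s : RamState} {ctx : List ℕ}, (∀ r ∈ ctx, s.reg r ≤ B) →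
      ∀ x ∈ ctx.map s.reg, x ≤ B := by
    intro s ctx h x hx
    obtain ⟨r, hr, rfl⟩ := List.mem_map.1 hx
    exact h r hr
  have hguard : ∀ {s : RamState} {l : List ℕ}, s.mem = appendMem M off l → s.reg 0 = off →
      true = true → (∀ a < s.reg 0, s.mem a = M a) ∧ ∀ a, s.reg 0 ≤ a → M a = 0 := by
    intro s l hm h0 _
    refine ⟨fun a ha => ?_, fun a ha => hoff a (by omega)⟩
    rw [hm, appendMem, if_pos (by omega)]
  induction g generalizing ctx t s l with
  | emit e =>
    obtain ⟨s₁, h₁, hm₁, hr₁, hv₁⟩ := e.runs_compile (guarded := true) hB hM hw ctx t s (by omega)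
      (fun r hr => (hctx r hr).2) henv hok (by simp) (hguard hmem h0)
    simp only [out, List.length_append, List.length_singleton] at hlen
    have hev := (e.eval_le hB hM (henvmem henv) hok).trans_lt hw
    refine ⟨_, (h₁.seq ((RamRuns.store s₁ (a := 1) (r := t) ?_).seq
      ((RamRuns.const _ t ?_).seq (RamRuns.op _ 1 ?_)))).mono ?_, ?_, ?_, ?_, fun r hr hr' => ?_⟩
    · rwa [hv₁]
    · omega
    · simp [Function.update_of_ne (show 1 ≠ t by omega), BinOp.eval, hr₁ 1 (by omega), h1]
      omega
    · simp only [cost]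
      omega
    · simp only [hm₁, hmem, hr₁ 1 (by omega), h1, hv₁]
      exact update_appendMem _ _ _ _
    · simp [Function.update_of_ne (show 0 ≠ t by omega), hr₁ 0 (by omega), h0]
    · simp [Function.update_of_ne (show 1 ≠ t by omega), BinOp.eval, hr₁ 1 (by omega), h1, out]
      omega
    · simp [Function.update_of_ne (show r ≠ t by omega), Function.update_of_ne (show r ≠ 1 by omega),
        hr₁ r hr']
  | seq g h ihg ihh =>
    simp only [out, ← List.append_assoc] at hlen ⊢
    obtain ⟨s₁, h₁, hm₁, h0₁, h1₁, hr₁⟩ := ihg (hmono hw (le_max_left _ _)) ctx t s l ht hctx henv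
      hok.1 hmem h0 h1 (by rw [List.length_append] at hlen; omega)
    have hc := hmap hctx hr₁
    obtain ⟨s₂, h₂, hm₂, h0₂, h1₂, hr₂⟩ := ihh (hmono hw (le_max_right _ _)) ctx t s₁ _ ht hctx
      (fun r hr => by rw [hr₁ r (hctx r hr).1 (hctx r hr).2]; exact henv r hr)
      (by rw [hc]; exact hok.2) hm₁ h0₁ h1₁ (by rwa [hc])
    rw [hc] at h₂ hm₂ h1₂
    exact ⟨s₂, h₁.seq h₂, hm₂, h0₂, h1₂, fun r hr hr' => (hr₂ r hr hr').trans (hr₁ r hr hr')⟩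
  | rep n g ih =>
    obtain ⟨hokn, hnB, hokg⟩ := hok
    set env := ctx.map s.reg with henvdef
    set N := n.eval M env with hN
    obtain ⟨s₁, h₁, hm₁, hr₁, hv₁⟩ := n.runs_compile (guarded := true) hB hM
      (hmono hw (le_max_left _ _)) ctx t s (by omega)
      (fun r hr => (hctx r hr).2) henv hokn (by simp) (hguard hmem h0)
    rw [← henvdef] at h₁ hv₁
    have h₂ := RamRuns.const s₁ (t + 1) (Nat.two_pow_pos w)
    have hBw : B < 2 ^ w := (Nat.le_self_pow n.size_pos.ne' B).trans_lt
      (hmono hw (le_max_left _ _))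
    let outs : ℕ → List ℕ := fun i => l ++ (List.range i).flatMap fun j => g.out M (j :: env)
    have houts : ∀ i, outs (i + 1) = outs i ++ g.out M (i :: env) := fun i => by
      simp [outs, List.range_succ]
    -- The only space assumption concerns the complete output; partial outputs are no longer than
    -- it.
    have hpre : ∀ i ≤ N, (outs i).length ≤ (outs N).length := by
      intro i hi
      exact monotone_nat_of_le_succ (f := fun i => (outs i).length)
        (fun k => by simp only [houts, List.length_append]; omega) hi
    let Inv : ℕ → RamState → Prop := fun i s' => s'.mem = appendMem M off (outs i) ∧
      s'.reg 0 = off ∧ s'.reg 1 = off + (outs i).length ∧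
      (∀ r, 2 ≤ r → r < t → s'.reg r = s.reg r) ∧ s'.reg t = N - i ∧ s'.reg (t + 1) = i
    obtain ⟨s₄, h₄, hi₄⟩ := RamRuns.loop (w := w) (r := t) (n := N)
      (p := .seq (g.compile ((t + 1) :: ctx) (t + 2)) <| .seq (.const (t + 2) 1) <|
        .seq (.op .add (t + 1) (t + 1) (t + 2)) (.op .sub t t (t + 2)))
      (s := { s₁ with reg := Function.update s₁.reg (t + 1) 0 }) Inv
      (fun i => g.cost M (i :: env) + 3)
      (by
        rintro i hi s' ⟨hm, hz, ho, hr, hrem, hidx⟩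
        refine ⟨by omega, ?_⟩
        have hmap' : ((t + 1) :: ctx).map s'.reg = i :: env := by
          simp only [List.map_cons, hidx, hmap hctx hr, henvdef]
        obtain ⟨s₅, h₅, hm₅, hz₅, ho₅, hr₅⟩ := ih (hmono hw (le_max_right _ _))
          ((t + 1) :: ctx) (t + 2) s' (outs i) (by omega)
          (by
            intro r hr'
            simp only [List.mem_cons] at hr'
            rcases hr' with rfl | hr'
            · omega
            · have := hctx r hr'
              omega)
          (by
            intro r hr'
            simp only [List.mem_cons] at hr'
            rcases hr' with rfl | hr'
            · omega
            · rw [hr r (hctx r hr').1 (hctx r hr').2]; exact henv r hr')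
          (by rw [hmap']; exact hokg i hi) hm hz ho
          (by
            rw [hmap', ← houts]
            have := hpre (i + 1) hi
            simp only [out, ← hN] at hlen
            simp only [outs] at this ⊢
            omega)
        rw [hmap'] at h₅ hm₅ ho₅
        rw [← houts] at hm₅ ho₅
        refine ⟨_, (h₅.seq ((RamRuns.const _ (t + 2) ?_).seq
          ((RamRuns.op _ (t + 1) ?_).seq (RamRuns.op _ t ?_)))).mono ?_, ?_, ?_, ?_, ?_, ?_, ?_⟩
        · omega
        · simp [BinOp.eval, hr₅ (t + 1) (by omega), hidx]
          omega
        · simp [BinOp.eval, hr₅ t, ht, hrem]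
          omega
        · omega
        · exact hm₅
        · simpa [Function.update_of_ne (show 0 ≠ t by omega)] using hz₅
        · simpa [Function.update_of_ne (show 1 ≠ t by omega),
            Function.update_of_ne (show 1 ≠ t + 1 by omega)] using ho₅
        · intro r hr2 hrt
          simp [Function.update_of_ne (show r ≠ t by omega),
            Function.update_of_ne (show r ≠ t + 1 by omega),
            Function.update_of_ne (show r ≠ t + 2 by omega), hr₅ r hr2 (by omega), hr r hr2 hrt]
        · simp [BinOp.eval, hr₅ t, ht, hrem]
          omega
        · simp [BinOp.eval, hr₅ (t + 1) (by omega), hidx])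
      (fun s' hs' => by have := hs'.2.2.2.2.1; omega)
      (by
        refine ⟨?_, ?_, ?_, fun r hr hr' => ?_, ?_, ?_⟩
        · simpa [outs] using hm₁.trans hmem
        · simp [hr₁ 0 (by omega), h0]
        · simp [Function.update_of_ne (show 1 ≠ t + 1 by omega), hr₁ 1 (by omega), h1, outs]
        · simp [Function.update_of_ne (show r ≠ t + 1 by omega), hr₁ r hr']
        · simp [hv₁, hN]
        · simp)
    refine ⟨s₄, (h₁.seq (h₂.seq h₄)).mono ?_, hi₄.1, hi₄.2.1, hi₄.2.2.1, hi₄.2.2.2.1⟩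
    simp only [cost, ← hN, Nat.add_assoc, Nat.reduceAdd]
    omega

end RamGen

/-! ### List transformations on the word RAM -/

/-- Move the memory down by the contents of register `0`; register `1` holds the first address
from which on the memory is zero. -/
def RamProgram.shift : RamProgram :=
  .seq (.const 2 0) <| .seq (.op .band 3 1 1) <| .loop 3 <| .seq (.op .add 4 2 0) <|
  .seq (.load 4 4) <| .seq (.store 2 4) <| .seq (.const 4 1) <| .seq (.op .add 2 2 4) <|
  .op .sub 3 3 4

/-- Copying in increasing order is safe because the source address is never below the destination.
The loop runs through all `e` cells, so that cells behind the moved block are overwritten by zeros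
from beyond `e`. -/
theorem RamProgram.runs_shift {w off e : ℕ} (s : RamState) (h0 : s.reg 0 = off) (h1 : s.reg 1 = e)
    (hw : off + e < 2 ^ w) (hmem : ∀ a, s.mem a < 2 ^ w) (hz : ∀ a, e ≤ a → s.mem a = 0) :
    ∃ s', RamRuns w .shift s s' (7 * e + 3) ∧ s'.mem = fun a => s.mem (a + off) := by
  have hw' := Nat.two_pow_pos w
  have h₁ := RamRuns.const s 2 hw'
  have h₂ := RamRuns.op (w := w) { s with reg := Function.update s.reg 2 0 } (o := .band) 3
    (a := 1) (b := 1) (by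
      simp [BinOp.eval, h1]
      omega)
  let Inv : ℕ → RamState → Prop := fun i s' =>
    (∀ a, s'.mem a = if a < i then s.mem (a + off) else s.mem a) ∧ s'.reg 0 = off ∧
    s'.reg 2 = i ∧ s'.reg 3 = e - i
  obtain ⟨s₃, h₃, hi₃⟩ := RamRuns.loop (w := w) (r := 3) (n := e)
    (p := .seq (.op .add 4 2 0) <| .seq (.load 4 4) <| .seq (.store 2 4) <| .seq (.const 4 1) <|
      .seq (.op .add 2 2 4) <| .op .sub 3 3 4)
    (s := ⟨_, s.mem⟩) Inv (fun _ => 6)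
    (by
      rintro i hi s' ⟨hm, hz', hidx, hrem⟩
      refine ⟨by omega, ?_⟩
      refine ⟨_, ((RamRuns.op _ 4 ?_).seq ((RamRuns.load _ 4 ?_).seq ((RamRuns.store _ ?_).seq
        ((RamRuns.const _ 4 ?_).seq ((RamRuns.op _ 2 ?_).seq (RamRuns.op _ 3 ?_)))))).mono ?_,
        fun a => ?_, ?_, ?_, ?_⟩
      · simp [BinOp.eval, hz', hidx]
        omega
      · simp only [Function.update_self, hm]
        split_ifs <;> exact hmem _
      · simp only [Function.update_self, hm]
        split_ifs <;> exact hmem _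
      · omega
      · simp [BinOp.eval, hidx]
        omega
      · simp [BinOp.eval, hrem]
        omega
      · norm_num
      · simp only [Function.update_apply, BinOp.eval, hidx, hz', hm]
        norm_num
        split_ifs <;> first | rfl | omega | (congr 1; omega)
      · simp [hz']
      · simp [BinOp.eval, hidx]
      · simp [BinOp.eval, hrem]
        omega)
    (fun s' hs' => by have := hs'.2.2.2; omega)
    (by
      refine ⟨by simp, ?_, ?_, ?_⟩
      rotate_left 2
      · simp
        exact Function.update_self (f := Function.update s.reg 2 0) 3 (s.reg 1 &&& s.reg 1) |>.trans
          (by simp [h1])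
      · simp [h0]
      · simp)
  refine ⟨s₃, (h₁.seq (h₂.seq h₃)).mono ?_, ?_⟩
  · simp
    omega
  · funext a
    rw [hi₃.1]
    split_ifs with h
    · rfl
    · rw [hz a (by omega), hz _ (by omega)]

/-- Replace the memory by the list generated by `g`; the value of `off` bounds the length of the
original memory. All registers below `R` are cleared. -/
def RamGen.transform (g : RamGen) (off : RamExpr) (R : ℕ) : RamProgram :=
  .seq (.seq (off.compile false [] 2) <| .seq (.op .band 0 2 2) <| .seq (.op .band 1 2 2) <|
    .seq (g.compile [] 2) .shift) (.clear R)

/-- The output is written behind the input, which is still being read, then moved to address `0`,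
and the registers are cleared. The factor `8` combines one unit for generating with seven for
moving, as the output is no longer than the generation time. -/
theorem RamGen.runs_transform {input : List ℕ} {M : ℕ → ℕ} {B w R : ℕ} {off : RamExpr} {g : RamGen}
    (hinput : ∀ a, M a = input.getD a 0) (hB : 2 ≤ B) (hM : ∀ a, M a ≤ B)
    (hwoff : B ^ off.size < 2 ^ w) (hwg : B ^ g.size < 2 ^ w)
    (hoff : off.Ok M B []) (hg : g.Ok M B []) (hlen : input.length ≤ off.eval M [])
    (hw : 2 * off.eval M [] + (g.out M []).length < 2 ^ w)
    (hR : (g.transform off 0).regBound ≤ R) (s : RamState) (hs : s.mem = M)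
    (hreg : ∀ r, R ≤ r → s.reg r = 0) :
    RamRuns w (g.transform off R) s (RamState.init (g.out M []))
      (off.cost M [] + 8 * g.cost M [] + 7 * off.eval M [] + R + 6) := by
  obtain ⟨s₁, h₁, hm₁, hr₁, hv₁⟩ := off.runs_compile (guarded := false) hB hM hwoff [] 2 s (by omega)
    (by simp) (by simp) hoff (fun _ => hs) (by simp)
  simp only [List.map_nil] at h₁ hv₁
  have hL := g.length_out_le_cost M []
  set o := off.eval M [] with ho
  set L := g.out M [] with hLdef
  have hM0 : ∀ a, o ≤ a → M a = 0 := fun a ha => by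
    rw [hinput, List.getD_eq_default _ _ (hlen.trans ha)]
  have h₂ := RamRuns.op (w := w) s₁ (o := .band) 0 (a := 2) (b := 2) (by
    simp [BinOp.eval, hv₁]
    omega)
  have h₃ := RamRuns.op (w := w) { s₁ with reg := Function.update s₁.reg 0 o } (o := .band) 1
    (a := 2) (b := 2) (by
      simp [BinOp.eval, hv₁]
      omega)
  simp only [BinOp.eval, hv₁, Nat.and_self, ne_eq, OfNat.ofNat_ne_zero, not_false_eq_true,
    Function.update_of_ne] at h₂ h₃
  obtain ⟨s₄, h₄, hm₄, h0₄, h1₄, -⟩ := g.runs_compile (off := o) hB hM hM0 hwg [] 2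
    ⟨Function.update (Function.update s₁.reg 0 o) 1 o, s₁.mem⟩ [] le_rfl (by simp) (by simp)
    (by simpa using hg)
    (by
      simp only [hm₁, hs]
      funext a
      simp only [RamGen.appendMem]
      split_ifs with h
      · rfl
      · simpa using hM0 a (by omega))
    (by simp) (by simp) (by simp [← hLdef]; omega)
  simp only [List.map_nil, List.nil_append, ← hLdef] at h₄ hm₄ h1₄
  have hBw : B < 2 ^ w := (Nat.le_self_pow off.size_pos.ne' B).trans_lt hwoff
  obtain ⟨s₅, h₅, hm₅⟩ := RamProgram.runs_shift (w := w) s₄ h0₄ h1₄ (by omega)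
    (by
      intro a
      rw [hm₄, RamGen.appendMem]
      split_ifs
      · exact (hM a).trans_lt hBw
      · rcases lt_or_ge (a - o) L.length with h | h
        · rw [List.getD_eq_getElem _ _ h]
          exact (g.out_le hB hM (by simp) hg _ (List.getElem_mem h)).trans_lt hwg
        · rw [List.getD_eq_default _ _ h]
          exact Nat.two_pow_pos w)
    (by
      intro a ha
      rw [hm₄, RamGen.appendMem, if_neg (by omega), List.getD_eq_default _ _ (by omega)])
  have hcore := h₁.seq (h₂.seq (h₃.seq (h₄.seq h₅)))
  -- The part before the clearing does not depend on `R`, so its register bound can be taken from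
  -- the instance with `R = 0` and the choice of `R` is not circular.
  have hclear := RamProgram.runs_clear w R s₅ (by
    intro r hr
    obtain ⟨t, ht, -⟩ := hcore
    rw [ht.reg_eq (r := r), hreg r hr]
    refine le_trans ?_ (hR.trans hr)
    exact le_max_left _ _)
  have : (⟨fun _ => 0, s₅.mem⟩ : RamState) = RamState.init L := by
    rw [RamState.init, hm₅, hm₄]
    congr 1
    funext a
    simp [RamGen.appendMem]
  rw [this] at hclear
  exact (hcore.seq hclear).mono (by omega)

/-! ### Plays of Markov decision processes -/

theorem infSet_subset {V : Type} {ω : ℕ → V} {S : Set V} (h : ∀ n, ω n ∈ S) : infSet ω ⊆ S := by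
  intro u hu
  obtain ⟨i, rfl⟩ := (show ∃ᶠ i in Filter.atTop, ω i = u from hu).exists
  exact h i

theorem measurableSet_coord_eq {V : Type} [MeasurableSpace V] [MeasurableSingletonClass V] (n : ℕ)
    (u : V) : MeasurableSet {ω : ℕ → V | ω n = u} :=
  measurable_pi_apply (X := fun _ : ℕ => V) n (measurableSet_singleton u)

namespace MDP

variable {V : Type} [Finite V] (P : MDP V) (σ : P.Strategy)

theorem next_ne_zero_iff_of_random {n : ℕ} {h : Finset.Iic n → V} (hr : last h ∈ P.random) (w : V) :
    P.next σ n h w ≠ 0 ↔ P.edge (last h) w := by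
  simp [next, hr, uniformSucc, PMF.uniformOfFinset_apply]

theorem next_ne_zero_iff_of_not_random {n : ℕ} {h : Finset.Iic n → V} (hr : last h ∉ P.random)
    (w : V) : P.next σ n h w ≠ 0 ↔ w = σ.choose n h := by
  simp [next, hr, PMF.pure_apply]

theorem edge_of_next_ne_zero {n : ℕ} {h : Finset.Iic n → V} {w : V} (hw : P.next σ n h w ≠ 0) :
    P.edge (last h) w := by
  by_cases hr : last h ∈ P.random
  · exact (P.next_ne_zero_iff_of_random σ hr w).1 hw
  · rw [(P.next_ne_zero_iff_of_not_random σ hr w).1 hw]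
    exact σ.edge_choose n h hr

variable [MeasurableSpace V] [MeasurableSingletonClass V]

instance (v : V) : IsProbabilityMeasure (P.playMeasure σ v) := by
  unfold playMeasure
  infer_instance

theorem nextKernel_apply_singleton (n : ℕ) (h : Finset.Iic n → V) (w : V) :
    P.nextKernel σ n h {w} = P.next σ n h w :=
  PMF.toMeasure_apply_singleton _ _ (measurableSet_singleton w)

theorem ae_nextKernel_iff {n : ℕ} {h : Finset.Iic n → V} {p : V → Prop} :
    (∀ᵐ w ∂P.nextKernel σ n h, p w) ↔ ∀ w, P.next σ n h w ≠ 0 → p w := by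
  rw [ae_iff_of_countable]
  simp only [nextKernel_apply_singleton]

/-- A trajectory continued from a history keeps that history: the marginal on the coordinates up to
`n` is a Dirac measure. -/
theorem ae_traj_frestrictLe_eq (n : ℕ) (h : Finset.Iic n → V) :
    ∀ᵐ ω ∂Kernel.traj (X := fun _ => V) (fun n => P.nextKernel σ n) n h,
      Preorder.frestrictLe n ω = h := by
  have H := Kernel.traj_map_frestrictLe_of_le (X := fun _ => V)
    (κ := fun n => P.nextKernel σ n) (le_refl n)
  have H' := congrArg (fun η => η h) H
  simp only [Kernel.map_apply _ (Preorder.measurable_frestrictLe n), Kernel.deterministic_apply] at H'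
  have hset : MeasurableSet {g : Finset.Iic n → V | g = h} := measurableSet_singleton h
  refine (ae_map_iff (Preorder.measurable_frestrictLe (X := fun _ => V) n).aemeasurable hset).1 ?_
  rw [H', ae_dirac_iff hset]
  rfl

theorem ae_zero (v : V) : ∀ᵐ ω ∂P.playMeasure σ v, ω 0 = v := by
  filter_upwards [P.ae_traj_frestrictLe_eq σ 0 fun _ => v] with ω h
  exact congrFun h ⟨0, by simp⟩

/-- One step of a play. -/
theorem ae_step_iff (v : V) (n : ℕ) (p : (Finset.Iic n → V) → V → Prop) :
    (∀ᵐ ω ∂P.playMeasure σ v, p (Preorder.frestrictLe (π := fun _ => V) n ω) (ω (n + 1))) ↔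
    ∀ᵐ ω ∂P.playMeasure σ v, ∀ w, P.next σ n (Preorder.frestrictLe (π := fun _ => V) n ω) w ≠ 0 →
      p (Preorder.frestrictLe (π := fun _ => V) n ω) w := by
  have hm : MeasurableSet {x : (Finset.Iic n → V) × V | p x.1 x.2} := MeasurableSet.of_discrete
  -- The joint law of the history and the next vertex is the composition product of the law of the
  -- history with the step kernel, so an almost-sure statement about the pair can be tested first
  -- along the history and then along the atoms of the kernel.
  have h := Kernel.partialTraj_compProd_eq_map_traj (X := fun _ => V)
    (κ := fun n => P.nextKernel σ n) (Nat.zero_le n) (x₀ := fun _ => v)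
  have hmeas : Measurable fun x : ℕ → V =>
      ((Preorder.frestrictLe (π := fun _ => V) n x, x (n + 1)) : (Finset.Iic n → V) × V) :=
    (Preorder.measurable_frestrictLe (X := fun _ => V) n).prodMk (measurable_pi_apply _)
  calc _ ↔ ∀ᵐ x ∂(P.playMeasure σ v).map (fun x : ℕ → V =>
      ((Preorder.frestrictLe (π := fun _ => V) n x, x (n + 1)) : (Finset.Iic n → V) × V)),
        p x.1 x.2 := (ae_map_iff hmeas.aemeasurable hm).symm
    _ ↔ ∀ᵐ g ∂Kernel.partialTraj (X := fun _ => V) (fun n => P.nextKernel σ n) 0 n (fun _ => v),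
        ∀ w, P.next σ n g w ≠ 0 → p g w := by
      rw [playMeasure, ← h, Measure.ae_compProd_iff hm]
      simp only [ae_nextKernel_iff]
    _ ↔ _ := by
      rw [playMeasure, ← Kernel.traj_map_frestrictLe_apply]
      exact ae_map_iff (Preorder.measurable_frestrictLe (X := fun _ => V) n).aemeasurable
        MeasurableSet.of_discrete

theorem ae_next_ne_zero (v : V) : ∀ᵐ ω ∂P.playMeasure σ v, ∀ n,
    P.next σ n (Preorder.frestrictLe (π := fun _ => V) n ω) (ω (n + 1)) ≠ 0 :=
  ae_all_iff.2 fun n => (P.ae_step_iff σ v n fun h w => P.next σ n h w ≠ 0).2 <|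
    .of_forall fun _ _ h => h

theorem ae_edge (v : V) : ∀ᵐ ω ∂P.playMeasure σ v, ∀ n, P.edge (ω n) (ω (n + 1)) := by
  filter_upwards [P.ae_next_ne_zero σ v] with ω h n
  exact P.edge_of_next_ne_zero σ (h n)

/-- If a vertex is reached with positive probability at time `n`, then every vertex that may
follow is reached with positive probability at time `n + 1`. -/
theorem not_ae_ne_succ (v : V) {n : ℕ} {u w : V} (hu : ¬ ∀ᵐ ω ∂P.playMeasure σ v, ω n ≠ u)
    (hr : u ∈ P.random) (he : P.edge u w) : ¬ ∀ᵐ ω ∂P.playMeasure σ v, ω (n + 1) ≠ w := by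
  contrapose! hu
  filter_upwards [(P.ae_step_iff σ v n fun _ w' => w' ≠ w).1 hu] with ω h hω
  have hl : last (Preorder.frestrictLe (π := fun _ => V) n ω) = u := hω
  exact h w ((P.next_ne_zero_iff_of_random σ (hl ▸ hr) w).2 (hl ▸ he)) rfl

/-- A play follows edges, so if it avoided each of the finitely many successors almost surely at the
next step, it would almost surely not be in `u`. -/
theorem exists_not_ae_ne_succ (v : V) {n : ℕ} {u : V}
    (hu : ¬ ∀ᵐ ω ∂P.playMeasure σ v, ω n ≠ u) :
    ∃ w, P.edge u w ∧ ¬ ∀ᵐ ω ∂P.playMeasure σ v, ω (n + 1) ≠ w := by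
  contrapose! hu
  have := ae_all_iff.2 fun w => (ae_all_iff (ι := P.edge u w)).2 (hu w)
  filter_upwards [this, P.ae_edge σ v] with ω h he hω
  exact h (ω (n + 1)) (hω ▸ he n) rfl

/-- This is the conditional probability, given the history, of stepping from `u` to `w`; it is the
summand in the conditional Borel–Cantelli lemma. Given `h`, being in `u` at time `n` is already
decided. -/
theorem integral_traj_step [DecidableEq V] {n : ℕ} {h : Finset.Iic n → V} {u w : V} :
    ∫ ω, ({ω | ω n = u ∧ ω (n + 1) = w} : Set (ℕ → V)).indicator (1 : (ℕ → V) → ℝ) ω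
      ∂Kernel.traj (X := fun _ => V) (fun n => P.nextKernel σ n) n h =
    if last h = u then (P.next σ n h w).toReal else 0 := by
  have hm : MeasurableSet ({ω | ω n = u ∧ ω (n + 1) = w} : Set (ℕ → V)) :=
    (measurableSet_coord_eq n u).inter (measurableSet_coord_eq (n + 1) w)
  rw [integral_indicator_one hm]
  have hae := P.ae_traj_frestrictLe_eq σ n h
  split_ifs with hu
  · have h1 : ({ω | ω n = u ∧ ω (n + 1) = w} : Set (ℕ → V))
        =ᵐ[Kernel.traj (X := fun _ => V) (fun n => P.nextKernel σ n) n h]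
        (fun ω => ω (n + 1)) ⁻¹' {w} := by
      filter_upwards [hae] with ω hω
      have : ω n = u := by rw [← hu, ← hω]; rfl
      exact propext ⟨fun h => h.2, fun h => ⟨this, h⟩⟩
    rw [measureReal_congr h1, measureReal_def, ← Measure.map_apply (measurable_pi_apply _)
      (measurableSet_singleton w), ← Kernel.map_apply _ (measurable_pi_apply _),
      Kernel.map_traj_succ_self, nextKernel_apply_singleton]
  · rw [measureReal_eq_zero_iff, measure_eq_zero_iff_ae_notMem]
    filter_upwards [hae] with ω hω hω'
    refine hu ?_
    rw [← hω'.1, ← hω]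
    rfl

/-- By the conditional Borel–Cantelli lemma, steps from `u` to `w` occur infinitely often almost
surely wherever their conditional probabilities have a divergent sum. Each visit to `u` contributes
the same positive amount, whatever the strategy did before. -/
theorem ae_frequently_step (v : V) {u w : V} (hr : u ∈ P.random) (he : P.edge u w) :
    ∀ᵐ ω ∂P.playMeasure σ v, (∃ᶠ i in Filter.atTop, ω i = u) → ∃ᶠ i in Filter.atTop, ω i = w := by
  classical
  -- Steps are indexed by their arrival time, so that `s k` is observable at time `k`; the condition
  -- `0 < k` excludes the truncated value of `k - 1`.
  let s : ℕ → Set (ℕ → V) := fun k => {ω | 0 < k ∧ ω (k - 1) = u ∧ ω k = w}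
  have hs : ∀ k, MeasurableSet[Filtration.piLE (X := fun _ => V) k] (s k) := by
    intro k
    have hmk : ∀ i ≤ k, ∀ x : V,
        MeasurableSet[Filtration.piLE (X := fun _ => V) k] {ω : ℕ → V | ω i = x} := by
      intro i hi x
      exact ⟨{g | g ⟨i, hi⟩ = x}, measurable_pi_apply (X := fun _ : Set.Iic k => V) ⟨i, hi⟩
        (measurableSet_singleton x), rfl⟩
    exact (MeasurableSet.const _).inter ((hmk (k - 1) (by omega) u).inter (hmk k le_rfl w))
  obtain ⟨δ, hδ, hδ'⟩ : ∃ δ : ℝ, 0 < δ ∧ ∀ n (h : Finset.Iic n → V), last h = u →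
      δ ≤ (P.next σ n h w).toReal := by
    have h0 : P.uniformSucc u w ≠ 0 := by simp [uniformSucc, PMF.uniformOfFinset_apply, he]
    refine ⟨(P.uniformSucc u w).toReal,
      ENNReal.toReal_pos h0 (PMF.apply_ne_top _ _), fun n h hl => ?_⟩
    simp [next, hl, hr]
  have hcond : ∀ᵐ ω ∂P.playMeasure σ v, ∀ k,
      ((P.playMeasure σ v)[(s (k + 1)).indicator (1 : (ℕ → V) → ℝ) |
        Filtration.piLE (X := fun _ => V) k]) ω =
      if ω k = u then (P.next σ k (Preorder.frestrictLe (π := fun _ => V) k ω) w).toReal else 0 := by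
    refine ae_all_iff.2 fun k => ?_
    have hint : Integrable ((s (k + 1)).indicator (1 : (ℕ → V) → ℝ)) (P.playMeasure σ v) :=
      (integrable_const 1).indicator ((Filtration.piLE (X := fun _ => V)).le _ _ (hs _))
    filter_upwards [Kernel.condExp_traj (X := fun _ => V) (κ := fun n => P.nextKernel σ n)
      (Nat.zero_le k) hint] with ω hω
    have hsk : s (k + 1) = {ω | ω k = u ∧ ω (k + 1) = w} := by
      ext
      simp [s]
    refine hω.trans ?_
    rw [hsk]
    exact P.integral_traj_step σ
  filter_upwards [ae_mem_limsup_atTop_iff (P.playMeasure σ v) hs, hcond] with ω hω hc hu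
  have hlim : ω ∈ Filter.limsup s Filter.atTop := by
    rw [hω]
    simp only [hc]
    refine (not_summable_iff_tendsto_nat_atTop_of_nonneg fun k => ?_).1 fun hsum => ?_
    · split_ifs
      exacts [ENNReal.toReal_nonneg, le_rfl]
    -- The terms of a convergent series would tend to zero, but infinitely many of them are at least
    -- `δ`.
    · have := hsum.tendsto_atTop_zero.eventually_lt_const hδ
      obtain ⟨k, hk, hk'⟩ := (hu.and_eventually this).exists
      rw [if_pos hk] at hk'
      exact absurd (hδ' k (Preorder.frestrictLe (π := fun _ => V) k ω) hk) (not_le.2 hk')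
  rw [Filter.mem_limsup_iff_frequently_mem] at hlim
  exact hlim.mono fun k hk => hk.2.2

/-- The properties of the set of vertices that a play visits infinitely often. -/
structure Recurrent (I : Set V) : Prop where
  nonempty : I.Nonempty
  exists_edge : ∀ u ∈ I, ∃ w ∈ I, P.edge u w
  random : ∀ u ∈ I, u ∈ P.random → ∀ w, P.edge u w → w ∈ I

/-- Since `V` is finite, the pigeonhole principle yields a recurring vertex and, for each recurring
vertex, a successor that is taken infinitely often. Closure under random moves is
`ae_frequently_step` for all pairs of vertices at once. -/
theorem ae_recurrent (v : V) : ∀ᵐ ω ∂P.playMeasure σ v, P.Recurrent (infSet ω) := by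
  have h : ∀ᵐ ω ∂P.playMeasure σ v, ∀ u w, u ∈ P.random → P.edge u w →
      (∃ᶠ i in Filter.atTop, ω i = u) → ∃ᶠ i in Filter.atTop, ω i = w := by
    simp only [ae_all_iff]
    exact fun u w => P.ae_frequently_step σ v
  filter_upwards [h, P.ae_edge σ v] with ω h he
  refine ⟨?_, fun u hu => ?_, fun u hu hr w hw => h u w hr hw hu⟩
  · have : ∃ᶠ i in Filter.atTop, ∃ u, ω i = u := (Filter.Eventually.of_forall fun i => ⟨ω i, rfl⟩).frequently
    exact Filter.frequently_exists.1 this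
  · have hu' : ∃ᶠ i in Filter.atTop, ω i = u := hu
    have h1 : ∃ᶠ i in Filter.atTop, ∃ w, P.edge u w ∧ ω (i + 1) = w :=
      hu'.mono fun i hi => ⟨ω (i + 1), hi ▸ he i, rfl⟩
    obtain ⟨w, hw⟩ := Filter.frequently_exists.1 h1
    obtain ⟨-, hw'⟩ := hw.exists
    refine ⟨w, ?_, hw.exists.choose_spec.1⟩
    exact (Filter.tendsto_add_atTop_nat 1).frequently (p := fun i => ω i = w)
      (hw.mono fun i hi => hi.2)

/-! ### Criteria for almost-sure winning -/

theorem mem_almostSure_of_ae {ψ : Set (ℕ → V)} {v : V} (h : ∀ᵐ ω ∂P.playMeasure σ v, ω ∈ ψ) :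
    v ∈ P.almostSure ψ := by
  refine ⟨σ, ?_⟩
  rw [measure_congr (show ψ =ᵐ[P.playMeasure σ v] Set.univ from Filter.eventuallyEq_univ.2 h),
    measure_univ]

/-- The objective is not assumed measurable, so failure is witnessed by a measurable event `E` of
positive probability. If `ψ` had measure `1`, so would the complement of `E`. -/
theorem notMem_almostSure {ψ : Set (ℕ → V)} {v : V}
    (h : ∀ σ : P.Strategy, ∃ E : Set (ℕ → V), MeasurableSet E ∧
      (¬ ∀ᵐ ω ∂P.playMeasure σ v, ω ∉ E) ∧ ∀ᵐ ω ∂P.playMeasure σ v, ω ∈ E → ω ∉ ψ) :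
    v ∉ P.almostSure ψ := by
  rintro ⟨σ, hσ⟩
  obtain ⟨E, hE, hpos, hae⟩ := h σ
  have h1 : P.playMeasure σ v ψ ≤ P.playMeasure σ v Eᶜ :=
    measure_mono_ae (by filter_upwards [hae] with ω h hψ hE using h hE hψ)
  rw [hσ] at h1
  have h2 : P.playMeasure σ v Eᶜ = 1 := le_antisymm prob_le_one h1
  rw [prob_compl_eq_one_iff hE] at h2
  exact hpos (measure_eq_zero_iff_ae_notMem.1 h2)

/-- The strategy that always moves from `v` to `f v`. -/
def positional {P : MDP V} (f : V → V) (hf : ∀ v, v ∉ P.random → P.edge v (f v)) : P.Strategy where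
  choose _ h := f (last h)
  edge_choose _ h := hf (last h)

theorem ae_mem_of_positional {P : MDP V} (f : V → V) (hf : ∀ v, v ∉ P.random → P.edge v (f v))
    {S : Set V} (hrandom : ∀ u ∈ S, u ∈ P.random → ∀ w, P.edge u w → w ∈ S)
    (hplayer : ∀ u ∈ S, u ∉ P.random → f u ∈ S) {v : V} (hv : v ∈ S) :
    ∀ᵐ ω ∂P.playMeasure (positional f hf) v, ∀ n, ω n ∈ S := by
  filter_upwards [P.ae_next_ne_zero (positional f hf) v, P.ae_zero (positional f hf) v]
    with ω h h0 n
  induction n with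
  | zero => rwa [h0]
  | succ n ih =>
    by_cases hr : ω n ∈ P.random
    · exact hrandom _ ih hr _ ((P.next_ne_zero_iff_of_random _
        (h := Preorder.frestrictLe (π := fun _ => V) n ω) hr _).1 (h n))
    · rw [(P.next_ne_zero_iff_of_not_random _
        (h := Preorder.frestrictLe (π := fun _ => V) n ω) hr _).1 (h n)]
      exact hplayer _ ih hr

end MDP

/-! ### The reduction from orthogonal vectors -/

/-- Two nonempty sequences of Boolean vectors of dimension `d`. -/
structure OVTable where
  d : ℕ
  n₁ : ℕ
  n₂ : ℕ
  A : ℕ → ℕ → Bool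
  B : ℕ → ℕ → Bool
  n₁_pos : 0 < n₁
  n₂_pos : 0 < n₂

namespace OVTable

variable (x : OVTable)

def HasOrthogonalPair : Prop :=
  ∃ j < x.n₁, ∃ k < x.n₂, ∀ i < x.d, x.A j i = false ∨ x.B k i = false

/-- The vertices are `0`, one vertex `1 + j` for each vector of the first sequence, two vertices
`x.coord + 2 * i + b` for each coordinate, and two vertices `x.second + 2 * k + b` for each vector
of the second sequence. -/
def coord : ℕ := 1 + x.n₁

def second : ℕ := x.coord + 2 * x.d

def vertices : ℕ := x.second + 2 * x.n₂

/-- The edges; from the vertices of the second sequence they lead to vertex `0` if `c` is set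
and back to the same vertex otherwise. -/
def edges (c : Bool) : List (ℕ × ℕ) :=
  ((List.range x.n₁).map fun j => (0, 1 + j)) ++
  ((List.range x.n₁).flatMap fun j => (1 + j, 0) ::
    (List.range x.d).map fun i => (1 + j, x.coord + 2 * i + (x.A j i).toNat)) ++
  ((List.range x.d).flatMap fun i => (x.coord + 2 * i, 0) ::
    (List.range x.n₂).map fun k =>
      (x.coord + 2 * i + 1, x.second + 2 * k + (x.B k i).toNat)) ++
  (List.range (2 * x.n₂)).map fun q => (x.second + q, if c then 0 else x.second + q)

/-- The random vertices are the positive ones below this bound. -/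
def randomBound (c : Bool) : ℕ := if c then x.second else x.coord

/-- The edge list as a relation, suited to case analysis. The edge from `1 + j` to `0` also
guarantees a successor in dimension zero. -/
def Edge (c : Bool) (u v : ℕ) : Prop :=
  (u = 0 ∧ ∃ j < x.n₁, v = 1 + j) ∨
  (∃ j < x.n₁, u = 1 + j ∧ (v = 0 ∨ ∃ i < x.d, v = x.coord + 2 * i + (x.A j i).toNat)) ∨
  (∃ i < x.d, (u = x.coord + 2 * i ∧ v = 0) ∨
    (u = x.coord + 2 * i + 1 ∧ ∃ k < x.n₂, v = x.second + 2 * k + (x.B k i).toNat)) ∨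
  ∃ q < 2 * x.n₂, u = x.second + q ∧ v = if c then 0 else x.second + q

variable {x} {c : Bool} {u v : ℕ}

theorem mem_edges : (u, v) ∈ x.edges c ↔ x.Edge c u v := by
  simp only [edges, List.mem_append, List.mem_map, List.mem_range, Prod.mk.injEq,
    List.mem_flatMap, List.mem_cons, Edge]
  constructor
  · rintro (((⟨j, hj, rfl, rfl⟩ | ⟨j, hj, ⟨rfl, rfl⟩ | ⟨i, hi, rfl, rfl⟩⟩) |
      ⟨i, hi, ⟨rfl, rfl⟩ | ⟨k, hk, rfl, rfl⟩⟩) | ⟨q, hq, rfl, rfl⟩)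
    · exact .inl ⟨rfl, j, hj, rfl⟩
    · exact .inr (.inl ⟨j, hj, rfl, .inl rfl⟩)
    · exact .inr (.inl ⟨j, hj, rfl, .inr ⟨i, hi, rfl⟩⟩)
    · exact .inr (.inr (.inl ⟨i, hi, .inl ⟨rfl, rfl⟩⟩))
    · exact .inr (.inr (.inl ⟨i, hi, .inr ⟨rfl, k, hk, rfl⟩⟩))
    · exact .inr (.inr (.inr ⟨q, hq, rfl, rfl⟩))
  · rintro (⟨rfl, j, hj, rfl⟩ | ⟨j, hj, rfl, rfl | ⟨i, hi, rfl⟩⟩ |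
      ⟨i, hi, ⟨rfl, rfl⟩ | ⟨rfl, k, hk, rfl⟩⟩ | ⟨q, hq, rfl, rfl⟩)
    · exact .inl (.inl (.inl ⟨j, hj, rfl, rfl⟩))
    · exact .inl (.inl (.inr ⟨j, hj, .inl ⟨rfl, rfl⟩⟩))
    · exact .inl (.inl (.inr ⟨j, hj, .inr ⟨i, hi, rfl, rfl⟩⟩))
    · exact .inl (.inr ⟨i, hi, .inl ⟨rfl, rfl⟩⟩)
    · exact .inl (.inr ⟨i, hi, .inr ⟨k, hk, rfl, rfl⟩⟩)
    · exact .inr ⟨q, hq, rfl, rfl⟩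

theorem Edge.lt (h : x.Edge c u v) : u < x.vertices ∧ v < x.vertices := by
  simp only [vertices, second, coord]
  rcases h with ⟨rfl, j, hj, rfl⟩ | ⟨j, hj, rfl, rfl | ⟨i, hi, rfl⟩⟩ |
      ⟨i, hi, ⟨rfl, rfl⟩ | ⟨rfl, k, hk, rfl⟩⟩ | ⟨q, hq, rfl, rfl⟩
  · omega
  · omega
  · have := (x.A j i).toNat_le
    simp only [coord]
    omega
  · simp only [coord]
    omega
  · have := (x.B k i).toNat_le
    simp only [second, coord]
    omega
  · simp only [second, coord]
    split_ifs <;> omega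

/-- The groups of edges start in disjoint ranges of vertices, and within a group `2 * i + b` with a
bit `b` determines `i`. -/
theorem nodup_edges : (x.edges c).Nodup := by
  have hinj : ∀ {f : ℕ → ℕ × ℕ} {n : ℕ}, Function.Injective f → ((List.range n).map f).Nodup :=
    fun hf => List.nodup_range.map hf
  simp only [edges, List.nodup_append', List.nodup_flatMap, List.nodup_cons, List.disjoint_left,
    List.mem_append, List.mem_map, List.mem_range, List.mem_flatMap, List.mem_cons]
  refine ⟨⟨⟨hinj fun a b h => ?_, ⟨fun j _ => ⟨?_, hinj fun a b h => ?_⟩,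
    (List.nodup_range (n := x.n₁)).imp fun {a b} hab => ?_⟩, ?_⟩, ⟨fun i _ => ⟨?_, hinj fun a b h => ?_⟩,
    (List.nodup_range (n := x.d)).imp fun {a b} hab => ?_⟩, ?_⟩, hinj fun a b h => ?_, ?_⟩
  · simp only [Prod.mk.injEq] at h
    omega
  · rintro ⟨i, -, h⟩
    simp only [Prod.mk.injEq, coord] at h
    omega
  · simp only [Prod.mk.injEq] at h
    have := (x.A j a).toNat_le
    have := (x.A j b).toNat_le
    omega
  · simp only [Function.onFun, List.disjoint_left, List.mem_cons, List.mem_map]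
    rintro e (rfl | ⟨i, -, rfl⟩) (h | ⟨i', -, h⟩) <;> simp only [Prod.mk.injEq] at h <;> omega
  · rintro e ⟨j, -, rfl⟩ ⟨j', -, h | ⟨i', -, h⟩⟩ <;> simp only [Prod.mk.injEq] at h <;> omega
  · rintro ⟨k, -, h⟩
    simp only [Prod.mk.injEq] at h
    omega
  · simp only [Prod.mk.injEq] at h
    have := (x.B a i).toNat_le
    have := (x.B b i).toNat_le
    omega
  · simp only [Function.onFun, List.disjoint_left, List.mem_cons, List.mem_map]
    rintro e (rfl | ⟨i, -, rfl⟩) (h | ⟨i', -, h⟩) <;> simp only [Prod.mk.injEq] at h <;> omega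
  · rintro e (⟨j, hj, rfl⟩ | ⟨j, hj, rfl | ⟨i, -, rfl⟩⟩) ⟨j', -, h | ⟨i', -, h⟩⟩ <;>
      simp only [Prod.mk.injEq, coord] at h <;> omega
  · simp only [Prod.mk.injEq] at h
    omega
  · rintro e ((⟨j, hj, rfl⟩ | ⟨j, hj, rfl | ⟨i, -, rfl⟩⟩) | ⟨j, hj, rfl | ⟨i, -, rfl⟩⟩) ⟨j', -, h⟩ <;>
      simp only [Prod.mk.injEq, second, coord] at h <;> omega

/-! #### Successors -/

theorem edge_zero : x.Edge c 0 v ↔ ∃ j < x.n₁, v = 1 + j := by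
  refine ⟨?_, fun h => .inl ⟨rfl, h⟩⟩
  rintro (⟨-, h⟩ | ⟨j, hj, h, -⟩ | ⟨i, hi, ⟨h, -⟩ | ⟨h, -⟩⟩ | ⟨q, hq, h, -⟩)
  · exact h
  all_goals
    try simp only [second, coord] at h
    omega

theorem edge_first {j : ℕ} (hj : j < x.n₁) : x.Edge c (1 + j) v ↔
    v = 0 ∨ ∃ i < x.d, v = x.coord + 2 * i + (x.A j i).toNat := by
  refine ⟨?_, fun h => .inr (.inl ⟨j, hj, rfl, h⟩)⟩
  rintro (⟨h, -⟩ | ⟨j', -, h, h'⟩ | ⟨i, hi, ⟨h, -⟩ | ⟨h, -⟩⟩ | ⟨q, hq, h, -⟩)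
  · omega
  · obtain rfl : j = j' := by omega
    exact h'
  all_goals
    simp only [second, coord] at h
    omega

theorem edge_coord_zero {i : ℕ} (hi : i < x.d) : x.Edge c (x.coord + 2 * i) v ↔ v = 0 := by
  refine ⟨?_, fun h => .inr (.inr (.inl ⟨i, hi, .inl ⟨rfl, h⟩⟩))⟩
  rintro (⟨h, -⟩ | ⟨j', hj', h, -⟩ | ⟨i, hi, ⟨h, h'⟩ | ⟨h, -⟩⟩ | ⟨q, hq, h, -⟩)
  rotate_left 2
  · exact h'
  all_goals
    simp only [second, coord] at *
    omega

theorem edge_coord_one {i : ℕ} (hi : i < x.d) : x.Edge c (x.coord + 2 * i + 1) v ↔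
    ∃ k < x.n₂, v = x.second + 2 * k + (x.B k i).toNat := by
  refine ⟨?_, fun h => .inr (.inr (.inl ⟨i, hi, .inr ⟨rfl, h⟩⟩))⟩
  rintro (⟨h, -⟩ | ⟨j', hj', h, -⟩ | ⟨i', hi, ⟨h, -⟩ | ⟨h, h'⟩⟩ | ⟨q, hq, h, -⟩)
  rotate_left 3
  · obtain rfl : i = i' := by omega
    exact h'
  all_goals
    simp only [second, coord] at *
    omega

theorem edge_second {q : ℕ} (hq : q < 2 * x.n₂) : x.Edge c (x.second + q) v ↔
    v = if c then 0 else x.second + q := by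
  refine ⟨?_, fun h => .inr (.inr (.inr ⟨q, hq, rfl, h⟩))⟩
  rintro (⟨h, -⟩ | ⟨j', hj', h, -⟩ | ⟨i', hi, ⟨h, -⟩ | ⟨h, h'⟩⟩ | ⟨q', hq, h, h'⟩)
  rotate_left 4
  · obtain rfl : q = q' := by omega
    exact h'
  all_goals
    simp only [second, coord] at *
    omega

theorem vertex_cases (hu : u < x.vertices) : u = 0 ∨ (∃ j < x.n₁, u = 1 + j) ∨
    (∃ i < x.d, u = x.coord + 2 * i) ∨ (∃ i < x.d, u = x.coord + 2 * i + 1) ∨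
    ∃ q < 2 * x.n₂, u = x.second + q := by
  simp only [vertices, second, coord] at *
  rcases Nat.eq_zero_or_pos u with h | h
  · exact .inl h
  rcases lt_or_ge u (1 + x.n₁) with h1 | h1
  · exact .inr (.inl ⟨u - 1, by omega, by omega⟩)
  rcases lt_or_ge u (1 + x.n₁ + 2 * x.d) with h2 | h2
  · rcases Nat.even_or_odd' (u - (1 + x.n₁)) with ⟨i, hi | hi⟩
    · exact .inr (.inr (.inl ⟨i, by omega, by omega⟩))
    · exact .inr (.inr (.inr (.inl ⟨i, by omega, by omega⟩)))
  · exact .inr (.inr (.inr (.inr ⟨u - (1 + x.n₁ + 2 * x.d), by omega, by omega⟩)))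

theorem exists_edge (hu : u < x.vertices) : ∃ v, x.Edge c u v := by
  have h1 := x.n₁_pos
  have h2 := x.n₂_pos
  rcases vertex_cases hu with rfl | ⟨j, hj, rfl⟩ | ⟨i, hi, rfl⟩ | ⟨i, hi, rfl⟩ | ⟨q, hq, rfl⟩
  · exact ⟨_, edge_zero.2 ⟨0, h1, rfl⟩⟩
  · exact ⟨_, (edge_first hj).2 (.inl rfl)⟩
  · exact ⟨_, (edge_coord_zero hi).2 rfl⟩
  · exact ⟨_, (edge_coord_one hi).2 ⟨0, h2, rfl⟩⟩
  · exact ⟨_, (edge_second hq).2 rfl⟩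

variable (x c)

def toInput : MDPInput where
  n := x.vertices
  n_pos := by
    simp only [vertices, second, coord]
    omega
  random v := decide (0 < (v : ℕ) ∧ (v : ℕ) < x.randomBound c)
  edges := (x.edges c).pmap (fun e he => (⟨e.1, he.1⟩, ⟨e.2, he.2⟩))
    fun _ he => (mem_edges.1 he).lt
  edges_nodup := nodup_edges.pmap fun a _ b _ h => by
    simpa [Prod.ext_iff] using h
  exists_edge v := by
    obtain ⟨w, hw⟩ := exists_edge (c := c) v.2
    exact ⟨⟨w, hw.lt.2⟩, List.mem_pmap.2 ⟨(v, w), mem_edges.2 hw, rfl⟩⟩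

variable {x c}

theorem toMDP_edge {u v : Fin (x.toInput c).n} :
    (x.toInput c).toMDP.edge u v ↔ x.Edge c u v := by
  rw [← mem_edges]
  refine (List.mem_pmap (b := ((u, v) : Fin x.vertices × Fin x.vertices))).trans ?_
  constructor
  · rintro ⟨e, he, h⟩
    have : e = ((u : ℕ), (v : ℕ)) := Prod.ext
      (congrArg (fun p : Fin x.vertices × Fin x.vertices => (p.1 : ℕ)) h)
      (congrArg (fun p : Fin x.vertices × Fin x.vertices => (p.2 : ℕ)) h)
    exact this ▸ he
  · exact fun h => ⟨_, h, rfl⟩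

theorem mem_random {u : Fin (x.toInput c).n} :
    u ∈ (x.toInput c).toMDP.random ↔ 0 < (u : ℕ) ∧ (u : ℕ) < x.randomBound c := by
  change decide _ = true ↔ _
  exact decide_eq_true_iff

end OVTable

namespace OVTable

variable {x : OVTable} {c : Bool}

theorem pos_vertices : 0 < x.vertices := (x.toInput false).n_pos

theorem second_add_lt {k : ℕ} (hk : k < x.n₂) (b : Bool) :
    x.second + 2 * k + b.toNat < x.vertices := by
  have := b.toNat_le
  simp only [vertices]
  omega

/-- The start vertex. -/
def start (x : OVTable) (c : Bool) : Fin (x.toInput c).n := ⟨0, pos_vertices⟩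

/-- The vertices of a vector of the second sequence. -/
def target (x : OVTable) (c b : Bool) (k : Fin x.n₂) : Fin (x.toInput c).n :=
  ⟨x.second + 2 * k + b.toNat, second_add_lt k.2 b⟩

/-! #### Sets of vertices that are visited infinitely often -/

section Recurrent

variable {I : Set (Fin (x.toInput c).n)} {S : ℕ → Prop}

/-- The numbers of the vertices in `I`. -/
def indices (I : Set (Fin (x.toInput c).n)) (u : ℕ) : Prop := ∃ v ∈ I, (v : ℕ) = u

theorem exists_indices (hI : (x.toInput c).toMDP.Recurrent I) {u : ℕ} (hu : indices I u) :
    ∃ v, x.Edge c u v ∧ indices I v := by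
  obtain ⟨u, hu, rfl⟩ := hu
  obtain ⟨v, hv, he⟩ := hI.exists_edge u hu
  exact ⟨v, toMDP_edge.1 he, v, hv, rfl⟩

theorem indices_of_edge (hI : (x.toInput c).toMDP.Recurrent I) {u v : ℕ} (hu : indices I u)
    (h0 : 0 < u) (hr : u < x.randomBound c) (he : x.Edge c u v) : indices I v := by
  obtain ⟨u, hu, rfl⟩ := hu
  exact ⟨⟨v, he.lt.2⟩, hI.random u hu (mem_random.2 ⟨h0, hr⟩) _ (toMDP_edge.2 he), rfl⟩

theorem indices_zero_of_first (hI : (x.toInput c).toMDP.Recurrent I) {j : ℕ} (hj : j < x.n₁)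
    (h : indices I (1 + j)) : indices I 0 := by
  refine indices_of_edge hI h (by omega) ?_ ((edge_first hj).2 (.inl rfl))
  simp only [randomBound, second, coord]
  split_ifs <;> omega

theorem indices_zero_of_coord (hI : (x.toInput c).toMDP.Recurrent I) {i : ℕ} (hi : i < x.d)
    (h : indices I (x.coord + 2 * i)) : indices I 0 := by
  obtain ⟨v, he, hv⟩ := exists_indices hI h
  rwa [(edge_coord_zero hi).1 he] at hv

end Recurrent

/-! #### Plays that return to the start vertex -/

section Return

variable {I : Set (Fin (x.toInput true).n)}

/-- With `c` set, each layer of the graph leads to a later layer or to `0`, and the last layer leads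
to `0`; so every play keeps returning, whatever the strategy. -/
theorem indices_zero (hI : (x.toInput true).toMDP.Recurrent I) : indices I 0 := by
  have hY : ∀ q < 2 * x.n₂, indices I (x.second + q) → indices I 0 := by
    intro q hq h
    obtain ⟨v, he, hv⟩ := exists_indices hI h
    rw [edge_second hq, if_pos rfl] at he
    rwa [he] at hv
  obtain ⟨u, hu⟩ := hI.nonempty
  have hu' : indices I u := ⟨u, hu, rfl⟩
  rcases vertex_cases (x := x) u.2 with h | ⟨j, hj, h⟩ | ⟨i, hi, h⟩ | ⟨i, hi, h⟩ | ⟨q, hq, h⟩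
  · rwa [h] at hu'
  · rw [h] at hu'
    exact indices_zero_of_first hI hj hu'
  · rw [h] at hu'
    exact indices_zero_of_coord hI hi hu'
  · rw [h] at hu'
    obtain ⟨v, he, hv⟩ := exists_indices hI hu'
    obtain ⟨k, hk, rfl⟩ := (edge_coord_one hi).1 he
    have := (x.B k i).toNat_le
    exact hY (2 * k + (x.B k i).toNat) (by omega) (by rwa [← Nat.add_assoc])
  · rw [h] at hu'
    exact hY q hq hu'

theorem start_mem (hI : (x.toInput true).toMDP.Recurrent I) : x.start true ∈ I := by
  obtain ⟨u, hu, h⟩ := indices_zero hI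
  rwa [show x.start true = u from Fin.ext h.symm]

/-- Some choice `1 + j` recurs along with `0`. As vectors `j` and `k` share a one at some coordinate
`i`, the path through coordinate `i` to the target uses moves of chance only, so recurrence
propagates along it. -/
theorem target_mem (hI : (x.toInput true).toMDP.Recurrent I) (h : ¬ x.HasOrthogonalPair)
    (k : Fin x.n₂) : x.target true true k ∈ I := by
  obtain ⟨v, he, hv⟩ := exists_indices hI (indices_zero hI)
  obtain ⟨j, hj, rfl⟩ := edge_zero.1 he
  simp only [HasOrthogonalPair, not_exists, not_and, not_forall, not_or,
    Bool.not_eq_false] at h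
  obtain ⟨i, hi, hA, hB⟩ := h j hj k k.2
  have h1 : indices I (x.coord + 2 * i + 1) := by
    refine indices_of_edge hI hv (by omega) ?_ ((edge_first hj).2 (.inr ⟨i, hi, by simp [hA]⟩))
    simp only [randomBound, second, coord, if_pos]
    omega
  have h2 : indices I (x.second + 2 * k + 1) := by
    refine indices_of_edge hI h1 (by omega) ?_ ((edge_coord_one hi).2 ⟨k, k.2, by simp [hB]⟩)
    simp only [randomBound, second, if_pos]
    omega
  obtain ⟨u, hu, h⟩ := h2
  rwa [show x.target true true k = u from Fin.ext h.symm]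

/-- Without orthogonal pair, all targets are visited infinitely often. -/
theorem notMem_coBuchi (h : ¬ x.HasOrthogonalPair) {ψ : Set (ℕ → Fin (x.toInput true).n)}
    (hψ : ∀ ω ∈ ψ, ∃ k, x.target true true k ∉ infSet ω) :
    x.start true ∉ (x.toInput true).toMDP.almostSure ψ := by
  refine MDP.notMem_almostSure _ fun σ => ⟨Set.univ, MeasurableSet.univ, ?_, ?_⟩
  · intro h
    obtain ⟨ω, hω⟩ := h.exists
    exact hω trivial
  · filter_upwards [MDP.ae_recurrent _ σ _] with ω hω _ hω'
    obtain ⟨k, hk⟩ := hψ ω hω'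
    exact hk (target_mem hω h k)

/-- A strategy that always makes the same choice in the start vertex. -/
theorem exists_positional (x : OVTable) (c : Bool) (f : ℕ → ℕ)
    (hf : ∀ u, ∀ v, x.Edge c u v → x.Edge c u (f u)) :
    ∃ (g : Fin (x.toInput c).n → Fin (x.toInput c).n)
      (_ : ∀ v, v ∉ (x.toInput c).toMDP.random → (x.toInput c).toMDP.edge v (g v)),
      ∀ u, ((g u : Fin _) : ℕ) = f u := by
  have hf' : ∀ u : Fin (x.toInput c).n, x.Edge c u (f u) := fun u => by
    obtain ⟨v, hv⟩ := exists_edge (x := x) (c := c) u.2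
    exact hf u v hv
  exact ⟨fun u => ⟨f u, (hf' u).lt.2⟩, fun u _ => toMDP_edge.2 (hf' u), fun u => rfl⟩

open Classical in
/-- The successor of `u` if it is unique, with choices for the start vertex and the coordinates. -/
noncomputable def move (x : OVTable) (c : Bool) (j : ℕ) (k : ℕ) (u : ℕ) : ℕ :=
  if u = 0 then 1 + j else
  if h : ∃ i < x.d, u = x.coord + 2 * i + 1 then x.second + 2 * k + (x.B k h.choose).toNat else
  if h : ∃ v, x.Edge c u v then h.choose else 0

theorem move_coord {j k i : ℕ} (hi : i < x.d) :
    x.move c j k (x.coord + 2 * i + 1) = x.second + 2 * k + (x.B k i).toNat := by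
  have h : ∃ i' < x.d, x.coord + 2 * i + 1 = x.coord + 2 * i' + 1 := ⟨i, hi, rfl⟩
  rw [move, if_neg (by omega), dif_pos h]
  have := h.choose_spec.2
  rw [show h.choose = i by omega]

theorem edge_move {j k : ℕ} (hj : j < x.n₁) (hk : k < x.n₂) (u v : ℕ) (h : x.Edge c u v) :
    x.Edge c u (x.move c j k u) := by
  by_cases hu : u = 0
  · subst hu
    exact edge_zero.2 ⟨j, hj, by simp [move]⟩
  by_cases hu' : ∃ i < x.d, u = x.coord + 2 * i + 1
  · obtain ⟨i, hi, rfl⟩ := hu'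
    rw [move_coord hi]
    exact (edge_coord_one hi).2 ⟨k, hk, rfl⟩
  have hex : ∃ v, x.Edge c u v := ⟨v, h⟩
  rw [move, if_neg hu, dif_neg hu', dif_pos hex]
  exact hex.choose_spec

/-- With an orthogonal pair, the play can avoid a target while it always returns to the start
vertex. -/
theorem mem_coBuchi {j k : ℕ} (hj : j < x.n₁) (hk : k < x.n₂)
    (h : ∀ i < x.d, x.A j i = false ∨ x.B k i = false) {ψ : Set (ℕ → Fin (x.toInput true).n)}
    (hψ : ∀ ω, x.start true ∈ infSet ω → x.target true true ⟨k, hk⟩ ∉ infSet ω → ω ∈ ψ) :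
    x.start true ∈ (x.toInput true).toMDP.almostSure ψ := by
  obtain ⟨g, hg, hgf⟩ := x.exists_positional true (x.move true j k) (edge_move hj hk)
  -- A set that contains everything reachable when `j` is always chosen; from the second sequence
  -- only the target `2 * k + 1` is left out.
  let S : ℕ → Prop := fun u => u = 0 ∨ u = 1 + j ∨
    (∃ i < x.d, u = x.coord + 2 * i + (x.A j i).toNat) ∨
    ∃ q < 2 * x.n₂, u = x.second + q ∧ q ≠ 2 * k + 1
  have hsucc : ∀ u v, S u → u ≠ 0 → x.Edge true u v → S v := by
    rintro u v (rfl | rfl | ⟨i, hi, rfl⟩ | ⟨q, hq, rfl, -⟩) h0 he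
    · exact absurd rfl h0
    · rcases (edge_first hj).1 he with rfl | ⟨i, hi, rfl⟩
      · exact .inl rfl
      · exact .inr (.inr (.inl ⟨i, hi, rfl⟩))
    · cases hA : x.A j i with
      | false =>
        rw [hA, Bool.toNat_false, Nat.add_zero, edge_coord_zero hi] at he
        exact .inl he
      | true =>
        rw [hA, Bool.toNat_true, edge_coord_one hi] at he
        obtain ⟨k', hk', rfl⟩ := he
        have := (x.B k' i).toNat_le
        refine .inr (.inr (.inr ⟨2 * k' + (x.B k' i).toNat, by omega, by omega, fun hq => ?_⟩))
        obtain rfl : k = k' := by omega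
        -- Entering the target would require a common one of the vectors `j` and `k` at `i`.
        have := (h i hi).resolve_left (by simp [hA])
        rw [this, Bool.toNat_false] at hq
        omega
    · rw [edge_second hq, if_pos rfl] at he
      exact .inl he
  have hstay : ∀ᵐ ω ∂MDP.playMeasure _ (MDP.positional g hg) (x.start true), ∀ n,
      ω n ∈ {u : Fin (x.toInput true).n | S u} := by
    refine MDP.ae_mem_of_positional g hg (fun u hu hr w hw => ?_) (fun u hu hr => ?_) (.inl rfl)
    · exact hsucc _ _ hu (mem_random.1 hr).1.ne' (toMDP_edge.1 hw)
    · by_cases h0 : (u : ℕ) = 0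
      · refine .inr (.inl ?_)
        rw [hgf, h0]
        simp [move]
      · exact hsucc _ _ hu h0 (toMDP_edge.1 (hg u hr))
  refine MDP.mem_almostSure_of_ae _ (MDP.positional g hg) ?_
  filter_upwards [MDP.ae_recurrent _ (MDP.positional g hg) _, hstay] with ω hω hS
  refine hψ ω (start_mem hω) fun hmem => ?_
  have := infSet_subset (S := {u : Fin (x.toInput true).n | S u}) hS hmem
  simp only [Set.mem_ofPred_eq, target, S, Bool.toNat_true, second, coord] at this
  rcases this with h | h | ⟨i, hi, h⟩ | ⟨q, -, h, h'⟩
  · omega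
  · omega
  · have := (x.A j i).toNat_le
    omega
  · omega

end Return

/-! #### Plays that may end in a vertex of the second sequence -/

section Absorbing

/-- Player 1 chooses `j` in the start vertex and `k` at coordinates. A coordinate vertex with bit
one is reached only where vector `j` has a one, hence where vector `k` has a zero, so the only
absorbing vertex that can be entered is the target. Any recurring vertex then makes `0` or the
target recur. -/
theorem mem_buchi {j k : ℕ} (hj : j < x.n₁) (hk : k < x.n₂)
    (h : ∀ i < x.d, x.A j i = false ∨ x.B k i = false) :
    x.start false ∈ (x.toInput false).toMDP.almostSure
      (buchi {x.start false, x.target false false ⟨k, hk⟩}) := by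
  obtain ⟨g, hg, hgf⟩ := x.exists_positional false (x.move false j k) (edge_move hj hk)
  let S : ℕ → Prop := fun u => u = 0 ∨ u = 1 + j ∨
    (∃ i < x.d, u = x.coord + 2 * i + (x.A j i).toNat) ∨ u = x.second + 2 * k
  have hk2 : 2 * k < 2 * x.n₂ := by omega
  have hB : ∀ i < x.d, x.A j i = true → x.B k i = false := fun i hi hA =>
    (h i hi).resolve_left (by simp [hA])
  have hstay : ∀ᵐ ω ∂MDP.playMeasure _ (MDP.positional g hg) (x.start false), ∀ n,
      ω n ∈ {u : Fin (x.toInput false).n | S u} := by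
    refine MDP.ae_mem_of_positional g hg (fun u hu hr w hw => ?_) (fun u hu hr => ?_) (.inl rfl)
    · have hr := mem_random.1 hr
      have hw := toMDP_edge.1 hw
      simp only [randomBound, coord, Bool.false_eq_true, if_false] at hr
      rcases hu with h0 | h0 | ⟨i, hi, h0⟩ | h0
      · omega
      · rw [h0, edge_first hj] at hw
        rcases hw with hw | ⟨i, hi, hw⟩
        · exact .inl hw
        · exact .inr (.inr (.inl ⟨i, hi, hw⟩))
      · simp only [coord] at h0
        omega
      · simp only [second, coord] at h0
        omega
    · have hgu := toMDP_edge.1 (hg u hr)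
      rcases hu with h0 | h0 | ⟨i, hi, h0⟩ | h0
      · refine .inr (.inl ?_)
        rw [hgf, h0]
        simp [move]
      · refine absurd (mem_random.2 ⟨by omega, ?_⟩) hr
        simp only [randomBound, coord, Bool.false_eq_true, if_false]
        omega
      · cases hA : x.A j i with
        | false =>
          rw [h0, hA, Bool.toNat_false, Nat.add_zero, edge_coord_zero hi] at hgu
          exact .inl hgu
        | true =>
          refine .inr (.inr (.inr ?_))
          rw [hgf, h0, hA, Bool.toNat_true, move_coord hi, hB i hi hA, Bool.toNat_false, Nat.add_zero]
      · rw [h0, edge_second hk2] at hgu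
        exact .inr (.inr (.inr hgu))
  refine MDP.mem_almostSure_of_ae _ (MDP.positional g hg) ?_
  filter_upwards [MDP.ae_recurrent _ (MDP.positional g hg) _, hstay] with ω hω hS
  have hzero : indices (infSet ω) 0 → ω ∈ buchi {x.start false, x.target false false ⟨k, hk⟩} := by
    rintro ⟨u, hu, h0⟩
    obtain rfl : u = x.start false := Fin.ext h0
    exact ⟨_, hu, .inl rfl⟩
  have htarget : indices (infSet ω) (x.second + 2 * k) →
      ω ∈ buchi {x.start false, x.target false false ⟨k, hk⟩} := by
    rintro ⟨u, hu, h0⟩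
    obtain rfl : u = x.target false false ⟨k, hk⟩ := Fin.ext h0
    exact ⟨_, hu, .inr rfl⟩
  have hsub : ∀ u, indices (infSet ω) u → S u := by
    rintro _ ⟨u, hu, rfl⟩
    exact infSet_subset (S := {u : Fin (x.toInput false).n | S u}) hS hu
  obtain ⟨u, hu⟩ := hω.nonempty
  have hu' : indices (infSet ω) u := ⟨u, hu, rfl⟩
  rcases hsub _ hu' with h0 | h0 | ⟨i, hi, h0⟩ | h0
  · exact hzero (h0 ▸ hu')
  · exact hzero (indices_zero_of_first hω hj (h0 ▸ hu'))
  · rw [h0] at hu'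
    cases hA : x.A j i with
    | false =>
      rw [hA] at hu'
      exact hzero (indices_zero_of_coord hω hi hu')
    | true =>
      rw [hA, Bool.toNat_true] at hu'
      obtain ⟨v, he, hv⟩ := exists_indices hω hu'
      obtain ⟨k', hk', rfl⟩ := (edge_coord_one hi).1 he
      -- Some successor of this coordinate vertex recurs and lies in `S`; the only candidate is the
      -- target.
      have hSv := hsub _ hv
      simp only [S, second, coord] at hSv
      rcases hSv with h1 | h1 | ⟨i', hi', h1⟩ | h1
      · omega
      · omega
      · have := (x.A j i').toNat_le
        omega
      · rw [show x.second + 2 * k' + (x.B k' i).toNat = x.second + 2 * k by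
          simp only [second, coord]; omega] at hv
        exact htarget hv
  · exact htarget (h0 ▸ hu')

/-- Some first choice `j` has positive probability, chance may then draw a common one `i` of the
vectors `j` and `k`, and some answer of the player has positive probability. It leads to an
absorbing vertex, and not to the target: vector `k` has bit one at `i`. -/
theorem notMem_buchi (h : ¬ x.HasOrthogonalPair) (k : Fin x.n₂) :
    x.start false ∉ (x.toInput false).toMDP.almostSure
      (buchi {x.start false, x.target false false k}) := by
  refine MDP.notMem_almostSure _ fun σ => ?_
  simp only [HasOrthogonalPair, not_exists, not_and, not_forall, not_or,
    Bool.not_eq_false] at h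
  have h0 : ¬ ∀ᵐ ω ∂(x.toInput false).toMDP.playMeasure σ (x.start false), ω 0 ≠ x.start false := by
    intro h
    obtain ⟨ω, h1, h2⟩ := (h.and (MDP.ae_zero _ σ _)).exists
    exact h1 h2
  obtain ⟨u₁, he₁, h₁⟩ := MDP.exists_not_ae_ne_succ _ σ _ h0
  obtain ⟨j, hj, hu₁⟩ := edge_zero.1 (toMDP_edge.1 he₁)
  obtain ⟨i, hi, hA, hB⟩ := h j hj k k.2
  have he₂ : x.Edge false u₁ (x.coord + 2 * i + 1) := by
    rw [hu₁]
    exact (edge_first hj).2 (.inr ⟨i, hi, by simp [hA]⟩)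
  have h₂ := MDP.not_ae_ne_succ _ σ _ (w := ⟨_, he₂.lt.2⟩) h₁ (mem_random.2 (by
    simp only [randomBound, coord, Bool.false_eq_true, if_false]
    omega)) (toMDP_edge.2 he₂)
  obtain ⟨u₃, he₃, h₃⟩ := MDP.exists_not_ae_ne_succ _ σ _ h₂
  obtain ⟨k', hk', hu₃⟩ := (edge_coord_one hi).1 (toMDP_edge.1 he₃)
  -- The third step decides the play, since `u₃` is absorbing.
  refine ⟨{ω | ω 3 = u₃}, measurableSet_coord_eq 3 u₃, h₃, ?_⟩
  filter_upwards [MDP.ae_edge _ σ (x.start false)] with ω hω h3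
  have hstay : ∀ n, ω (n + 3) = u₃ := by
    intro n
    induction n with
    | zero => exact h3
    | succ n ih =>
      have he := toMDP_edge.1 (hω (n + 3))
      have hb := (x.B k' i).toNat_le
      rw [ih, hu₃, Nat.add_assoc, edge_second (by omega)] at he
      refine Fin.ext ?_
      rw [hu₃, show n + 1 + 3 = n + 3 + 1 by omega, he]
      simp [Nat.add_assoc]
  rintro ⟨v, hv, hv'⟩
  have hv : ∃ᶠ n in Filter.atTop, ω n = v := hv
  obtain ⟨n, hn, rfl⟩ := Filter.frequently_atTop.1 hv 3
  rw [show n = n - 3 + 3 by omega, hstay] at hv'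
  rcases hv' with hv' | hv'
  · have := congrArg Fin.val hv'
    rw [hu₃] at this
    simp only [start, second, coord] at this
    omega
  · have := congrArg Fin.val (Set.mem_singleton_iff.1 hv')
    rw [hu₃] at this
    simp only [target, Bool.toNat_false] at this
    have hb := (x.B k' i).toNat_le
    obtain rfl : k' = k := by omega
    rw [hB, Bool.toNat_true] at this
    omega

end Absorbing

end OVTable

/-! ### The instances of the problems on Markov decision processes -/

/-- The decision is read off from the output word of vertex `0`, so no postprocessing of the
computed winning set is needed. -/
theorem charVector_eq_cons {n : ℕ} (hn : 0 < n) (W : Set (Fin n)) (p : Prop)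
    (h : ⟨0, hn⟩ ∈ W ↔ p) : ∃ l, charVector W = yesNo p ++ l := by
  obtain ⟨n, rfl⟩ : ∃ m, n = m + 1 := ⟨n - 1, by omega⟩
  have h' : (0 : Fin (n + 1)) ∈ W ↔ p := h
  by_cases hp : p
  · exact ⟨_, by rw [charVector, List.ofFn_succ, if_pos (h'.2 hp), yesNo, if_pos hp]; rfl⟩
  · exact ⟨_, by rw [charVector, List.ofFn_succ, if_neg (mt h'.1 hp), yesNo, if_neg hp]; rfl⟩

theorem List.flatMap_finRange {α : Type*} (n : ℕ) (f : ℕ → List α) :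
    ((List.finRange n).flatMap fun k : Fin n => f (k : ℕ)) = (List.range n).flatMap f := by
  rw [← List.map_coe_finRange_eq_range]
  exact (List.flatMap_map (fun k : Fin n => (k : ℕ)) f _).symm

theorem Set.biUnion_map_finRange {α β : Type*} (n : ℕ) (g : Fin n → α) (F : α → Set β) :
    ⋃ T ∈ (List.finRange n).map g, F T = ⋃ k, F (g k) := by
  simp

theorem encodeVertexSet_singleton {n : ℕ} (v : Fin n) : encodeVertexSet {v} = [1, (v : ℕ)] := by
  simp [encodeVertexSet]

theorem encodeVertexSet_pair {n : ℕ} {u v : Fin n} (h : u < v) :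
    encodeVertexSet {u, v} = [2, (u : ℕ), (v : ℕ)] := by
  have hu : u ∉ ({v} : Finset (Fin n)) := by simpa using h.ne
  rw [encodeVertexSet, Finset.sort_insert _ (by simpa using h.le) hu, Finset.card_insert_of_notMem hu]
  simp

theorem TargetsInput.encode_mk (I : MDPInput) (L : List (Finset (Fin I.n))) (h : L ≠ []) :
    (TargetsInput.mk I L h).encode = I.encode ++ L.length :: L.flatMap encodeVertexSet :=
  rfl

theorem RabinInput.encode_mk (I : MDPInput) (L : List (Finset (Fin I.n) × Finset (Fin I.n)))
    (h : L ≠ []) : (RabinInput.mk I L h).encode = I.encode ++ L.length ::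
      L.flatMap fun LU => encodeVertexSet LU.1 ++ encodeVertexSet LU.2 :=
  rfl

theorem mem_iUnion_coBuchi_map_finRange {V : Type} {n : ℕ} (g : Fin n → V) (ω : ℕ → V) :
    ω ∈ ⋃ T ∈ (List.finRange n).map fun k => ({g k} : Finset V), coBuchi (T : Set V) ↔
      ∃ k, g k ∉ infSet ω := by
  simp [coBuchi]

theorem mem_rabin_map_finRange {V : Type} {n : ℕ} (g : Fin n → Finset V × Finset V) (ω : ℕ → V) :
    ω ∈ rabin (((List.finRange n).map g).map fun LU => ((LU.1 : Set V), (LU.2 : Set V))) ↔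
      ∃ k, (((g k).1 : Set V) ∩ infSet ω).Nonempty ∧ ((g k).2 : Set V) ∩ infSet ω = ∅ := by
  simp [rabin]

namespace OVTable

variable (x : OVTable)

/-- The encoding of the MDP and of one object for each vector of the second sequence, whose
encoding consists of `pre` and one vertex. -/
def words (c : Bool) (pre : List ℕ) : List ℕ :=
  [x.vertices, (x.edges c).length] ++
    ((List.range x.vertices).map fun v => (decide (0 < v ∧ v < x.randomBound c)).toNat) ++
    ((x.edges c).flatMap fun e => [e.1, e.2]) ++
    x.n₂ :: (List.range x.n₂).flatMap fun k => pre ++ [x.second + 2 * k + c.toNat]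

/-- The problem `Q` is at least as hard as deciding whether there is an orthogonal pair. -/
def ReducesTo (Q : MDPProblem) (c : Bool) (pre : List ℕ) : Prop :=
  ∀ x : OVTable, ∃ y : Q.Input, Q.encode y = x.words c pre ∧
    Q.logSize y = (Q.encode y).length.size ∧ Q.m y = (x.edges c).length ∧ Q.k y = x.n₂ ∧
    ∃ l, Q.answer y = yesNo x.HasOrthogonalPair ++ l

theorem encode_toInput (c : Bool) : (x.toInput c).encode = [x.vertices, (x.edges c).length] ++
    ((List.range x.vertices).map fun v => (decide (0 < v ∧ v < x.randomBound c)).toNat) ++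
    ((x.edges c).flatMap fun e => [e.1, e.2]) := by
  have h1 : (x.toInput c).m = (x.edges c).length := by simp [MDPInput.m, toInput]
  have h2 : (List.ofFn fun v => ((x.toInput c).random v).toNat) =
      (List.range x.vertices).map fun v => (decide (0 < v ∧ v < x.randomBound c)).toNat := by
    rw [List.ofFn_eq_map, ← List.map_coe_finRange_eq_range, List.map_map]
    rfl
  have h3 : ((x.toInput c).edges.flatMap fun e => [(e.1 : ℕ), (e.2 : ℕ)]) =
      (x.edges c).flatMap fun e => [e.1, e.2] := by
    simp only [toInput, List.flatMap_def, List.map_pmap, List.pmap_eq_map]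
  rw [MDPInput.encode, h1, h2, h3]
  rfl

/-- The start vertex belongs to every target set, because plays that return to it forever without
being absorbed have to win. -/
def buchiInput : TargetsInput where
  toMDPInput := x.toInput false
  targets := (List.finRange x.n₂).map fun k => {x.start false, x.target false false k}
  targets_ne := by simpa [List.finRange_eq_nil_iff] using x.n₂_pos.ne'

def coBuchiInput : TargetsInput where
  toMDPInput := x.toInput true
  targets := (List.finRange x.n₂).map fun k => {x.target true true k}
  targets_ne := by simpa [List.finRange_eq_nil_iff] using x.n₂_pos.ne'

/-- The start vertex recurs almost surely under every strategy, so the first component of each pair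
imposes no restriction. -/
def rabinInput : RabinInput where
  toMDPInput := x.toInput true
  pairs := (List.finRange x.n₂).map fun k => ({x.start true}, {x.target true true k})
  pairs_ne := by simpa [List.finRange_eq_nil_iff] using x.n₂_pos.ne'

theorem encode_buchiInput : x.buchiInput.encode = x.words false [2, 0] := by
  refine (TargetsInput.encode_mk (x.toInput false) _ _).trans ?_
  rw [encode_toInput, List.length_map, List.length_finRange, words, List.flatMap_map,
    ← List.flatMap_finRange]
  congr 2
  refine List.flatMap_congr fun k _ => encodeVertexSet_pair (Fin.lt_def.2 ?_)
  simp only [start, target, second, coord]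
  omega

theorem encode_coBuchiInput : x.coBuchiInput.encode = x.words true [1] := by
  refine (TargetsInput.encode_mk (x.toInput true) _ _).trans ?_
  rw [encode_toInput, List.length_map, List.length_finRange, words, List.flatMap_map,
    ← List.flatMap_finRange]
  congr 2
  exact List.flatMap_congr fun k _ => encodeVertexSet_singleton _

theorem encode_rabinInput : x.rabinInput.encode = x.words true [1, 0, 1] := by
  refine (RabinInput.encode_mk (x.toInput true) _ _).trans ?_
  rw [encode_toInput, List.length_map, List.length_finRange, words, List.flatMap_map,
    ← List.flatMap_finRange]
  congr 2
  refine List.flatMap_congr fun k _ => ?_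
  rw [encodeVertexSet_singleton, encodeVertexSet_singleton]
  rfl

variable {x}

/-- The two assumptions are all that is used of an objective; both the disjunctive coBüchi objective
and the Rabin objective satisfy them. -/
theorem start_mem_of_hasOrthogonalPair {ψ : Set (ℕ → Fin (x.toInput true).n)}
    (h1 : ∀ ω ∈ ψ, ∃ k, x.target true true k ∉ infSet ω)
    (h2 : ∀ ω k, x.start true ∈ infSet ω → x.target true true k ∉ infSet ω → ω ∈ ψ) :
    x.start true ∈ (x.toInput true).toMDP.almostSure ψ ↔ x.HasOrthogonalPair := by
  refine ⟨fun h => ?_, fun ⟨j, hj, k, hk, h⟩ => mem_coBuchi hj hk h fun ω => h2 ω _⟩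
  by_contra hn
  exact notMem_coBuchi hn h1 h

theorem start_mem_buchiQueryWin : x.start false ∈ x.buchiInput.buchiQueryWin ↔
    x.HasOrthogonalPair := by
  refine (Set.ext_iff.1 (Set.biUnion_map_finRange x.n₂ _ fun T : Finset (Fin (x.toInput false).n) =>
    (x.toInput false).toMDP.almostSure (buchi T)) _).trans ?_
  simp only [Set.mem_iUnion, Finset.coe_insert, Finset.coe_singleton]
  refine ⟨fun ⟨k, hk⟩ => ?_, fun ⟨j, hj, k, hk, h⟩ => ⟨⟨k, hk⟩, mem_buchi hj hk h⟩⟩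
  by_contra hn
  exact notMem_buchi hn k hk

theorem mem_coBuchi_singleton {V : Type} {v : V} {ω : ℕ → V} :
    ω ∈ coBuchi {v} ↔ v ∉ infSet ω := by
  simp [coBuchi]

theorem start_mem_coBuchiObjectiveWin : x.start true ∈ x.coBuchiInput.coBuchiObjectiveWin ↔
    x.HasOrthogonalPair := by
  have h := mem_iUnion_coBuchi_map_finRange (x.target true true)
  exact start_mem_of_hasOrthogonalPair (fun ω => (h ω).1) fun ω k _ hk => (h ω).2 ⟨k, hk⟩

/-- The strategy from an orthogonal pair avoids one fixed target, so at the start vertex the query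
has the same answer as the objective. -/
theorem start_mem_coBuchiQueryWin : x.start true ∈ x.coBuchiInput.coBuchiQueryWin ↔
    x.HasOrthogonalPair := by
  refine (Set.ext_iff.1 (Set.biUnion_map_finRange x.n₂ _ fun T : Finset (Fin (x.toInput true).n) =>
    (x.toInput true).toMDP.almostSure (coBuchi T)) _).trans ?_
  simp only [Set.mem_iUnion, Finset.coe_singleton]
  refine ⟨fun ⟨k, hk⟩ => ?_, fun ⟨j, hj, k, hk, h⟩ => ⟨⟨k, hk⟩, mem_coBuchi hj hk h fun ω _ h =>
    mem_coBuchi_singleton.2 h⟩⟩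
  by_contra hn
  exact notMem_coBuchi hn (fun ω hω => ⟨k, mem_coBuchi_singleton.1 hω⟩) hk

theorem start_mem_rabinWin : x.start true ∈ x.rabinInput.rabinWin ↔ x.HasOrthogonalPair := by
  have h := mem_rabin_map_finRange fun k : Fin x.n₂ =>
    (({x.start true}, {x.target true true k}) : Finset (Fin (x.toInput true).n) × Finset _)
  simp only [Finset.coe_singleton, Set.singleton_inter_nonempty, Set.singleton_inter_eq_empty] at h
  refine start_mem_of_hasOrthogonalPair (fun ω hω => ?_) fun ω k h0 hk => (h ω).2 ⟨k, h0, hk⟩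
  obtain ⟨k, -, hk⟩ := (h ω).1 hω
  exact ⟨k, hk⟩

theorem length_edges_toInput {c : Bool} : (x.toInput c).m = (x.edges c).length := by
  simp [MDPInput.m, toInput]

theorem buchiQuery_reducesTo : ReducesTo buchiQuery false [2, 0] := fun x =>
  ⟨x.buchiInput, x.encode_buchiInput, rfl, length_edges_toInput, (List.length_map _).trans List.length_finRange,
    charVector_eq_cons _ _ _ x.start_mem_buchiQueryWin⟩

theorem coBuchiObjective_reducesTo : ReducesTo coBuchiObjective true [1] := fun x =>
  ⟨x.coBuchiInput, x.encode_coBuchiInput, rfl, length_edges_toInput,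
    (List.length_map _).trans List.length_finRange,
    charVector_eq_cons _ _ _ x.start_mem_coBuchiObjectiveWin⟩

theorem coBuchiQuery_reducesTo : ReducesTo coBuchiQuery true [1] := fun x =>
  ⟨x.coBuchiInput, x.encode_coBuchiInput, rfl, length_edges_toInput,
    (List.length_map _).trans List.length_finRange,
    charVector_eq_cons _ _ _ x.start_mem_coBuchiQueryWin⟩

theorem card_targets_coBuchiInput : ∀ T ∈ x.coBuchiInput.targets, T.card = 1 := by
  intro T hT
  obtain ⟨k, -, rfl⟩ := List.mem_map.1 hT
  exact Finset.card_singleton _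

theorem singletonCoBuchiObjective_reducesTo : ReducesTo singletonCoBuchiObjective true [1] :=
  fun x => ⟨⟨x.coBuchiInput, x.card_targets_coBuchiInput⟩, x.encode_coBuchiInput, rfl,
    length_edges_toInput, (List.length_map _).trans List.length_finRange,
    charVector_eq_cons _ _ _ x.start_mem_coBuchiObjectiveWin⟩

theorem singletonCoBuchiQuery_reducesTo : ReducesTo singletonCoBuchiQuery true [1] :=
  fun x => ⟨⟨x.coBuchiInput, x.card_targets_coBuchiInput⟩, x.encode_coBuchiInput, rfl,
    length_edges_toInput, (List.length_map _).trans List.length_finRange,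
    charVector_eq_cons _ _ _ x.start_mem_coBuchiQueryWin⟩

theorem rabinObjective_reducesTo : ReducesTo rabinObjective true [1, 0, 1] := fun x =>
  ⟨x.rabinInput, x.encode_rabinInput, rfl, length_edges_toInput,
    (List.length_map _).trans List.length_finRange, charVector_eq_cons _ _ _ x.start_mem_rabinWin⟩

end OVTable

/-! ### Generating the instances -/

namespace RamExpr

instance : Add RamExpr := ⟨op .add⟩

instance : Mul RamExpr := ⟨op .mul⟩

def lt (a b : RamExpr) : RamExpr := op .lt a b

end RamExpr

/-- First generate the numbers in `l`. -/
def RamGen.prepend (l : List ℕ) (g : RamGen) : RamGen :=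
  l.foldr (fun a g => seq (emit (.const a)) g) g

theorem RamGen.out_prepend (M : ℕ → ℕ) (l : List ℕ) (g : RamGen) (env : List ℕ) :
    (g.prepend l).out M env = l ++ g.out M env := by
  induction l with
  | nil => rfl
  | cons a l ih => exact congrArg (a :: ·) ih

theorem RamGen.cost_prepend (M : ℕ → ℕ) (l : List ℕ) (g : RamGen) (env : List ℕ) :
    (g.prepend l).cost M env = 4 * l.length + g.cost M env := by
  induction l with
  | nil => simp [prepend]
  | cons a l ih =>
    change 1 + 3 + (g.prepend l).cost M env = _
    rw [ih, List.length_cons]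
    ring

theorem RamGen.ok_prepend (M : ℕ → ℕ) (B : ℕ) (l : List ℕ) (g : RamGen) (env : List ℕ) :
    (g.prepend l).Ok M B env ↔ g.Ok M B env := by
  induction l with
  | nil => rfl
  | cons a l ih =>
    change True ∧ (g.prepend l).Ok M B env ↔ _
    rw [ih, true_and]

/-- Row `j` of a matrix of width `d` that is stored row by row. -/
theorem List.getD_flatMap_range {α : Type*} (f : ℕ → ℕ → α) (a : α) {n d j i : ℕ} (hj : j < n)
    (hi : i < d) :
    ((List.range n).flatMap fun j => (List.range d).map (f j)).getD (j * d + i) a = f j i := by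
  have hlen : ∀ n, ((List.range n).flatMap fun j => (List.range d).map (f j)).length = n * d := by
    intro n
    simp [List.length_flatMap]
  induction n with
  | zero => omega
  | succ n ih =>
    rw [List.range_succ, List.flatMap_append]
    rcases Nat.lt_succ_iff_lt_or_eq.1 hj with hj | rfl
    · rw [List.getD_append, ih hj]
      rw [hlen]
      nlinarith
    · rw [List.getD_append_right _ _ _ _ (by rw [hlen]; omega), hlen, Nat.add_sub_cancel_left]
      simp [hi]

namespace OVTable

variable (x : OVTable)

/-- The encoding of the table. -/
def tableWords : List ℕ :=
  [x.d, x.n₁, x.n₂] ++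
    ((List.range x.n₁).flatMap fun j => (List.range x.d).map fun i => (x.A j i).toNat) ++
    (List.range x.n₂).flatMap fun k => (List.range x.d).map fun i => (x.B k i).toNat

def tableMem (a : ℕ) : ℕ := x.tableWords.getD a 0

variable {x}

theorem length_tableWords : x.tableWords.length = 3 + (x.n₁ + x.n₂) * x.d := by
  simp [tableWords, List.length_flatMap]
  ring

theorem tableMem_zero : x.tableMem 0 = x.d := rfl

theorem tableMem_one : x.tableMem 1 = x.n₁ := rfl

theorem tableMem_two : x.tableMem 2 = x.n₂ := rfl

theorem tableMem_first {j i : ℕ} (hj : j < x.n₁) (hi : i < x.d) :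
    x.tableMem (3 + j * x.d + i) = (x.A j i).toNat := by
  rw [tableMem, tableWords, List.append_assoc, List.getD_append_right _ _ _ _ (by simp; omega),
    show 3 + j * x.d + i - [x.d, x.n₁, x.n₂].length = j * x.d + i by simp; omega,
    List.getD_append]
  · exact List.getD_flatMap_range (fun j i => (x.A j i).toNat) 0 hj hi
  · simp [List.length_flatMap]
    nlinarith

theorem tableMem_second {k i : ℕ} (hk : k < x.n₂) (hi : i < x.d) :
    x.tableMem (3 + (x.n₁ + k) * x.d + i) = (x.B k i).toNat := by
  rw [tableMem, tableWords, List.getD_append_right]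
  · rw [← List.getD_flatMap_range (fun k i => (x.B k i).toNat) 0 hk hi]
    congr 1
    simp [List.length_flatMap]
    rw [Nat.add_mul]
    omega
  · simp [List.length_flatMap]
    nlinarith

/-- The bound is larger than the entries require: the same number has to bound the iteration counts
of the generator, among them the number of vertices. -/
theorem tableMem_le (a : ℕ) : x.tableMem a ≤ 2 * (x.n₁ + x.n₂ + x.d) + 2 := by
  have hmem : ∀ v ∈ x.tableWords, v ≤ 2 * (x.n₁ + x.n₂ + x.d) + 2 := by
    intro v hv
    simp only [tableWords, List.mem_append, List.mem_cons, List.not_mem_nil, or_false,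
      List.mem_flatMap, List.mem_map] at hv
    rcases hv with (h | ⟨j, -, i, -, rfl⟩) | ⟨k, -, i, -, rfl⟩
    · omega
    · have := (x.A j i).toNat_le
      omega
    · have := (x.B k i).toNat_le
      omega
  rcases lt_or_ge a x.tableWords.length with h | h
  · rw [tableMem, List.getD_eq_getElem _ _ h]
    exact hmem _ (List.getElem_mem h)
  · rw [tableMem, List.getD_eq_default _ _ h]
    omega

/-! #### The generator -/

open RamExpr RamGen

def dExpr : RamExpr := load (const 0)

def n₁Expr : RamExpr := load (const 1)

def n₂Expr : RamExpr := load (const 2)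

def coordExpr : RamExpr := const 1 + n₁Expr

def secondExpr : RamExpr := coordExpr + const 2 * dExpr

def verticesExpr : RamExpr := secondExpr + const 2 * n₂Expr

/-- The encoding announces the number of edges before listing them, so the number is computed in
closed form. -/
def edgesLengthExpr : RamExpr :=
  n₁Expr + n₁Expr * (const 1 + dExpr) + dExpr * (const 1 + n₂Expr) + const 2 * n₂Expr

def randomGen (c : Bool) : RamGen :=
  rep verticesExpr <| emit <|
    (const 0).lt (var 0) * (var 0).lt (if c then secondExpr else coordExpr)

def startEdgesGen : RamGen := rep n₁Expr <| seq (emit (const 0)) (emit (const 1 + var 0))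

/-- In the inner repetition `var 0` is the coordinate and `var 1` the vector. In `coordEdgesGen` the
nesting is reversed: `var 1` is the coordinate and `var 0` the vector. -/
def firstEdgesGen : RamGen :=
  rep n₁Expr <| seq (emit (const 1 + var 0)) <| seq (emit (const 0)) <|
    rep dExpr <| seq (emit (const 1 + var 1)) <|
      emit (coordExpr + const 2 * var 0 + load (const 3 + var 1 * dExpr + var 0))

def coordEdgesGen : RamGen :=
  rep dExpr <| seq (emit (coordExpr + const 2 * var 0)) <| seq (emit (const 0)) <|
    rep n₂Expr <| seq (emit (coordExpr + const 2 * var 1 + const 1)) <|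
      emit (secondExpr + const 2 * var 0 + load (const 3 + (n₁Expr + var 0) * dExpr + var 1))

def secondEdgesGen (c : Bool) : RamGen :=
  rep (const 2 * n₂Expr) <| seq (emit (secondExpr + var 0)) <|
    emit (if c then const 0 else secondExpr + var 0)

def targetsGen (c : Bool) (pre : List ℕ) : RamGen :=
  rep n₂Expr <| prepend pre <| emit (secondExpr + const 2 * var 0 + const c.toNat)

/-- Generate the instance from the table. -/
def wordsGen (c : Bool) (pre : List ℕ) : RamGen :=
  seq (emit verticesExpr) <| seq (emit edgesLengthExpr) <| seq (randomGen c) <|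
  seq startEdgesGen <| seq firstEdgesGen <| seq coordEdgesGen <| seq (secondEdgesGen c) <|
  seq (emit n₂Expr) (targetsGen c pre)

theorem eval_dExpr (env : List ℕ) : dExpr.eval x.tableMem env = x.d := rfl

theorem eval_n₁Expr (env : List ℕ) : n₁Expr.eval x.tableMem env = x.n₁ := rfl

theorem eval_n₂Expr (env : List ℕ) : n₂Expr.eval x.tableMem env = x.n₂ := rfl

theorem eval_verticesExpr (env : List ℕ) : verticesExpr.eval x.tableMem env = x.vertices := rfl

theorem length_edges {c : Bool} : (x.edges c).length =
    x.n₁ + x.n₁ * (1 + x.d) + x.d * (1 + x.n₂) + 2 * x.n₂ := by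
  simp [edges, List.length_flatMap]
  ring

theorem out_randomGen (c : Bool) : (randomGen c).out x.tableMem [] =
    (List.range x.vertices).map fun v => (decide (0 < v ∧ v < x.randomBound c)).toNat := by
  rw [randomGen, out, eval_verticesExpr, List.map_eq_flatMap]
  refine List.flatMap_congr fun v _ => ?_
  have : (if c then secondExpr else coordExpr).eval x.tableMem [v] = x.randomBound c := by
    cases c <;> rfl
  simp only [out, RamExpr.lt, this, eval, BinOp.eval, List.getD_cons_zero]
  by_cases h1 : 0 < v <;> by_cases h2 : v < x.randomBound c <;> simp [h1, h2]

theorem out_edgesGen (c : Bool) :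
    (startEdgesGen.out x.tableMem [] ++ (firstEdgesGen.out x.tableMem [] ++
      (coordEdgesGen.out x.tableMem [] ++ (secondEdgesGen c).out x.tableMem []))) =
    (x.edges c).flatMap fun e => [e.1, e.2] := by
  simp only [edges, List.flatMap_append, List.flatMap_map, List.flatMap_assoc, List.flatMap_cons,
    List.append_assoc]
  congr 1
  congr 1
  · refine List.flatMap_congr fun j hj => congrArg ([1 + j, 0] ++ ·) <|
      List.flatMap_congr fun i hi => ?_
    rw [← tableMem_first (List.mem_range.1 hj) (List.mem_range.1 hi)]
    rfl
  congr 1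
  · refine List.flatMap_congr fun i hi => congrArg ([x.coord + 2 * i, 0] ++ ·) <|
      List.flatMap_congr fun k hk => ?_
    rw [← tableMem_second (List.mem_range.1 hk) (List.mem_range.1 hi)]
    rfl
  · cases c <;> rfl

theorem out_wordsGen (c : Bool) (pre : List ℕ) :
    (wordsGen c pre).out x.tableMem [] = x.words c pre := by
  have h : (targetsGen c pre).out x.tableMem [] =
      (List.range x.n₂).flatMap fun k => pre ++ [x.second + 2 * k + c.toNat] :=
    List.flatMap_congr fun k _ => out_prepend _ _ _ _
  have h' : edgesLengthExpr.eval x.tableMem [] = (x.edges c).length := length_edges.symm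
  rw [words, ← out_randomGen, ← out_edgesGen, ← h, ← h']
  simp only [wordsGen, out, List.append_assoc, List.cons_append, List.nil_append]
  rfl

theorem ok_wordsGen (c : Bool) (pre : List ℕ) :
    (wordsGen c pre).Ok x.tableMem (2 * (x.n₁ + x.n₂ + x.d) + 2) [] := by
  have h : ∀ e : RamExpr, e = dExpr ∨ e = n₁Expr ∨ e = n₂Expr ∨ e = coordExpr ∨ e = secondExpr ∨
      e = verticesExpr → ∀ B env, e.Ok x.tableMem B env := by
    rintro e (rfl | rfl | rfl | rfl | rfl | rfl) B env <;>
      simp [dExpr, n₁Expr, n₂Expr, coordExpr, secondExpr, verticesExpr, RamExpr.Ok, BinOp.Tame]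
  have hc : ∀ B env, (if c then secondExpr else coordExpr).Ok x.tableMem B env := by
    cases c <;> exact h _ (by simp)
  have hc' : ∀ B env, (if c then const 0 else secondExpr + var 0).Ok x.tableMem B env := by
    cases c <;> simp [h, RamExpr.Ok, BinOp.Tame]
  simp only [wordsGen, randomGen, startEdgesGen, firstEdgesGen, coordEdgesGen, secondEdgesGen,
    targetsGen, edgesLengthExpr, RamGen.Ok, ok_prepend, RamExpr.lt, BinOp.Tame, BinOp.eval, RamExpr.Ok, hc, hc',
    h, true_or, or_true, true_and, and_true, implies_true, eval_dExpr, eval_n₁Expr, eval_n₂Expr,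
    eval_verticesExpr, RamExpr.eval, vertices, second, coord]
  exact ⟨by omega, by omega, ⟨by omega, fun _ _ => by omega⟩, ⟨by omega, fun _ _ => by omega⟩,
    by omega, by omega⟩

/-- The time for the generation is linear in the size of the table. -/
theorem cost_wordsGen_le (c : Bool) (pre : List ℕ) : (wordsGen c pre).cost x.tableMem [] ≤
    (1000 + 4 * pre.length) * ((x.n₁ + x.n₂ + 1) * (x.d + 1)) := by
  have h2 := x.n₂_pos
  cases c <;>
  simp only [wordsGen, randomGen, startEdgesGen, firstEdgesGen, coordEdgesGen, secondEdgesGen,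
    targetsGen, edgesLengthExpr, RamGen.cost, cost_prepend, RamExpr.lt, BinOp.eval,
    RamExpr.cost, dExpr, n₁Expr, n₂Expr, coordExpr, secondExpr, verticesExpr, if_true, if_false,
    Bool.false_eq_true, RamExpr.eval, tableMem_zero, tableMem_one, tableMem_two,
    Finset.sum_const, Finset.card_range, smul_eq_mul]
  -- After expansion the bound is a linear inequality between monomials, each of which is an atom
  -- for `omega`.
  · ring_nf
    omega
  · ring_nf
    omega

end OVTable

/-! ### Composing the generator with a fast algorithm -/

theorem RamState.init_eq {l : List ℕ} {M : ℕ → ℕ} (h : ∀ a, M a = l.getD a 0) :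
    (RamState.init l).mem = M :=
  funext fun a => (h a).symm

namespace OVTable

open RamExpr RamGen

def lengthExpr : RamExpr := const 3 + (n₁Expr + n₂Expr) * dExpr

theorem eval_lengthExpr {x : OVTable} : lengthExpr.eval x.tableMem [] = x.tableWords.length :=
  length_tableWords.symm

theorem ok_lengthExpr {x : OVTable} (B : ℕ) : lengthExpr.Ok x.tableMem B [] := by
  simp [lengthExpr, dExpr, n₁Expr, n₂Expr, RamExpr.Ok, BinOp.Tame]

/-- An algorithm for a problem to which the orthogonal vectors problem reduces decides whether
there is an orthogonal pair, with overhead linear in the size of the table. -/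
theorem ReducesTo.exists_program {Q : MDPProblem} {c : Bool} {pre : List ℕ}
    (hQ : ReducesTo Q c pre) {T : Q.Input → ℝ} (hT0 : ∀ y, 0 ≤ T y) (hT : Q.SolvableIn T) :
    ∃ (p : RamProgram) (a K : ℕ), ∀ (x : OVTable) (w : ℕ), a * (x.n₁ + x.n₂ + x.d).size ≤ w →
      ∃ (y : Q.Input) (s : RamState) (t : ℕ), Q.encode y = x.words c pre ∧
        (Q.encode y).length ≤ K * ((x.n₁ + x.n₂ + 1) * (x.d + 1)) ∧
        Q.m y = (x.edges c).length ∧ Q.k y = x.n₂ ∧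
        RamRun w p (RamState.init x.tableWords) s t ∧
        (∀ i (hi : i < (yesNo x.HasOrthogonalPair).length),
          s.mem i = (yesNo x.HasOrthogonalPair)[i]) ∧
        (t : ℝ) ≤ K * (((x.n₁ + x.n₂ + 1) * (x.d + 1) : ℕ) + T y) := by
  obtain ⟨q, b, C, hq⟩ := hT
  obtain ⟨g, hg⟩ : ∃ g, g = wordsGen c pre := ⟨_, rfl⟩
  obtain ⟨o, ho⟩ : ∃ o, o = lengthExpr := ⟨_, rfl⟩
  obtain ⟨K, hK⟩ : ∃ K, K = 1000 + 4 * pre.length := ⟨_, rfl⟩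
  obtain ⟨R, hR⟩ : ∃ R, R = (g.transform o 0).regBound := ⟨_, rfl⟩
  -- With `z` the bit length of `n₁ + n₂ + d`, values are bounded by powers of `2 ^ (2 * z)`, whence
  -- `2 * o.size` and `2 * g.size`. The summand `(b + 1) * (K + 12)` covers the addresses and the
  -- word length that `q` itself demands.
  refine ⟨.seq (g.transform o R) q,
    2 * o.size + 2 * g.size + (b + 1) * (K + 12) + 1, 100 + 8 * K + R + ⌈|C|⌉₊,
    fun x w hw => ?_⟩
  obtain ⟨y, hy, hsize, hm, hk, l, hl⟩ := hQ x
  obtain ⟨s, t, hrun, hans, ht⟩ := hq y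
  obtain ⟨S, hS⟩ : ∃ S, S = x.n₁ + x.n₂ + x.d := ⟨_, rfl⟩
  obtain ⟨X, hX⟩ : ∃ X, X = (x.n₁ + x.n₂ + 1) * (x.d + 1) := ⟨_, rfl⟩
  obtain ⟨z, hz⟩ : ∃ z, z = S.size := ⟨_, rfl⟩
  rw [← hX]
  rw [← hS, ← hz] at hw
  have h1 := x.n₁_pos
  have h2 := x.n₂_pos
  have hX1 : 1 ≤ X := hX ▸ Nat.mul_pos (by omega) (by omega)
  have hSz : S < 2 ^ z := hz ▸ Nat.lt_size_self S
  have hz1 : 1 ≤ z := by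
    by_contra hlt
    rw [show z = 0 by omega] at hSz
    omega
  have hB : 2 * S + 2 ≤ 2 ^ (2 * z) := by
    calc 2 * S + 2 ≤ 2 ^ (z + 1) := by rw [pow_succ]; omega
      _ ≤ 2 ^ (2 * z) := Nat.pow_le_pow_right (by omega) (by omega)
  have hBpow : ∀ k, 2 * k < 2 * o.size + 2 * g.size + (b + 1) * (K + 12) + 1 →
      (2 * S + 2) ^ k < 2 ^ w := by
    intro k hk
    calc (2 * S + 2) ^ k ≤ (2 ^ (2 * z)) ^ k := Nat.pow_le_pow_left hB k
      _ = 2 ^ (2 * k * z) := by rw [← pow_mul]; ring_nf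
      _ < 2 ^ w := Nat.pow_lt_pow_right (by omega)
        (lt_of_lt_of_le (Nat.mul_lt_mul_of_pos_right hk hz1) hw)
  have hcost : g.cost x.tableMem [] ≤ K * X := by
    rw [hg, hK, hX]
    exact cost_wordsGen_le c pre
  have hout : g.out x.tableMem [] = x.words c pre := by
    rw [hg]
    exact out_wordsGen c pre
  have hL : (x.words c pre).length ≤ K * X := by
    rw [← hout]
    exact (g.length_out_le_cost _ _).trans hcost
  have hoff : x.tableWords.length ≤ 3 * X := by
    rw [length_tableWords, hX]
    nlinarith
  have hX2 : X ≤ 2 ^ (4 * z) := by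
    calc X ≤ (2 * S + 2) * (2 * S + 2) := hX ▸ Nat.mul_le_mul (by omega) (by omega)
      _ ≤ 2 ^ (2 * z) * 2 ^ (2 * z) := Nat.mul_le_mul hB hB
      _ = 2 ^ (4 * z) := by rw [← pow_add]; ring_nf
  have hbig : 2 * x.tableWords.length + (x.words c pre).length < 2 ^ ((K + 12) * z) := by
    calc 2 * x.tableWords.length + (x.words c pre).length ≤ (K + 6) * X := by
          rw [Nat.add_mul]; omega
      _ ≤ (K + 6) * 2 ^ (4 * z) := Nat.mul_le_mul_left _ hX2
      _ < 2 ^ (K + 6) * 2 ^ (4 * z) := Nat.mul_lt_mul_of_pos_right Nat.lt_two_pow_self (by positivity)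
      _ = 2 ^ (K + 6 + 4 * z) := by rw [← pow_add]
      _ ≤ 2 ^ ((K + 12) * z) := Nat.pow_le_pow_right (by omega) (by
        have := Nat.le_mul_of_pos_right (K + 12) hz1
        have := Nat.mul_le_mul_left K hz1
        rw [Nat.add_mul]
        omega)
  -- The generated instance has length below `2 ^ ((K + 12) * z)`, so the word length assumed by `q`
  -- is at most the available one.
  have hlog : b * Q.logSize y ≤ w := by
    have : Q.logSize y ≤ (K + 12) * z := by
      rw [hsize, hy, Nat.size_le]
      omega
    calc b * Q.logSize y ≤ b * ((K + 12) * z) := Nat.mul_le_mul_left _ this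
      _ = b * (K + 12) * z := by ring
      _ ≤ (2 * o.size + 2 * g.size + (b + 1) * (K + 12) + 1) * z :=
        Nat.mul_le_mul_right _ (by rw [Nat.add_mul b 1]; omega)
      _ ≤ w := hw
  have heval : o.eval x.tableMem [] = x.tableWords.length := ho ▸ eval_lengthExpr
  have htrans := RamGen.runs_transform (g := g) (off := o) (M := x.tableMem) (w := w)
    (R := R) (fun _ => rfl) (show 2 ≤ 2 * S + 2 by omega) (fun a => hS ▸ tableMem_le a)
    (hBpow _ (by omega)) (hBpow _ (by omega)) (ho ▸ ok_lengthExpr _) (by rw [hg, hS]; exact ok_wordsGen c pre)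
    (by rw [heval]) (by
      rw [heval, hout]
      refine hbig.trans_le (Nat.pow_le_pow_right (by omega) (le_trans ?_ hw))
      exact Nat.mul_le_mul_right _ (by rw [Nat.add_mul b 1]; omega)) hR.ge (RamState.init x.tableWords)
    (RamState.init_eq fun _ => rfl) (fun _ _ => rfl)
  rw [hout, ← hy, heval] at htrans
  obtain ⟨t₁, hrun₁, ht₁⟩ := htrans
  refine ⟨y, s, t₁ + t, hy, ?_, hm, hk, .seq _ _ _ _ _ _ _ hrun₁ (hrun.mono_word hlog), ?_, ?_⟩
  · rw [hy]
    exact hL.trans (Nat.mul_le_mul_right _ (by omega))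
  · intro i hi
    rw [hans i (by rw [hl, List.length_append]; omega)]
    simp only [hl]
    exact List.getElem_append_left hi
  · have hc : o.cost x.tableMem [] = 16 := ho ▸ rfl
    have h3 : t₁ ≤ (100 + 8 * K + R) * X := by nlinarith
    have h4 : (t₁ : ℝ) ≤ (100 + 8 * K + R : ℕ) * (X : ℝ) := by exact_mod_cast h3
    have h5 : (t : ℝ) ≤ ⌈|C|⌉₊ * T y := ht.trans <|
      mul_le_mul_of_nonneg_right ((le_abs_self C).trans (Nat.le_ceil _)) (hT0 y)
    have h6 := hT0 y
    push_cast at h4 ⊢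
    have h7 : (0 : ℝ) ≤ X := Nat.cast_nonneg _
    have h8 : (0 : ℝ) ≤ ⌈|C|⌉₊ := Nat.cast_nonneg _
    have h9 : (0 : ℝ) ≤ 100 + 8 * K + R := by positivity
    nlinarith [mul_nonneg h8 h7, mul_nonneg h9 h6]

end OVTable

/-- The program `p` decides on a machine with words of at least `a * log (n₁ + n₂ + d)` bits whether
there is an orthogonal pair, in time `C * N ^ (2 - ε) * (d + 1) ^ 2`. -/
def OVTable.DecidedBy (ε : ℝ) (p : RamProgram) (a : ℕ) (C : ℝ) : Prop :=
  ∀ (x : OVTable) (w N : ℕ), a * (x.n₁ + x.n₂ + x.d).size ≤ w → x.n₁ ≤ N → x.n₂ ≤ N →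
    ∃ (s : RamState) (t : ℕ), RamRun w p (RamState.init x.tableWords) s t ∧
      (∀ i (hi : i < (yesNo x.HasOrthogonalPair).length),
        s.mem i = (yesNo x.HasOrthogonalPair)[i]) ∧
      (t : ℝ) ≤ C * ((N : ℝ) ^ (2 - ε) * ((x.d : ℝ) + 1) ^ 2)

namespace OVTable

/-- With `D = d + 1`, the input length and `m` are at most `A * N * D`, and `k` is at most `N`; so
both admissible bounds are at most a constant times `N ^ (2 - ε) * D ^ 2`. The condition `ε ≤ 1 / 2`
makes the exponent `1 - ε` nonnegative and lets the linear terms be absorbed. -/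
theorem ReducesTo.decidedBy {Q : MDPProblem} {c : Bool} {pre : List ℕ}
    (hQ : ReducesTo Q c pre) {T : Q.Input → ℝ} (hT0 : ∀ y, 0 ≤ T y) (hT : Q.SolvableIn T) {ε : ℝ}
    (hε : ε ≤ 1 / 2)
    (hTle : ∀ y, 1 ≤ Q.m y → 1 ≤ Q.k y → T y ≤ (Q.encode y).length + (Q.m y : ℝ) ^ (2 - ε) ∨
      T y ≤ (Q.encode y).length + ((Q.k y : ℝ) * Q.m y) ^ (1 - ε)) (hε0 : 0 < ε) :
    ∃ p a C, 0 ≤ C ∧ DecidedBy ε p a C := by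
  obtain ⟨p, a, K, hp⟩ := hQ.exists_program hT0 hT
  obtain ⟨A, hA⟩ : ∃ A : ℝ, A = 3 * K + 3 := ⟨_, rfl⟩
  have hK0 : (0 : ℝ) ≤ K := Nat.cast_nonneg _
  have hA1 : 1 ≤ A := by linarith
  refine ⟨p, a, K * (A + (A + A ^ 2)), by positivity, fun x w N hw h1 h2 => ?_⟩
  obtain ⟨y, s, t, hy, hlen, hm, hk, hrun, hans, ht⟩ := hp x w hw
  refine ⟨s, t, hrun, hans, ht.trans ?_⟩
  have hn₁ := x.n₁_pos
  have hn₂ := x.n₂_pos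
  have hN1 : (1 : ℝ) ≤ N := by exact_mod_cast hn₁.trans_le h1
  have hN0 : (0 : ℝ) ≤ N := by linarith
  obtain ⟨D, hD⟩ : ∃ D : ℝ, D = (x.d : ℝ) + 1 := ⟨_, rfl⟩
  have hD1 : 1 ≤ D := by
    rw [hD]
    linarith [(Nat.cast_nonneg x.d : (0 : ℝ) ≤ x.d)]
  obtain ⟨Z, hZ⟩ : ∃ Z : ℝ, Z = (N : ℝ) ^ (2 - ε) * D ^ 2 := ⟨_, rfl⟩
  rw [← hD, ← hZ]
  have hND : N * D ≤ Z := by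
    rw [hZ]
    refine mul_le_mul ?_ (by nlinarith) (by linarith) (by positivity)
    nth_rw 1 [← Real.rpow_one (N : ℝ)]
    exact Real.rpow_le_rpow_of_exponent_le hN1 (by linarith)
  have hZ0 : 0 ≤ Z := le_trans (by positivity) hND
  have hX : (((x.n₁ + x.n₂ + 1) * (x.d + 1) : ℕ) : ℝ) ≤ 3 * (N * D) := by
    have : (x.n₁ + x.n₂ + 1) * (x.d + 1) ≤ 3 * N * (x.d + 1) :=
      Nat.mul_le_mul_right _ (by omega)
    have h' : (((x.n₁ + x.n₂ + 1) * (x.d + 1) : ℕ) : ℝ) ≤ ((3 * N * (x.d + 1) : ℕ) : ℝ) :=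
      Nat.cast_le.2 this
    refine h'.trans (le_of_eq ?_)
    push_cast
    rw [hD]
    ring
  have hlen' : ((Q.encode y).length : ℝ) ≤ A * (N * D) := by
    have h : ((Q.encode y).length : ℝ) ≤ (K * ((x.n₁ + x.n₂ + 1) * (x.d + 1)) : ℕ) :=
      Nat.cast_le.2 hlen
    rw [Nat.cast_mul] at h
    have : 0 ≤ N * D := by positivity
    nlinarith
  -- Every edge is listed in the encoding, so the bound on its length applies to `m`.
  have hmlen : ((Q.m y : ℕ) : ℝ) ≤ A * (N * D) := by
    refine le_trans (Nat.cast_le.2 ?_) hlen'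
    rw [hm, hy, words]
    simp only [List.length_append, List.length_flatMap, List.length_cons, List.length_nil,
      List.map_const', List.sum_replicate, smul_eq_mul]
    omega
  have hm1 : 1 ≤ Q.m y := by
    rw [hm, length_edges]
    omega
  have hmain : T y ≤ (A + A ^ 2) * Z := by
    have hl : ((Q.encode y).length : ℝ) ≤ A * Z := hlen'.trans (by gcongr)
    rcases hTle y hm1 (hk ▸ hn₂) with h | h
    · have : (Q.m y : ℝ) ^ (2 - ε) ≤ A ^ 2 * Z := by
        calc (Q.m y : ℝ) ^ (2 - ε) ≤ (A * (N * D)) ^ (2 - ε) :=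
              Real.rpow_le_rpow (Nat.cast_nonneg _) hmlen (by linarith)
          _ = A ^ (2 - ε) * ((N : ℝ) ^ (2 - ε) * D ^ (2 - ε)) := by
              rw [Real.mul_rpow (by positivity) (by positivity),
                Real.mul_rpow (by positivity) (by positivity)]
          _ ≤ A ^ (2 : ℝ) * ((N : ℝ) ^ (2 - ε) * D ^ (2 : ℝ)) := by
              gcongr <;> linarith
          _ = A ^ 2 * Z := by rw [hZ, Real.rpow_two, Real.rpow_two]
      linarith
    · have : ((Q.k y : ℝ) * Q.m y) ^ (1 - ε) ≤ A ^ 2 * Z := by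
        have hkN : (Q.k y : ℝ) ≤ N := by rw [hk]; exact_mod_cast h2
        calc ((Q.k y : ℝ) * Q.m y) ^ (1 - ε) ≤ (N * (A * (N * D))) ^ (1 - ε) := by
              refine Real.rpow_le_rpow (by positivity) ?_ (by linarith)
              gcongr
          _ = A ^ (1 - ε) * (((N : ℝ) ^ (1 - ε) * (N : ℝ) ^ (1 - ε)) * D ^ (1 - ε)) := by
              rw [show (N : ℝ) * (A * (N * D)) = A * (N * N * D) by ring,
                Real.mul_rpow (by positivity) (by positivity),
                Real.mul_rpow (by positivity) (by positivity), Real.mul_rpow hN0 hN0]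
          _ = A ^ (1 - ε) * ((N : ℝ) ^ (2 - 2 * ε) * D ^ (1 - ε)) := by
              rw [← Real.rpow_add (by linarith)]
              ring_nf
          _ ≤ A ^ (2 : ℝ) * ((N : ℝ) ^ (2 - ε) * D ^ (2 : ℝ)) := by
              gcongr <;> linarith
          _ = A ^ 2 * Z := by rw [hZ, Real.rpow_two, Real.rpow_two]
      linarith
  have : (((x.n₁ + x.n₂ + 1) * (x.d + 1) : ℕ) : ℝ) ≤ A * Z := by
    nlinarith
  calc K * ((((x.n₁ + x.n₂ + 1) * (x.d + 1) : ℕ) : ℝ) + T y) ≤ K * (A * Z + (A + A ^ 2) * Z) := by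
        gcongr
    _ = K * (A + (A + A ^ 2)) * Z := by ring

/-- A large `ε` may be replaced by `1 / 2`: the bases `m` and `k * m` are at least `1` on the
generated instances, so a smaller `ε` only weakens the time bound. -/
theorem ReducesTo.noFastAlgorithm {Q : MDPProblem} {c : Bool} {pre : List ℕ}
    (hQ : ReducesTo Q c pre)
    (h : ∀ ε, 0 < ε → ε ≤ 1 / 2 → ∀ p a C, 0 ≤ C → ¬ DecidedBy ε p a C) : Q.NoFastAlgorithm := by
  intro ε hε
  have hε' : 0 < min ε (1 / 2) := lt_min hε (by norm_num)
  have hle : min ε (1 / 2) ≤ ε := min_le_left _ _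
  constructor
  · intro hsolv
    have hT : ∀ y, 1 ≤ Q.m y → (Q.m y : ℝ) ^ (2 - ε) ≤ (Q.m y : ℝ) ^ (2 - min ε (1 / 2)) :=
      fun y hm => Real.rpow_le_rpow_of_exponent_le (by exact_mod_cast hm) (by linarith)
    obtain ⟨p, a, C, hC, hdec⟩ := hQ.decidedBy (fun y => by positivity) hsolv (min_le_right ε _)
      (fun y hm _ => .inl (by linarith [hT y hm])) hε'
    exact h _ hε' (min_le_right _ _) p a C hC hdec
  · intro hsolv
    have hT : ∀ y, 1 ≤ Q.m y → 1 ≤ Q.k y →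
        ((Q.k y : ℝ) * Q.m y) ^ (1 - ε) ≤ ((Q.k y : ℝ) * Q.m y) ^ (1 - min ε (1 / 2)) :=
      fun y hm hk => Real.rpow_le_rpow_of_exponent_le
        (by exact_mod_cast Nat.mul_pos hk hm) (by linarith)
    obtain ⟨p, a, C, hC, hdec⟩ := hQ.decidedBy (fun y => by positivity) hsolv (min_le_right ε _)
      (fun y hm hk => .inr (by linarith [hT y hm hk])) hε'
    exact h _ hε' (min_le_right _ _) p a C hC hdec

end OVTable

/-! ### The Orthogonal Vectors Conjecture -/

namespace OVInput

variable (x : OVInput)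

/-- Component `i` of vector `j` in a list of vectors. -/
def component {d : ℕ} (S : List (Fin d → Bool)) (j i : ℕ) : Bool :=
  if h : j < S.length ∧ i < d then S[j] ⟨i, h.2⟩ else false

theorem component_eq {d : ℕ} (S : List (Fin d → Bool)) {j : ℕ} (hj : j < S.length) (i : Fin d) :
    component S j i = S[j] i := by
  rw [component, dif_pos ⟨hj, i.2⟩]

def toTable (h₁ : 0 < x.S₁.length) (h₂ : 0 < x.S₂.length) : OVTable where
  d := x.d
  n₁ := x.S₁.length
  n₂ := x.S₂.length
  A := component x.S₁
  B := component x.S₂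
  n₁_pos := h₁
  n₂_pos := h₂

theorem flatMap_component {d : ℕ} (S : List (Fin d → Bool)) :
    ((List.range S.length).flatMap fun j => (List.range d).map fun i => (component S j i).toNat) =
      S.flatMap fun u => List.ofFn fun i => (u i).toNat := by
  have h : S.flatMap (fun u => List.ofFn fun i => (u i).toNat) =
      ((List.finRange S.length).map S.get).flatMap fun u => List.ofFn fun i => (u i).toNat := by
    rw [← List.ofFn_eq_map, List.ofFn_get]
  rw [h, List.flatMap_map, ← List.flatMap_finRange]
  refine List.flatMap_congr fun j _ => ?_
  rw [List.ofFn_eq_map, ← List.map_coe_finRange_eq_range, List.map_map]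
  refine List.map_congr_left fun i _ => ?_
  rw [Function.comp_apply, component_eq S j.2]
  rfl

variable {x}

/-- An orthogonal vectors instance is already encoded as a table, so no conversion program is needed
here. -/
theorem tableWords_toTable (h₁ : 0 < x.S₁.length) (h₂ : 0 < x.S₂.length) :
    (x.toTable h₁ h₂).tableWords = x.encode := by
  rw [encode, List.flatMap_append, ← flatMap_component, ← flatMap_component, ← List.append_assoc]
  rfl

theorem hasOrthogonalPair_toTable (h₁ : 0 < x.S₁.length) (h₂ : 0 < x.S₂.length) :
    (x.toTable h₁ h₂).HasOrthogonalPair ↔ x.HasOrthogonalPair := by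
  have key : ∀ j (hj : j < x.S₁.length) k (hk : k < x.S₂.length),
      (∀ i < x.d, component x.S₁ j i = false ∨ component x.S₂ k i = false) ↔
      ∑ i, (x.S₁[j] i).toNat * (x.S₂[k] i).toNat = 0 := by
    intro j hj k hk
    rw [Finset.sum_eq_zero_iff]
    have : ∀ a b : Bool, a.toNat * b.toNat = 0 ↔ a = false ∨ b = false := by decide
    simp only [this, Finset.mem_univ, true_implies]
    constructor
    · intro h i
      have := h i i.2
      rwa [component_eq _ hj, component_eq _ hk] at this
    · intro h i hi
      have := h ⟨i, hi⟩
      rwa [← component_eq _ hj, ← component_eq _ hk] at this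
  constructor
  · rintro ⟨j, hj, k, hk, h⟩
    exact ⟨_, List.getElem_mem hj, _, List.getElem_mem hk, (key j hj k hk).1 h⟩
  · rintro ⟨u, hu, v, hv, h⟩
    obtain ⟨j, hj, rfl⟩ := List.getElem_of_mem hu
    obtain ⟨k, hk, rfl⟩ := List.getElem_of_mem hv
    exact ⟨j, hj, k, hk, (key j hj k hk).2 h⟩

theorem length_encode : x.encode.length = 3 + (x.S₁.length + x.S₂.length) * x.d := by
  simp [encode, List.length_flatMap]
  ring

/-- Vectors of dimension zero leave no trace in the encoding apart from their number. That the lists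
have no duplicates is what keeps this number, and with it the required word length, under control.
-/
theorem length_le_one {d : ℕ} (hd : d = 0) {S : List (Fin d → Bool)} (hS : S.Nodup) :
    S.length ≤ 1 := by
  subst hd
  simpa using hS.length_le_card

theorem length_le_length_encode {S : List (Fin x.d → Bool)} (hS : S.Nodup)
    (hle : S.length ≤ x.S₁.length + x.S₂.length) : S.length ≤ x.encode.length := by
  rw [length_encode]
  rcases Nat.eq_zero_or_pos x.d with hd | hd
  · have := length_le_one hd hS
    omega
  · nlinarith

end OVInput

/-- Run `p` if the two counts in the memory are positive, and write `0` otherwise. -/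
def RamProgram.guardCounts (p : RamProgram) : RamProgram :=
  .seq (.const 0 1) <| .seq (.load 0 0) <| .seq (.const 1 2) <| .seq (.load 1 1) <|
  .seq (.op .mul 0 0 1) <| .cond 0 (.seq (.clear 2) p) (.store 0 0)

/-- Tables must be nonempty, while instances may have an empty set, and then the answer is no. One
multiplication tests both counts; the two registers used are cleared so that `p` starts from the
initial state. -/
theorem RamProgram.runs_guardCounts {p : RamProgram} {l : List ℕ} {w n₁ n₂ : ℕ}
    (h1 : l.getD 1 0 = n₁) (h2 : l.getD 2 0 = n₂) (hw : 2 < 2 ^ w) (hn₁ : n₁ < 2 ^ w)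
    (hn₂ : n₂ < 2 ^ w) (hn : n₁ * n₂ < 2 ^ w) :
    (n₁ * n₂ = 0 → ∃ s, RamRuns w p.guardCounts (RamState.init l) s 7 ∧ s.mem 0 = 0) ∧
    (n₁ * n₂ ≠ 0 → ∀ s T, RamRuns w p (RamState.init l) s T →
      RamRuns w p.guardCounts (RamState.init l) s (T + 9)) := by
  have m1 : (RamState.init l).mem 1 = n₁ := h1
  have m2 : (RamState.init l).mem 2 = n₂ := h2
  have r1 := RamRuns.const (w := w) (RamState.init l) 0 (show 1 < 2 ^ w by omega)
  have r2 := RamRuns.load (w := w) ⟨Function.update (RamState.init l).reg 0 1, (RamState.init l).mem⟩ 0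
    (a := 0) (by simpa [m1] using hn₁)
  have r3 := RamRuns.const (w := w) ⟨Function.update (Function.update (RamState.init l).reg 0 1) 0 n₁,
    (RamState.init l).mem⟩ 1 hw
  have r4 := RamRuns.load (w := w) ⟨Function.update (Function.update (Function.update
    (RamState.init l).reg 0 1) 0 n₁) 1 2, (RamState.init l).mem⟩ 1 (a := 1) (by simpa [m2] using hn₂)
  have r5 := RamRuns.op (w := w) ⟨Function.update (Function.update (Function.update (Function.update
    (RamState.init l).reg 0 1) 0 n₁) 1 2) 1 n₂, (RamState.init l).mem⟩ (o := .mul) 0 (a := 0) (b := 1)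
    (by simpa [BinOp.eval] using hn)
  simp only [Function.update_self, m1, m2, BinOp.eval] at r2 r4 r5
  have hpre : ∀ {q s T}, RamRuns w q ⟨_, (RamState.init l).mem⟩ s T →
      RamRuns w (.seq (.const 0 1) <| .seq (.load 0 0) <| .seq (.const 1 2) <| .seq (.load 1 1) <|
        .seq (.op .mul 0 0 1) q) (RamState.init l) s (T + 5) := fun hq =>
    (r1.seq (r2.seq (r3.seq (r4.seq (r5.seq hq))))).mono (by omega)
  constructor
  · intro h0
    refine ⟨_, (hpre (RamRuns.cond_false ?_ (RamRuns.store _ ?_))).mono le_rfl, ?_⟩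
    · simpa using h0
    · simp [h0]
    · simp [h0]
  · intro h0 s T hs
    refine (hpre (RamRuns.cond_true ?_ ((RamProgram.runs_clear w 2 _ ?_).seq hs))).mono (by omega)
    · simpa using h0
    · intro r hr
      simp [Function.update_of_ne (show r ≠ 0 by omega), Function.update_of_ne (show r ≠ 1 by omega),
        RamState.init]

/-- Polylogarithmic factors are negligible. -/
theorem exists_sq_le_rpow (c : ℝ) {δ : ℝ} (hδ : 0 < δ) : ∃ C : ℝ, 0 ≤ C ∧ ∀ d N : ℕ, 0 < N →
    (d : ℝ) ≤ c * Real.logb 2 N → ((d : ℝ) + 1) ^ 2 ≤ C * (N : ℝ) ^ δ := by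
  have hl2 : 0 < Real.log 2 := Real.log_pos (by norm_num)
  -- The constant comes from `log N ≤ N ^ (δ / 2) / (δ / 2)`; the final `+ 1` pays for the `1` in `d
  -- + 1`.
  obtain ⟨E, hE⟩ : ∃ E : ℝ, E = |c| / Real.log 2 / (δ / 2) + 1 := ⟨_, rfl⟩
  have hE0 : 0 ≤ E := by rw [hE]; positivity
  refine ⟨E ^ 2, by positivity, fun d N hN hd => ?_⟩
  have hN1 : (1 : ℝ) ≤ N := by exact_mod_cast hN
  have hlog := Real.log_le_rpow_div (show (0 : ℝ) ≤ N by linarith) (half_pos hδ)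
  have h1 : (1 : ℝ) ≤ (N : ℝ) ^ (δ / 2) := Real.one_le_rpow hN1 (by linarith)
  have hlogb : 0 ≤ Real.logb 2 N := Real.logb_nonneg (by norm_num) hN1
  have hd' : (d : ℝ) + 1 ≤ E * (N : ℝ) ^ (δ / 2) := by
    calc (d : ℝ) + 1 ≤ |c| * Real.logb 2 N + (N : ℝ) ^ (δ / 2) := by
          have := mul_le_mul_of_nonneg_right (le_abs_self c) hlogb
          linarith
      _ = |c| / Real.log 2 * Real.log N + (N : ℝ) ^ (δ / 2) := by
          rw [Real.logb]
          ring
      _ ≤ |c| / Real.log 2 * ((N : ℝ) ^ (δ / 2) / (δ / 2)) + (N : ℝ) ^ (δ / 2) := by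
          gcongr
      _ = E * (N : ℝ) ^ (δ / 2) := by
          rw [hE]
          ring
  calc ((d : ℝ) + 1) ^ 2 ≤ (E * (N : ℝ) ^ (δ / 2)) ^ 2 := by gcongr
    _ = E ^ 2 * (N : ℝ) ^ δ := by
      rw [mul_pow, ← Real.rpow_natCast ((N : ℝ) ^ (δ / 2)), ← Real.rpow_mul (by linarith)]
      norm_num

/-- The conjecture is applied with `ε / 2`: half of the saving pays for the factor `(d + 1) ^ 2`,
which is `O(N ^ (ε / 2))` in logarithmic dimension. -/
theorem OVC.not_decidedBy (h : OVC) {ε : ℝ} (hε : 0 < ε) (hε' : ε ≤ 1 / 2) {p : RamProgram} {a : ℕ}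
    {C : ℝ} (hC : 0 ≤ C) : ¬ OVTable.DecidedBy ε p a C := by
  intro hp
  obtain ⟨c, hc⟩ := h (ε / 2) (by linarith)
  obtain ⟨E, hE0, hE⟩ := exists_sq_le_rpow c (half_pos hε)
  -- The additional `3` in the word length makes room for the product of the two counts, and the `9`
  -- pays for the test.
  refine hc ⟨p.guardCounts, a + 3, C * E + 9, ?_⟩
  rintro ⟨x, hx⟩
  change ∃ s t, RamRun ((a + 3) * x.encode.length.size) p.guardCounts (RamState.init x.encode) s t ∧
    (∀ i (hi : i < (yesNo x.HasOrthogonalPair).length),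
      s.mem i = (yesNo x.HasOrthogonalPair)[i]) ∧ (t : ℝ) ≤ (C * E + 9) * (x.N : ℝ) ^ (2 - ε / 2)
  have hN1 : (1 : ℝ) ≤ x.N := by exact_mod_cast x.N_pos
  have hone : (1 : ℝ) ≤ (x.N : ℝ) ^ (2 - ε / 2) := Real.one_le_rpow hN1 (by linarith)
  obtain ⟨L, hL⟩ : ∃ L, L = x.encode.length := ⟨_, rfl⟩
  obtain ⟨z, hz⟩ : ∃ z, z = L.size := ⟨_, rfl⟩
  obtain ⟨w, hw⟩ : ∃ w, w = (a + 3) * z := ⟨_, rfl⟩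
  rw [← hL, ← hz, ← hw]
  have hLz : L < 2 ^ z := hz ▸ Nat.lt_size_self L
  have hL3 : 3 ≤ L := by
    rw [hL, OVInput.length_encode]
    omega
  have hn₁ : x.S₁.length ≤ L := hL ▸ OVInput.length_le_length_encode x.nodup₁ (by omega)
  have hn₂ : x.S₂.length ≤ L := hL ▸ OVInput.length_le_length_encode x.nodup₂ (by omega)
  have hzw : 2 ^ (2 * z) ≤ 2 ^ w := Nat.pow_le_pow_right (by omega) (by rw [hw]; nlinarith)
  have hz2 : 2 ^ z * 2 ^ z = 2 ^ (2 * z) := by rw [← pow_add]; ring_nf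
  have hmul : x.S₁.length * x.S₂.length < 2 ^ w := by nlinarith
  have hLw : L < 2 ^ w := by nlinarith
  obtain ⟨h0, h1⟩ := RamProgram.runs_guardCounts (p := p) (l := x.encode) (w := w) rfl rfl
    (by omega) (hn₁.trans_lt hLw) (hn₂.trans_lt hLw) hmul
  by_cases hne : x.S₁.length * x.S₂.length = 0
  · obtain ⟨s, ⟨t, hrun, ht⟩, hs⟩ := h0 hne
    refine ⟨s, t, hrun, ?_, ?_⟩
    · have hno : ¬ x.HasOrthogonalPair := by
        rintro ⟨u, hu, v, hv, -⟩
        have := List.length_pos_of_mem hu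
        have := List.length_pos_of_mem hv
        rcases Nat.mul_eq_zero.1 hne with h | h <;> omega
      rw [yesNo, if_neg hno]
      intro i hi
      obtain rfl : i = 0 := by simpa using hi
      exact hs
    · have : (t : ℝ) ≤ 7 := by exact_mod_cast ht
      nlinarith [mul_nonneg hC hE0]
  · have hp₁ : 0 < x.S₁.length := Nat.pos_of_ne_zero fun h => hne (by rw [h, Nat.zero_mul])
    have hp₂ : 0 < x.S₂.length := Nat.pos_of_ne_zero fun h => hne (by rw [h, Nat.mul_zero])
    have hsum : x.S₁.length + x.S₂.length + x.d ≤ L := by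
      rcases Nat.eq_zero_or_pos x.d with hd | hd
      · have := OVInput.length_le_one hd x.nodup₁
        have := OVInput.length_le_one hd x.nodup₂
        omega
      · rw [hL, OVInput.length_encode]
        nlinarith
    obtain ⟨s, t, hrun, hans, ht⟩ := hp (x.toTable hp₁ hp₂) w x.N
      (by
        rw [hw, hz]
        exact Nat.mul_le_mul (by omega) (Nat.size_le_size hsum)) x.card₁ x.card₂
    rw [OVInput.tableWords_toTable] at hrun
    obtain ⟨t', hrun', ht'⟩ := h1 hne s t ⟨t, hrun, le_rfl⟩
    refine ⟨s, t', hrun', ?_, ?_⟩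
    · rw [← propext (OVInput.hasOrthogonalPair_toTable hp₁ hp₂)]
      exact hans
    · have hd := hE x.d x.N x.N_pos hx
      calc (t' : ℝ) ≤ t + 9 := by exact_mod_cast ht'
        _ ≤ C * ((x.N : ℝ) ^ (2 - ε) * ((x.d : ℝ) + 1) ^ 2) + 9 := by
          have : (t : ℝ) ≤ C * ((x.N : ℝ) ^ (2 - ε) * ((x.d : ℝ) + 1) ^ 2) := ht
          linarith
        _ ≤ C * ((x.N : ℝ) ^ (2 - ε) * (E * (x.N : ℝ) ^ (ε / 2))) + 9 := by gcongr
        _ = C * E * ((x.N : ℝ) ^ (2 - ε) * (x.N : ℝ) ^ (ε / 2)) + 9 := by ring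
        _ = C * E * (x.N : ℝ) ^ (2 - ε / 2) + 9 := by
          rw [← Real.rpow_add (by linarith)]
          ring_nf
        _ ≤ (C * E + 9) * (x.N : ℝ) ^ (2 - ε / 2) := by nlinarith

/-! ### The Strong Exponential Time Hypothesis -/

theorem foldSeq_congr {a : ℕ} {f g : ℕ → ℕ → ℕ} {n : ℕ} (h : ∀ i < n, ∀ y, f i y = g i y) :
    foldSeq a f n = foldSeq a g n := by
  induction n with
  | zero => rfl
  | succ n ih => rw [foldSeq, foldSeq, ih fun i hi => h i (by omega), h n (by omega)]

theorem foldSeq_add (g : ℕ → ℕ) (n : ℕ) :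
    foldSeq 0 (fun i y => y + g i) n = ∑ i ∈ Finset.range n, g i := by
  induction n with
  | zero => rfl
  | succ n ih => rw [foldSeq, ih, Finset.sum_range_succ]

theorem foldSeq_double (n : ℕ) : foldSeq 1 (fun _ y => y + y) n = 2 ^ n := by
  induction n with
  | zero => rfl
  | succ n ih => rw [foldSeq, ih, pow_succ]; ring

namespace CNFInput

def clauseWords {n : ℕ} (C : List (Fin n × Bool)) : List ℕ :=
  C.length :: C.map fun l => 2 * (l.1 : ℕ) + l.2.toNat

variable (x : CNFInput)

def mem (a : ℕ) : ℕ := x.encode.getD a 0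

def clause (c : ℕ) : List (Fin x.n × Bool) := x.clauses.getD c []

/-- The address of clause `c`. -/
def pos (c : ℕ) : ℕ := foldSeq 2 (fun _ a => a + 1 + x.mem a) c

/-- The literal `l` is true if the variables from `lo` to `hi - 1` have the values given by the bits
of `j`. -/
def Matches {n : ℕ} (lo hi j : ℕ) (l : Fin n × Bool) : Prop :=
  lo ≤ (l.1 : ℕ) ∧ (l.1 : ℕ) < hi ∧ j.testBit (l.1 - lo) = l.2

open Classical in
/-- Whether no literal of clause `c` is made true by the partial assignment `j`. -/
noncomputable def entry (lo hi j c : ℕ) : Bool := decide (∀ l ∈ x.clause c, ¬ Matches lo hi j l)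

/-- The assignments to the first and to the second half of the variables, as vectors indexed by the
clauses. -/
noncomputable def table : OVTable where
  d := x.clauses.length
  n₁ := 2 ^ (x.n / 2)
  n₂ := 2 ^ (x.n - x.n / 2)
  A := x.entry 0 (x.n / 2)
  B := x.entry (x.n / 2) x.n
  n₁_pos := by positivity
  n₂_pos := by positivity

variable {x}

/-- A bit is one when the half assignment leaves the clause unsatisfied. So orthogonality means that
each clause is satisfied by one of the halves, and every variable belongs to exactly one half. -/
theorem hasOrthogonalPair_table : x.table.HasOrthogonalPair ↔ x.Satisfiable := by
  have hentry : ∀ lo hi j c, x.entry lo hi j c = false ↔ ∃ l ∈ x.clause c, Matches lo hi j l := by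
    intro lo hi j c
    simp only [entry, decide_eq_false_iff_not, not_forall, not_not, exists_prop]
  have hclause : ∀ {P : List (Fin x.n × Bool) → Prop},
      (∀ c < x.clauses.length, P (x.clause c)) ↔ ∀ C ∈ x.clauses, P C := by
    intro P
    constructor
    · intro h C hC
      obtain ⟨c, hc, rfl⟩ := List.getElem_of_mem hC
      have := h c hc
      rwa [clause, List.getD_eq_getElem _ _ hc] at this
    · intro h c hc
      rw [clause, List.getD_eq_getElem _ _ hc]
      exact h _ (List.getElem_mem hc)
  constructor
  · rintro ⟨j, -, k, -, h⟩
    refine ⟨fun v => if (v : ℕ) < x.n / 2 then j.testBit v else k.testBit (v - x.n / 2),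
      hclause.1 fun c hc => ?_⟩
    rcases h c hc with h | h
    · obtain ⟨l, hl, -, h2, h3⟩ := (hentry _ _ _ _).1 h
      exact ⟨l, hl, by simpa [h2] using h3⟩
    · obtain ⟨l, hl, h1, -, h3⟩ := (hentry _ _ _ _).1 h
      exact ⟨l, hl, by simpa [h1.not_gt] using h3⟩
  · rintro ⟨a, ha⟩
    let b : ℕ → Bool := fun v => if h : v < x.n then a ⟨v, h⟩ else false
    refine ⟨Nat.ofBits fun i : Fin (x.n / 2) => b i, Nat.ofBits_lt_two_pow _,
      Nat.ofBits fun i : Fin (x.n - x.n / 2) => b (x.n / 2 + i), Nat.ofBits_lt_two_pow _,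
      fun c hc => ?_⟩
    obtain ⟨l, hl, hal⟩ := hclause.2 ha c hc
    have hb : b l.1 = l.2 := by simp only [b, l.1.2, dif_pos, hal]
    change x.entry _ _ _ _ = false ∨ x.entry _ _ _ _ = false
    rw [hentry, hentry]
    rcases lt_or_ge (l.1 : ℕ) (x.n / 2) with h | h
    · exact .inl ⟨l, hl, Nat.zero_le _, h, by rw [Nat.sub_zero, Nat.testBit_ofBits_lt _ _ h, hb]⟩
    · refine .inr ⟨l, hl, h, l.1.2, ?_⟩
      rw [Nat.testBit_ofBits_lt _ _ (by have := l.1.2; omega)]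
      simp only [Nat.add_sub_cancel' h, hb]

/-- Clauses have varying lengths, so addresses are found by walking: the word at the address of a
clause is its length. The invariant is that the rest of the input encodes exactly the remaining
clauses. -/
theorem drop_pos {c : ℕ} (hc : c ≤ x.clauses.length) : x.pos c ≤ x.encode.length ∧
    x.encode.drop (x.pos c) = (x.clauses.drop c).flatMap clauseWords := by
  induction c with
  | zero => exact ⟨by simp [pos, foldSeq, encode], rfl⟩
  | succ c ih =>
    obtain ⟨ih₁, ih₂⟩ := ih (by omega)
    rw [List.drop_eq_getElem_cons (show c < x.clauses.length by omega), List.flatMap_cons] at ih₂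
    have hmem : x.mem (x.pos c) = x.clauses[c].length := by
      have := congrArg (List.getD · 0 0) ih₂
      simpa [mem, List.getD_eq_getElem?_getD, clauseWords] using this
    have hstep : x.pos (c + 1) = x.pos c + (1 + x.clauses[c].length) := by
      rw [← hmem, ← Nat.add_assoc]
      rfl
    have hlen : (clauseWords x.clauses[c]).length = 1 + x.clauses[c].length := by
      simp [clauseWords, Nat.add_comm]
    refine ⟨?_, ?_⟩
    · have := congrArg List.length ih₂
      rw [List.length_drop, List.length_append, hlen] at this
      omega
    · rw [hstep, ← List.drop_drop, ih₂, ← hlen, List.drop_left]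

theorem drop_pos_lt {c : ℕ} (hc : c < x.clauses.length) : x.encode.drop (x.pos c) =
    clauseWords (x.clause c) ++ (x.clauses.drop (c + 1)).flatMap clauseWords := by
  rw [(drop_pos hc.le).2, List.drop_eq_getElem_cons hc, List.flatMap_cons, clause,
    List.getD_eq_getElem _ _ hc]

theorem mem_pos {c : ℕ} (hc : c < x.clauses.length) : x.mem (x.pos c) = (x.clause c).length := by
  have := congrArg (List.getD · 0 0) (drop_pos_lt hc)
  simpa [mem, List.getD_eq_getElem?_getD, clauseWords] using this

theorem mem_literal {c i : ℕ} (hc : c < x.clauses.length) (hi : i < (x.clause c).length) :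
    x.mem (x.pos c + 1 + i) =
      2 * ((x.clause c)[i].1 : ℕ) + (x.clause c)[i].2.toNat := by
  have := congrArg (List.getD · (i + 1) 0) (drop_pos_lt hc)
  simp only [List.getD_eq_getElem?_getD, List.getElem?_drop, clauseWords, List.cons_append,
    List.getElem?_cons_succ] at this
  rw [List.getElem?_append_left (by simpa using hi), List.getElem?_map,
    List.getElem?_eq_getElem hi] at this
  rw [mem, List.getD_eq_getElem?_getD, show x.pos c + 1 + i = x.pos c + (i + 1) by omega, this]
  rfl

/-- The input length is not stored in the input; walking past the last clause computes it. -/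
theorem pos_length : x.pos x.clauses.length = x.encode.length := by
  obtain ⟨h₁, h₂⟩ := drop_pos (x := x) le_rfl
  have := congrArg List.length h₂
  simp at this
  omega

theorem length_clause_le {c : ℕ} (hc : c < x.clauses.length) :
    (x.clause c).length ≤ x.encode.length := by
  have := congrArg List.length (drop_pos_lt hc)
  simp only [List.length_drop, List.length_append, clauseWords, List.length_cons,
    List.length_map] at this
  omega

theorem length_le : x.clauses.length ≤ x.encode.length ∧ 2 ≤ x.encode.length := by
  simp only [encode, List.length_append, List.length_cons, List.length_nil, List.length_flatMap,
    List.length_map, List.sum_map_add, List.map_const', List.sum_replicate, smul_eq_mul]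
  omega

/-- The time bound of SETH mentions the number of clauses only; since clause lengths are bounded by
`k`, reading the input stays within it. -/
theorem length_encode_le {k : ℕ} (hk : ∀ C ∈ x.clauses, C.length ≤ k) :
    x.encode.length ≤ (k + 2) * (x.clauses.length + 1) := by
  have : ∀ L : List (List (Fin x.n × Bool)), (∀ C ∈ L, C.length ≤ k) →
      (L.flatMap clauseWords).length ≤ (k + 1) * L.length := by
    intro L
    induction L with
    | nil => simp
    | cons C L ih =>
      intro h
      have h1 := ih fun C hC => h C (List.mem_cons_of_mem _ hC)
      have h2 := h C List.mem_cons_self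
      simp only [List.flatMap_cons, List.length_append, clauseWords, List.length_cons,
        List.length_map] at h1 ⊢
      nlinarith
  have h := this x.clauses hk
  have : x.encode.length = 2 + (x.clauses.flatMap clauseWords).length := by
    simp [encode, clauseWords]
    omega
  nlinarith

theorem mem_le (a : ℕ) : x.mem a ≤ 2 ^ (x.n + 1) + x.encode.length := by
  have hn : x.n < 2 ^ x.n := Nat.lt_two_pow_self
  have hmem : ∀ v ∈ x.encode, v ≤ 2 ^ (x.n + 1) + x.encode.length := by
    intro v hv
    rw [pow_succ]
    simp only [encode, List.mem_append, List.mem_cons, List.not_mem_nil, or_false,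
      List.mem_flatMap, List.mem_map] at hv
    rcases hv with (rfl | rfl) | ⟨C, hC, rfl | ⟨l, -, rfl⟩⟩
    · omega
    · have := x.length_le.1
      omega
    · obtain ⟨c, hc, rfl⟩ := List.getElem_of_mem hC
      have := length_clause_le hc
      rw [clause, List.getD_eq_getElem _ _ hc] at this
      omega
    · have := l.1.2
      have := l.2.toNat_le
      omega
  rcases lt_or_ge a x.encode.length with h | h
  · rw [mem, List.getD_eq_getElem _ _ h]
    exact hmem _ (List.getElem_mem h)
  · rw [mem, List.getD_eq_default _ _ h]
    omega

/-! #### Generating the table -/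

open RamExpr RamGen

def nExpr : RamExpr := load (const 0)

def lengthExpr : RamExpr := load (const 1)

def halfExpr : RamExpr := op .div nExpr (const 2)

/-- Powers of two are computed by repeated doubling, because the left shift is not tame. -/
def powExpr (e : RamExpr) : RamExpr := fold e (const 1) (var 1 + var 1)

def posExpr (e : RamExpr) : RamExpr := fold e (const 2) (var 1 + const 1 + load (var 1))

/-- Whether the literal with word `u` is made true by the partial assignment `j`. -/
def matchExpr (lo hi j u : RamExpr) : RamExpr :=
  -- The first factor tests `lo ≤ v` for the variable `v` of the literal. Where it is one, the
  -- truncated difference `v - lo` in the last factor is the true one.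
  lo.lt (op .div u (const 2) + const 1) * (op .div u (const 2)).lt hi *
    op .eq (op .mod (op .shr j (op .sub (op .div u (const 2)) lo)) (const 2)) (op .mod u (const 2))

/-- The number of literals of clause `var 0` that are made true by the partial assignment
`var 1`. -/
def countExpr (lo hi : RamExpr) : RamExpr :=
  fold (load (posExpr (var 0))) (const 0) <|
    -- Inside the `fold` two variables have been pushed, so the clause is `var 2` and the assignment
    -- `var 3`.
    var 1 + matchExpr lo hi (var 3) (load (posExpr (var 2) + const 1 + var 0))

def rowsGen (lo hi : RamExpr) : RamGen :=
  rep (powExpr (op .sub hi lo)) <| rep lengthExpr <| emit <| op .eq (countExpr lo hi) (const 0)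

def tableGen : RamGen :=
  seq (emit lengthExpr) <| seq (emit (powExpr halfExpr)) <|
  seq (emit (powExpr (op .sub nExpr halfExpr))) <|
  seq (rowsGen (const 0) halfExpr) (rowsGen halfExpr nExpr)

theorem eval_nExpr (env : List ℕ) : nExpr.eval x.mem env = x.n := rfl

theorem eval_lengthExpr (env : List ℕ) : lengthExpr.eval x.mem env = x.clauses.length := rfl

theorem eval_halfExpr (env : List ℕ) : halfExpr.eval x.mem env = x.n / 2 := rfl

theorem eval_powExpr (e : RamExpr) (env : List ℕ) :
    (powExpr e).eval x.mem env = 2 ^ e.eval x.mem env :=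
  foldSeq_double _

theorem eval_posExpr (e : RamExpr) (env : List ℕ) :
    (posExpr e).eval x.mem env = x.pos (e.eval x.mem env) := rfl

open Classical in
theorem eval_matchExpr (lo hi j u : RamExpr) (env : List ℕ) (l : Fin x.n × Bool)
    (hu : u.eval x.mem env = 2 * (l.1 : ℕ) + l.2.toNat) :
    (matchExpr lo hi j u).eval x.mem env =
      if Matches (lo.eval x.mem env) (hi.eval x.mem env) (j.eval x.mem env) l then 1 else 0 := by
  obtain ⟨v, b⟩ := l
  have h1 : (2 * (v : ℕ) + b.toNat) / 2 = v := by have := b.toNat_le; omega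
  have h2 : (2 * (v : ℕ) + b.toNat) % 2 = b.toNat := by have := b.toNat_le; omega
  have h3 : ∀ j k : ℕ, (j >>> k) % 2 = b.toNat ↔ j.testBit k = b := by
    intro j k
    rw [Nat.shiftRight_eq_div_pow, ← Nat.toNat_testBit]
    cases j.testBit k <;> cases b <;> decide
  change (if lo.eval x.mem env < u.eval x.mem env / 2 + 1 then 1 else 0) *
    (if u.eval x.mem env / 2 < hi.eval x.mem env then 1 else 0) *
    (if (j.eval x.mem env >>> (u.eval x.mem env / 2 - lo.eval x.mem env)) % 2 =
      u.eval x.mem env % 2 then 1 else 0) = _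
  rw [hu, h1, h2, Matches]
  simp only [h3, Nat.lt_succ_iff]
  by_cases c1 : lo.eval x.mem env ≤ v <;> by_cases c2 : v < hi.eval x.mem env <;> simp [c1, c2]

open Classical in
/-- The partial sums computed by `countExpr`. -/
theorem eval_countExpr_aux {lo hi : RamExpr} {a b : ℕ} (hlo : ∀ env, lo.eval x.mem env = a)
    (hhi : ∀ env, hi.eval x.mem env = b) {c j i : ℕ} (hc : c < x.clauses.length)
    (hle : i ≤ (x.clause c).length) :
    foldSeq 0 (fun i y => (var 1 + matchExpr lo hi (var 3)
      (load (posExpr (var 2) + const 1 + var 0))).eval x.mem (i :: y :: [c, j])) i =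
      ∑ i ∈ Finset.range i, if h : i < (x.clause c).length then
        if Matches a b j (x.clause c)[i] then 1 else 0 else 0 := by
  rw [← foldSeq_add]
  refine foldSeq_congr fun i' hi' y => ?_
  rw [dif_pos (by omega)]
  refine congrArg (y + ·) ?_
  have h := eval_matchExpr lo hi (var 3) (load (posExpr (var 2) + const 1 + var 0)) [i', y, c, j]
    (x.clause c)[i'] (mem_literal (i := i') hc (by omega))
  rw [hlo, hhi] at h
  exact h

open Classical in
theorem eval_countExpr {lo hi : RamExpr} {a b : ℕ} (hlo : ∀ env, lo.eval x.mem env = a)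
    (hhi : ∀ env, hi.eval x.mem env = b) {c j : ℕ} (hc : c < x.clauses.length) :
    (op .eq (countExpr lo hi) (const 0)).eval x.mem [c, j] = (x.entry a b j c).toNat := by
  have h : (countExpr lo hi).eval x.mem [c, j] = ∑ i ∈ Finset.range (x.clause c).length,
      if h : i < (x.clause c).length then
        if Matches a b j (x.clause c)[i] then 1 else 0 else 0 := by
    rw [← eval_countExpr_aux hlo hhi hc le_rfl, ← mem_pos hc]
    rfl
  change (if (countExpr lo hi).eval x.mem [c, j] = 0 then 1 else 0) = _
  have hiff : (countExpr lo hi).eval x.mem [c, j] = 0 ↔ ∀ l ∈ x.clause c, ¬ Matches a b j l := by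
    rw [h, Finset.sum_eq_zero_iff]
    constructor
    · intro h l hl
      obtain ⟨i, hi, rfl⟩ := List.getElem_of_mem hl
      simpa [hi] using h i (Finset.mem_range.2 hi)
    · intro h i hi
      rw [Finset.mem_range] at hi
      rw [dif_pos hi, if_neg (h _ (List.getElem_mem hi))]
  simp only [hiff, entry]
  by_cases h : ∀ l ∈ x.clause c, ¬ Matches a b j l
  · rw [if_pos h, decide_eq_true h]
    rfl
  · rw [if_neg h, decide_eq_false h]
    rfl

theorem out_rowsGen {lo hi : RamExpr} {a b : ℕ} (hlo : ∀ env, lo.eval x.mem env = a)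
    (hhi : ∀ env, hi.eval x.mem env = b) : (rowsGen lo hi).out x.mem [] =
      (List.range (2 ^ (b - a))).flatMap fun j =>
        (List.range x.clauses.length).map fun c => (x.entry a b j c).toNat := by
  rw [rowsGen, out, eval_powExpr]
  simp only [eval, BinOp.eval, hlo, hhi]
  refine List.flatMap_congr fun j _ => ?_
  rw [out, eval_lengthExpr, List.map_eq_flatMap]
  refine List.flatMap_congr fun c hc => ?_
  rw [out, eval_countExpr hlo hhi (List.mem_range.1 hc)]

theorem out_tableGen : tableGen.out x.mem [] = x.table.tableWords := by
  simp only [tableGen, out, eval_powExpr, out_rowsGen (x := x) (lo := const 0) (fun _ => rfl)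
    eval_halfExpr, out_rowsGen (x := x) eval_halfExpr eval_nExpr, eval_lengthExpr]
  rfl

/-! ### Bounds on values and running time for the table generator -/

theorem pos_le {c : ℕ} (hc : c ≤ x.clauses.length) : x.pos c ≤ x.encode.length :=
  (drop_pos hc).1

theorem ok_posExpr {e : RamExpr} {env : List ℕ} {B : ℕ} (he : e.Ok x.mem B env)
    (hB : x.encode.length ≤ B) (hc : e.eval x.mem env ≤ x.clauses.length) :
    (posExpr e).Ok x.mem B env :=
  ⟨he, trivial, hc.trans (x.length_le.1.trans hB),
    fun _ hi => (pos_le (hi.trans hc)).trans hB, fun _ _ => ⟨trivial, ⟨trivial, trivial, trivial⟩, trivial⟩⟩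

theorem ok_powExpr {e : RamExpr} {env : List ℕ} {B : ℕ} (he : e.Ok x.mem B env)
    (hB : 2 ^ x.n ≤ B) (hc : e.eval x.mem env ≤ x.n) : (powExpr e).Ok x.mem B env := by
  have hpow : ∀ i ≤ x.n, 2 ^ i ≤ B := fun i hi => (Nat.pow_le_pow_right (by omega) hi).trans hB
  refine ⟨he, trivial, hc.trans (Nat.lt_two_pow_self.le.trans hB), fun i hi => ?_,
    fun _ _ => ⟨trivial, trivial, trivial⟩⟩
  exact (foldSeq_double i).le.trans (hpow i (hi.trans hc))

theorem ok_countExpr {lo hi : RamExpr} {a b : ℕ} (hlo : ∀ env, lo.eval x.mem env = a)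
    (hhi : ∀ env, hi.eval x.mem env = b) {B : ℕ} (hlo' : ∀ env, lo.Ok x.mem B env)
    (hhi' : ∀ env, hi.Ok x.mem B env) (hB : x.encode.length ≤ B) {c j : ℕ}
    (hc : c < x.clauses.length) : (countExpr lo hi).Ok x.mem B [c, j] := by
  classical
  have hn : (load (posExpr (var 0))).eval x.mem [c, j] = (x.clause c).length := mem_pos hc
  refine ⟨ok_posExpr trivial hB hc.le, trivial, ?_, fun i hi => ?_, fun i hi => ?_⟩
  · rw [hn]
    exact (length_clause_le hc).trans hB
  · rw [hn] at hi
    refine (eval_countExpr_aux hlo hhi hc hi).le.trans ?_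
    refine (Finset.sum_le_card_nsmul _ _ 1 fun i _ => ?_).trans ?_
    · split_ifs <;> simp
    · rw [Finset.card_range, smul_eq_mul, mul_one]
      exact hi.trans ((length_clause_le hc).trans hB)
  · have : ∀ y, (posExpr (var 2)).Ok x.mem B [i, y, c, j] := fun y => ok_posExpr trivial hB hc.le
    simp [matchExpr, RamExpr.Ok, RamExpr.lt, BinOp.Tame, this, hlo', hhi']

theorem ok_rowsGen {lo hi : RamExpr} {a b : ℕ} (hlo : ∀ env, lo.eval x.mem env = a)
    (hhi : ∀ env, hi.eval x.mem env = b) {B : ℕ} (hlo' : ∀ env, lo.Ok x.mem B env)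
    (hhi' : ∀ env, hi.Ok x.mem B env) (hB : x.encode.length ≤ B) (hB' : 2 ^ x.n ≤ B)
    (hb : b ≤ x.n) : (rowsGen lo hi).Ok x.mem B [] := by
  have he : (op .sub hi lo).eval x.mem [] = b - a := by
    simp only [eval, BinOp.eval, hlo, hhi]
  refine ⟨ok_powExpr ⟨trivial, hhi' _, hlo' _⟩ hB' (by omega), ?_, fun j _ =>
    ⟨trivial, x.length_le.1.trans hB, fun c hc =>
      ⟨trivial, ok_countExpr hlo hhi hlo' hhi' hB hc, trivial⟩⟩⟩
  rw [eval_powExpr, he]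
  exact (Nat.pow_le_pow_right (by omega) (by omega)).trans hB'

theorem ok_tableGen {B : ℕ} (hB : x.encode.length ≤ B) (hB' : 2 ^ x.n ≤ B) :
    tableGen.Ok x.mem B [] := by
  have hn : ∀ env, nExpr.Ok x.mem B env := fun _ => trivial
  have hh : ∀ env, halfExpr.Ok x.mem B env := fun _ => ⟨trivial, trivial, trivial⟩
  refine ⟨trivial, ok_powExpr (hh _) hB' ?_, ok_powExpr ⟨trivial, hn _, hh _⟩ hB' ?_,
    ok_rowsGen (fun _ => rfl) eval_halfExpr (fun _ => trivial) hh hB hB' (Nat.div_le_self _ _),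
    ok_rowsGen eval_halfExpr eval_nExpr hh hn hB hB' le_rfl⟩
  · rw [eval_halfExpr]
    omega
  · simp only [eval, BinOp.eval, eval_nExpr, eval_halfExpr]
    omega

theorem cost_posExpr_le (e : RamExpr) (env : List ℕ) :
    (posExpr e).cost x.mem env ≤ e.cost x.mem env + 3 + 13 * e.eval x.mem env := by
  simp only [posExpr, RamExpr.cost, Finset.sum_const, Finset.card_range, smul_eq_mul]
  omega

theorem cost_powExpr_le (e : RamExpr) (env : List ℕ) :
    (powExpr e).cost x.mem env ≤ e.cost x.mem env + 3 + 8 * e.eval x.mem env := by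
  simp only [powExpr, RamExpr.cost, Finset.sum_const, Finset.card_range, smul_eq_mul]
  omega

/-- The address of the clause is recomputed for each of the at most `k` literals, each time by a
walk through the preceding clauses. This wastes a factor of the number of clauses, which the
polynomial factor in SETH tolerates. -/
theorem cost_countExpr_le {lo hi : RamExpr} (hlo : ∀ env, lo.cost x.mem env ≤ 6)
    (hhi : ∀ env, hi.cost x.mem env ≤ 6) {k : ℕ} (hk : ∀ C ∈ x.clauses, C.length ≤ k) {c j : ℕ}
    (hc : c < x.clauses.length) :
    (countExpr lo hi).cost x.mem [c, j] ≤ 200 * (k + 1) * (x.clauses.length + 1) := by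
  have hpos : ∀ y z, (posExpr (var 2)).cost x.mem [y, z, c, j] ≤ 4 + 13 * c :=
    fun _ _ => (cost_posExpr_le _ _).trans (by simp [RamExpr.cost, eval])
  have hpos' : (posExpr (var 0)).cost x.mem [c, j] ≤ 4 + 13 * c :=
    (cost_posExpr_le _ _).trans (by simp [RamExpr.cost, eval])
  have hn : (load (posExpr (var 0))).eval x.mem [c, j] ≤ k := by
    have h : (load (posExpr (var 0))).eval x.mem [c, j] = (x.clause c).length := mem_pos hc
    rw [h, clause, List.getD_eq_getElem _ _ hc]
    exact hk _ (List.getElem_mem hc)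
  rw [countExpr, RamExpr.cost]
  refine (Nat.add_le_add_left (Finset.sum_le_card_nsmul _ _ (187 + 52 * c) fun i _ => ?_) _).trans ?_
  · generalize foldSeq _ _ i = y
    have := hpos i y
    have := hlo [i, y, c, j]
    have := hhi [i, y, c, j]
    simp only [matchExpr, RamExpr.lt, RamExpr.cost] at *
    omega
  · rw [Finset.card_range, smul_eq_mul]
    simp only [RamExpr.cost]
    have h1 := Nat.mul_le_mul hn (show 187 + 52 * c ≤ 187 * (x.clauses.length + 1) by omega)
    nlinarith

/-- There are at most `2 ^ h` rows with one entry for each clause, and an entry takes time linear in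
the number of clauses for fixed `k`. -/
theorem cost_rowsGen_le {lo hi : RamExpr} {a b : ℕ} (hlo : ∀ env, lo.eval x.mem env = a)
    (hhi : ∀ env, hi.eval x.mem env = b) (hlo' : ∀ env, lo.cost x.mem env ≤ 6)
    (hhi' : ∀ env, hi.cost x.mem env ≤ 6) {k h : ℕ} (hk : ∀ C ∈ x.clauses, C.length ≤ k)
    (hh : b - a ≤ h) :
    (rowsGen lo hi).cost x.mem [] ≤ 1000 * (k + 1) * (2 ^ h * (x.clauses.length + 1) ^ 2) := by
  obtain ⟨E, hE⟩ : ∃ E, E = 200 * (k + 1) * (x.clauses.length + 1) + 9 := ⟨_, rfl⟩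
  have he : (op .sub hi lo).eval x.mem [] = b - a := by
    simp only [eval, BinOp.eval, hlo, hhi]
  have hec : (op .sub hi lo).cost x.mem [] ≤ 13 := by
    have := hlo' []
    have := hhi' []
    simp only [RamExpr.cost]
    omega
  have hpow := (cost_powExpr_le (op .sub hi lo) []).trans
    (show _ ≤ 16 + 8 * h by rw [he]; omega)
  have hinner : ∀ j, (rep lengthExpr <| emit <| op .eq (countExpr lo hi) (const 0)).cost x.mem [j] ≤
      6 + x.clauses.length * E := by
    intro j
    rw [RamGen.cost]
    refine (Nat.add_le_add_left (Finset.sum_le_card_nsmul _ _ E fun c hc => ?_) _).trans ?_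
    · rw [eval_lengthExpr, Finset.mem_range] at hc
      have := cost_countExpr_le hlo' hhi' hk hc (j := j)
      simp only [RamGen.cost, RamExpr.cost]
      omega
    · rw [Finset.card_range, eval_lengthExpr]
      rfl
  rw [rowsGen, RamGen.cost]
  refine (Nat.add_le_add (Nat.add_le_add_right hpow 2) (Finset.sum_le_card_nsmul _ _ (10 + x.clauses.length * E)
    fun j _ => ?_)).trans ?_
  · have := hinner j
    omega
  · rw [Finset.card_range, eval_powExpr, he, smul_eq_mul]
    have hP : 2 ^ (b - a) ≤ 2 ^ h := Nat.pow_le_pow_right (by omega) hh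
    have hhP : h < 2 ^ h := Nat.lt_two_pow_self
    obtain ⟨Z, hZ⟩ : ∃ Z, Z = (k + 1) * (x.clauses.length + 1) ^ 2 := ⟨_, rfl⟩
    have hE' : 10 + x.clauses.length * E ≤ 219 * Z := by
      rw [hE, hZ]
      nlinarith [Nat.zero_le (k * x.clauses.length), Nat.zero_le (k * x.clauses.length ^ 2)]
    have hZ1 : 1 ≤ Z := hZ ▸ Nat.mul_pos (by omega) (by positivity)
    calc 16 + 8 * h + 2 + 2 ^ (b - a) * (10 + x.clauses.length * E)
        ≤ 26 * 2 ^ h * Z + 2 ^ h * (219 * Z) :=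
          Nat.add_le_add (le_trans (by omega) (Nat.le_mul_of_pos_right _ hZ1)) (Nat.mul_le_mul hP hE')
      _ ≤ 1000 * 2 ^ h * Z := by nlinarith
      _ = _ := by rw [hZ]; ring

theorem cost_tableGen_le {k : ℕ} (hk : ∀ C ∈ x.clauses, C.length ≤ k) :
    tableGen.cost x.mem [] ≤
      3000 * (k + 1) * (2 ^ (x.n - x.n / 2) * (x.clauses.length + 1) ^ 2) := by
  obtain ⟨h, hh⟩ : ∃ h, h = x.n - x.n / 2 := ⟨_, rfl⟩
  have c1 := cost_powExpr_le (x := x) halfExpr []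
  have c2 := cost_powExpr_le (x := x) (op .sub nExpr halfExpr) []
  have c3 := cost_rowsGen_le (x := x) (lo := const 0) (fun _ => rfl) eval_halfExpr
    (fun _ => by simp [RamExpr.cost]) (fun _ => le_rfl) hk (h := h) (by omega)
  have c4 := cost_rowsGen_le (x := x) eval_halfExpr eval_nExpr
    (fun _ => le_rfl) (fun _ => by simp [nExpr, RamExpr.cost]) hk (h := h) (by omega)
  have e1 : (op .sub nExpr halfExpr).eval x.mem [] = h := by
    rw [hh]
    rfl
  have e2 : (op .sub nExpr halfExpr).cost x.mem [] = 11 := rfl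
  have e3 : halfExpr.cost x.mem [] = 6 := rfl
  rw [eval_halfExpr, e3] at c1
  rw [e1, e2] at c2
  have hhP : h < 2 ^ h := Nat.lt_two_pow_self
  have hle : 2 ^ h ≤ (k + 1) * (2 ^ h * (x.clauses.length + 1) ^ 2) := by
    calc 2 ^ h = 1 * (2 ^ h * 1) := by ring
      _ ≤ _ := Nat.mul_le_mul (by omega) (Nat.mul_le_mul_left _ (Nat.one_le_pow _ _ (by omega)))
  have c0 : lengthExpr.cost x.mem [] = 4 := rfl
  rw [← hh]
  rw [Nat.mul_assoc] at c3 c4 ⊢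
  simp only [tableGen, RamGen.cost, c0]
  omega

end CNFInput

-- SETH is applied with `ε / 2` and `N = 2 ^ ⌈n / 2⌉`. Then `N ^ (2 - ε) ≤ 2 * 2 ^ ((1 - ε / 2) *
-- n)`, the factor `2` stemming from odd `n`. Building the table takes time about `N` times the
-- square of the number of clauses, which is within the same bound.
set_option maxHeartbeats 1000000 in
open CNFInput in
theorem SETH.not_decidedBy (h : SETH) {ε : ℝ} (hε : 0 < ε) (hε' : ε ≤ 1 / 2) {p : RamProgram} {a : ℕ}
    {C : ℝ} (hC : 0 ≤ C) : ¬ OVTable.DecidedBy ε p a C := by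
  intro hp
  obtain ⟨k, hk⟩ := h (ε / 2) (by linarith)
  obtain ⟨g, hg⟩ : ∃ g, g = tableGen := ⟨_, rfl⟩
  obtain ⟨o, ho⟩ : ∃ o, o = posExpr lengthExpr := ⟨_, rfl⟩
  obtain ⟨R, hR⟩ : ∃ R, R = (g.transform o 0).regBound := ⟨_, rfl⟩
  -- The polynomial in SETH has exponent `2`, since the dimension of the table is the number of
  -- clauses. The word length contains `2 * a` because `n₁ + n₂ + d` has at most `2 * S` bits.
  refine hk 2 ⟨.seq (g.transform o R) p, 2 * a + 2 * o.size + 2 * g.size + 10,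
    2 * (24000 * (k + 1) + 7 * (k + 2) + R + 30) + 2 * C, ?_⟩
  rintro ⟨x, hx⟩
  change ∃ s t, RamRun ((2 * a + 2 * o.size + 2 * g.size + 10) * (x.n + x.encode.length.size))
      (.seq (g.transform o R) p) (RamState.init x.encode) s t ∧
    (∀ i (hi : i < (yesNo x.Satisfiable).length), s.mem i = (yesNo x.Satisfiable)[i]) ∧
    (t : ℝ) ≤ (2 * (24000 * (k + 1) + 7 * (k + 2) + R + 30) + 2 * C) *
      ((2 : ℝ) ^ ((1 - ε / 2) * (x.n : ℝ)) * ((x.clauses.length : ℝ) + 1) ^ 2)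
  obtain ⟨L, hL⟩ : ∃ L, L = x.encode.length := ⟨_, rfl⟩
  obtain ⟨m, hm⟩ : ∃ m, m = x.clauses.length := ⟨_, rfl⟩
  obtain ⟨S, hS⟩ : ∃ S, S = x.n + L.size := ⟨_, rfl⟩
  obtain ⟨w, hw⟩ : ∃ w, w = (2 * a + 2 * o.size + 2 * g.size + 10) * S := ⟨_, rfl⟩
  obtain ⟨H, hH⟩ : ∃ H, H = x.n - x.n / 2 := ⟨_, rfl⟩
  rw [← hL, ← hm, ← hS, ← hw]
  have hLm : m ≤ L ∧ 2 ≤ L := hL ▸ hm ▸ x.length_le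
  have hLz : L < 2 ^ L.size := Nat.lt_size_self L
  have hz : 2 ≤ L.size := by
    by_contra hlt
    have : 2 ^ L.size ≤ 2 ^ 1 := Nat.pow_le_pow_right (by omega) (by omega)
    omega
  have hn : 2 ^ x.n * 2 ^ L.size = 2 ^ S := by rw [hS, pow_add]
  have hn1 : 1 ≤ 2 ^ x.n := Nat.one_le_two_pow
  have hz4 : 4 ≤ 2 ^ L.size := Nat.pow_le_pow_right (n := 2) (by omega) hz
  have hB : 2 ^ (x.n + 1) + L < 2 ^ (2 * S) := by
    calc 2 ^ (x.n + 1) + L < 2 * 2 ^ S := by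
          rw [pow_succ, ← hn]
          nlinarith
      _ = 2 ^ (S + 1) := by rw [pow_succ]; ring
      _ ≤ 2 ^ (2 * S) := Nat.pow_le_pow_right (by omega) (by omega)
  have hBpow : ∀ i, i < a + o.size + g.size + 5 → (2 ^ (x.n + 1) + L) ^ i < 2 ^ w := by
    intro i hi
    calc (2 ^ (x.n + 1) + L) ^ i ≤ (2 ^ (2 * S)) ^ i := Nat.pow_le_pow_left hB.le i
      _ = 2 ^ (2 * i * S) := by rw [← pow_mul]; ring_nf
      _ < 2 ^ w := Nat.pow_lt_pow_right (by omega) (by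
        rw [hw]
        exact Nat.mul_lt_mul_of_pos_right (by omega) (by omega))
  have h₁ : 2 ^ (x.n / 2) ≤ 2 ^ H := Nat.pow_le_pow_right (by omega) (by omega)
  have h₂ : 2 ^ H ≤ 2 ^ x.n := Nat.pow_le_pow_right (by omega) (by omega)
  have hlenT : x.table.tableWords.length = 3 + (2 ^ (x.n / 2) + 2 ^ H) * m := by
    rw [OVTable.length_tableWords, hm, hH]
    rfl
  have hcost : g.cost x.mem [] ≤ 3000 * (k + 1) * (2 ^ H * (m + 1) ^ 2) := by
    rw [hg, hm, hH]
    exact cost_tableGen_le hx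
  have hout : g.out x.mem [] = x.table.tableWords := by
    rw [hg]
    exact out_tableGen
  have heval : o.eval x.mem [] = L := by
    rw [ho, eval_posExpr, eval_lengthExpr, pos_length, hL]
  have hocost : o.cost x.mem [] ≤ 7 + 13 * m := by
    rw [ho, hm]
    exact cost_posExpr_le lengthExpr []
  have hLk : L ≤ (k + 2) * (m + 1) := by
    rw [hL, hm]
    exact length_encode_le hx
  obtain ⟨t₁, hrun₁, ht₁⟩ := RamGen.runs_transform (g := g) (off := o) (M := x.mem) (w := w)
    (R := R) (input := x.encode) (B := 2 ^ (x.n + 1) + L) (fun _ => rfl) (by omega)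
    (fun a => hL ▸ mem_le a) (hBpow _ (by omega)) (hBpow _ (by omega))
    (by
      rw [ho]
      exact ok_posExpr trivial (by omega) le_rfl)
    (by
      rw [hg]
      exact ok_tableGen (by omega) (by rw [pow_succ]; omega)) (by rw [heval, hL])
    (by
      rw [heval, hout, hlenT]
      refine lt_of_le_of_lt ?_ (hBpow 4 (by omega))
      have : (2 ^ (x.n / 2) + 2 ^ H) * m ≤ 2 * 2 ^ x.n * L :=
        Nat.mul_le_mul (by omega) hLm.1
      have hL2 := hLm.2
      obtain ⟨b, hb⟩ : ∃ b, b = 2 ^ (x.n + 1) + L := ⟨_, rfl⟩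
      rw [← hb]
      have hb' : b = 2 * 2 ^ x.n + L := by rw [hb, pow_succ, mul_comm]
      have h5 : 2 * 2 ^ x.n * L ≤ b * b := Nat.mul_le_mul (by omega) (by omega)
      have h6 : b ^ 4 = b * b * (b * b) := by ring
      have h7 : 4 * b ≤ b * b := Nat.mul_le_mul_right _ (by omega)
      have h8 : 16 * (b * b) ≤ b * b * (b * b) := Nat.mul_le_mul_right _ (by omega)
      omega) hR.ge (RamState.init x.encode)
    (RamState.init_eq fun _ => rfl) (fun _ _ => rfl)
  rw [hout] at hrun₁
  rw [heval] at ht₁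
  -- The larger half has `H` variables, so `2 ^ H` bounds the number of vectors on both sides.
  obtain ⟨s, t, hrun, hans, ht⟩ := hp x.table w (2 ^ H) (by
      have : (2 ^ (x.n / 2) + 2 ^ H + m).size ≤ 2 * S := by
        rw [Nat.size_le]
        refine lt_of_le_of_lt ?_ hB
        rw [pow_succ]
        omega
      calc a * (2 ^ (x.n / 2) + 2 ^ (x.n - x.n / 2) + x.clauses.length).size ≤ a * (2 * S) := by
            rw [← hH, ← hm]
            exact Nat.mul_le_mul_left _ this
        _ = 2 * a * S := by ring
        _ ≤ w := hw ▸ Nat.mul_le_mul_right _ (by omega)) h₁ (hH ▸ le_rfl)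
  refine ⟨s, t₁ + t, .seq _ _ _ _ _ _ _ hrun₁ hrun, ?_, ?_⟩
  · rw [← propext hasOrthogonalPair_table]
    exact hans
  · obtain ⟨Y, hY⟩ : ∃ Y : ℝ, Y = (2 : ℝ) ^ ((1 - ε / 2) * (x.n : ℝ)) := ⟨_, rfl⟩
    obtain ⟨Q, hQ⟩ : ∃ Q : ℝ, Q = ((m : ℝ) + 1) ^ 2 := ⟨_, rfl⟩
    have hn0 : (0 : ℝ) ≤ x.n := Nat.cast_nonneg _
    have hHn : (H : ℝ) ≤ (x.n : ℝ) / 2 + 1 / 2 := by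
      have : 2 * H ≤ x.n + 1 := by omega
      have : ((2 * H : ℕ) : ℝ) ≤ ((x.n + 1 : ℕ) : ℝ) := Nat.cast_le.2 this
      push_cast at this
      linarith
    have hpow : ∀ r : ℝ, r ≤ (1 - ε / 2) * x.n + 1 → (2 : ℝ) ^ r ≤ 2 * Y := by
      intro r hr
      calc (2 : ℝ) ^ r ≤ 2 ^ ((1 - ε / 2) * (x.n : ℝ) + 1) :=
            Real.rpow_le_rpow_of_exponent_le (by norm_num) hr
        _ = 2 * Y := by
          rw [Real.rpow_add (by norm_num), Real.rpow_one, hY]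
          ring
    have hHY : (2 : ℝ) ^ H ≤ 2 * Y := by
      rw [← Real.rpow_natCast]
      exact hpow _ (by nlinarith)
    have hHY' : (((2 ^ H : ℕ) : ℝ)) ^ (2 - ε) ≤ 2 * Y := by
      push_cast
      rw [← Real.rpow_natCast, ← Real.rpow_mul (by norm_num)]
      exact hpow _ (by nlinarith)
    have ht₁' : t₁ ≤ (24000 * (k + 1) + 7 * (k + 2) + R + 30) * (2 ^ H * (m + 1) ^ 2) := by
      obtain ⟨W, hW⟩ : ∃ W, W = 2 ^ H * (m + 1) ^ 2 := ⟨_, rfl⟩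
      have hW1 : m + 1 ≤ W := by
        calc m + 1 ≤ 1 * (m + 1) ^ 2 := by nlinarith
          _ ≤ W := hW ▸ Nat.mul_le_mul_right _ Nat.one_le_two_pow
      rw [← hW] at hcost ⊢
      have := hLk.trans (Nat.mul_le_mul_left (k + 2) hW1)
      nlinarith
    have ht₁R : (t₁ : ℝ) ≤ (24000 * (k + 1) + 7 * (k + 2) + R + 30) * (2 ^ H * Q) := by
      rw [hQ]
      exact_mod_cast ht₁'
    have htd : (t : ℝ) ≤ C * (((2 ^ H : ℕ) : ℝ) ^ (2 - ε) * Q) := by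
      rw [hQ, hm]
      exact ht
    have hQ0 : 0 ≤ Q := by rw [hQ]; positivity
    rw [← hY, ← hQ]
    push_cast
    calc (t₁ : ℝ) + t ≤ (24000 * (k + 1) + 7 * (k + 2) + R + 30) * (2 * Y * Q) +
          C * (2 * Y * Q) := by
          refine add_le_add (ht₁R.trans ?_) (htd.trans ?_) <;> gcongr
      _ = _ := by ring

theorem mainTheorem8 (h : SETH ∨ OVC) :
    buchiQuery.NoFastAlgorithm ∧
    coBuchiObjective.NoFastAlgorithm ∧
    coBuchiQuery.NoFastAlgorithm ∧
    singletonCoBuchiObjective.NoFastAlgorithm ∧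
    singletonCoBuchiQuery.NoFastAlgorithm ∧
    rabinObjective.NoFastAlgorithm := by
  have H : ∀ ε, 0 < ε → ε ≤ 1 / 2 → ∀ p a C, 0 ≤ C → ¬ OVTable.DecidedBy ε p a C :=
    fun ε hε hε' p a C hC => h.elim (fun h => h.not_decidedBy hε hε' hC)
      fun h => h.not_decidedBy hε hε' hC
  exact ⟨OVTable.buchiQuery_reducesTo.noFastAlgorithm H,
    OVTable.coBuchiObjective_reducesTo.noFastAlgorithm H,
    OVTable.coBuchiQuery_reducesTo.noFastAlgorithm H,
    OVTable.singletonCoBuchiObjective_reducesTo.noFastAlgorithm H,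
    OVTable.singletonCoBuchiQuery_reducesTo.noFastAlgorithm H,
    OVTable.rabinObjective_reducesTo.noFastAlgorithm H⟩
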